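/- **Definitions.** A simple stochastic multiplayer game (SSMG) has a finite set of players, a finite set $V$ of vertices, each of which is either controlled by exactly one player, who chooses among a nonempty set of successors, or stochastic, with a probability distribution on $V$; a successor of a stochastic vertex is a vertex of positive probability. For each player $i$ there is a set $F_i\subseteq V$ of vertices $v$ whose only successor is $v$ itself. A strategy of player $i$ maps each history ending in a vertex $v$ of player $i$ to a probability distribution on the successors of $v$; it is stationary if it depends only on $v$. A strategy profile and an initial vertex induce a probability measure on infinite plays, and the payoff of player $i$ is the probability of reaching $F_i$. A Nash equilibrium is a strategy profile in which no player can increase her payoff by switching alone to any other strategy, stationary or not; it is stationary if all its strategies are. * **SqrtSum**: given $d_1,\dots,d_n,k\in\mathbb N$ in binary, decide whether $\sum_{i=1}^n\sqrt{d_i}\ge k$. * **StatNE**: given an SSMG with rational transition probabilities, an initial vertex, and rational threshold vectors $x,y$ with one entry in $[0,1]$ for each player (fractions are given by numerator and denominator in binary), decide whether there is a stationary Nash equilibrium whose payoff vector is $\ge x$ and $\le y$ componentwise. For $p\in[\tfrac12,1)$ let $G(p)$ be the following SSMG with players $0,1,2,3$ and initial vertex $s$. At $s$, player 1 moves to $a_1$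 or ends the game with payoff $(1,\tfrac12,0,0)$. At the stochastic vertex $a_1$ the game moves to $s_1$ with probability $p$ and ends with payoff $(1,0,0,1)$ with probability $1-p$. At $s_1$, player 0 moves to $t$ or ends the game with payoff $(1,1,0,0)$. At $t$, player 2 moves to $a_2$ or ends the game with payoff $(1,0,\tfrac12,0)$. At the stochastic vertex $a_2$ the game moves to $s_2$ with probability $p$ and ends with payoff $(1,0,0,0)$ with probability $1-p$. At $s_2$, player 0 moves to $s$ or ends the game with payoff $(1,0,1,0)$. (The payoffs $(1,\tfrac12,0,0)$ and $(1,0,\tfrac12,0)$ are realised by a stochastic vertex that leads with probability $\tfrac12$ each to a terminal vertex with payoff $(1,1,0,0)$, respectively $(1,0,1,0)$, and to one with payoff $(1,0,0,0)$.) **Theorem.** 1. SqrtSum is polynomial-time many-one reducible to StatNE. Moreover, there is such a reduction, computed by a polynomial-time Turing machine, all of whose output instances are games with four players and thresholds $x=(1,0,0,0)$, $y=(1,1,1,1)$; they ask whether there is a stationary Nash equilibrium in which player 0 wins almost surely. 2. For every real $p\in[\tfrac12,1)$, the maximal payoff of player 3 in a stationary Nash equilibrium of $(G(p),s)$ exists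 and equals $$\frac{\sqrt{2-2p}-p+1}{2p+2}.$$ -/

import Mathlib

/-! ### Simple stochastic multiplayer games -/

/-- Probability distributions on a finite set `V`. -/
abbrev ProbDist (V : Type*) [Fintype V] : Type _ := stdSimplex ℝ V

/-- The distribution that gives probability `p` to `a` and `1 - p` to `b`. -/
noncomputable def ProbDist.mix {V : Type*} [Fintype V] [DecidableEq V]
    (p : unitInterval) (a b : V) : ProbDist V :=
  ⟨(p : ℝ) • Pi.single a 1 + (1 - (p : ℝ)) • Pi.single b 1,
    convex_stdSimplex ℝ V (single_mem_stdSimplex ℝ a) (single_mem_stdSimplex ℝ b)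
      p.2.1 (sub_nonneg.2 p.2.2) (by ring)⟩

/-- The point mass at `a`. -/
noncomputable def ProbDist.point {V : Type*} [Fintype V] [DecidableEq V] (a : V) : ProbDist V :=
  ⟨Pi.single a 1, single_mem_stdSimplex ℝ a⟩

/-- The measure on `V` with the given point probabilities. -/
noncomputable def ProbDist.toMeasure {V : Type*} [Fintype V] [MeasurableSpace V]
    (p : ProbDist V) : MeasureTheory.Measure V :=
  ∑ w, ENNReal.ofReal (p.1 w) • MeasureTheory.Measure.dirac w

instance ProbDist.isProbabilityMeasure_toMeasure {V : Type*} [Fintype V] [MeasurableSpace V]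
    (p : ProbDist V) : MeasureTheory.IsProbabilityMeasure p.toMeasure := by
  constructor
  simp only [ProbDist.toMeasure, MeasureTheory.Measure.coe_finsetSum, Finset.sum_apply,
    MeasureTheory.Measure.smul_apply, MeasureTheory.measure_univ, smul_eq_mul, mul_one]
  rw [← ENNReal.ofReal_sum_of_nonneg (fun w _ => p.2.1 w), p.2.2, ENNReal.ofReal_one]

/-- What happens at a vertex: either a player chooses among a set of successors, or the successor
is drawn at random. -/
inductive Node (P V : Type*) [Fintype V] where
  | player (i : P) (S : Set V)
  | chance (p : ProbDist V)

/-- The set `vΔ` of possible successors. -/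
def Node.succ {P V : Type*} [Fintype V] : Node P V → Set V
  | .player _ S => S
  | .chance p => {w | 0 < p.1 w}

/-- A simple stochastic multiplayer game with players `P` and finite vertex set `V`. -/
structure SSMG (P V : Type*) [Fintype V] where
  node : V → Node P V
  /-- `win i` is the set `F_i`. -/
  win : P → Set V
  succ_nonempty : ∀ v, (node v).succ.Nonempty
  win_terminal : ∀ i, ∀ v ∈ win i, (node v).succ = {v}

namespace SSMG

variable {P V : Type*} [Fintype V]

/-- A (mixed, history-dependent) strategy of player `i`: `act x v` is the distribution chosen after
the history `xv`. Only its values at vertices `v` that player `i` controls play a role. -/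
structure Strategy (G : SSMG P V) (i : P) where
  act : List V → V → ProbDist V
  legal : ∀ x v S, G.node v = .player i S → ∀ w, 0 < (act x v).1 w → w ∈ S

/-- A stationary strategy depends only on the current vertex. -/
def Strategy.IsStationary {G : SSMG P V} {i : P} (τ : G.Strategy i) : Prop :=
  ∀ x v S, G.node v = .player i S → τ.act x v = τ.act [] v

/-- A strategy profile. -/
abbrev Profile (G : SSMG P V) := ∀ i, G.Strategy i

/-- The conditional distribution of the next vertex given the history `xv`. -/
def next (G : SSMG P V) (σ : G.Profile) (x : List V) (v : V) : ProbDist V :=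
  match G.node v with
  | .player i _ => (σ i).act x v
  | .chance p => p

variable [MeasurableSpace V] [DiscreteMeasurableSpace V]

/-- The transition kernel from the first `n + 1` vertices `h 0, …, h n` of a play to the next
vertex. -/
noncomputable def kernel (G : SSMG P V) (σ : G.Profile) (n : ℕ) :
    ProbabilityTheory.Kernel (Finset.Iic n → V) V :=
  ProbabilityTheory.Kernel.ofFunOfCountable fun h =>
    (G.next σ (List.ofFn fun j : Fin n => h ⟨j, Finset.mem_Iic.2 j.2.le⟩)
      (h ⟨n, Finset.mem_Iic.2 le_rfl⟩)).toMeasure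

instance (G : SSMG P V) (σ : G.Profile) (n : ℕ) :
    ProbabilityTheory.IsMarkovKernel (G.kernel σ n) :=
  ⟨fun _ => ProbDist.isProbabilityMeasure_toMeasure _⟩

/-- The probability measure on infinite plays that is induced by a strategy profile and an initial
vertex. -/
noncomputable def law (G : SSMG P V) (v₀ : V) (σ : G.Profile) : MeasureTheory.Measure (ℕ → V) :=
  ProbabilityTheory.Kernel.traj (X := fun _ => V) (G.kernel σ) 0 (fun _ => v₀)

/-- The expected payoff of player `i`: the probability of reaching `F_i`. -/
noncomputable def payoff (G : SSMG P V) (v₀ : V) (σ : G.Profile) (i : P) : ℝ :=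
  (G.law v₀ σ).real {ω | ∃ n, ω n ∈ G.win i}

variable [DecidableEq P]

/-- No player can improve her payoff by switching to an arbitrary other strategy. -/
def IsNash (G : SSMG P V) (v₀ : V) (σ : G.Profile) : Prop :=
  ∀ i, ∀ τ : G.Strategy i, G.payoff v₀ (Function.update σ i τ) i ≤ G.payoff v₀ σ i

/-- A Nash equilibrium that consists of stationary strategies. -/
def IsStationaryNash (G : SSMG P V) (v₀ : V) (σ : G.Profile) : Prop :=
  (∀ i, (σ i).IsStationary) ∧ G.IsNash v₀ σ

end SSMG

/-! ### The gadget `G(p)` -/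

/-- The vertices of the gadget. A vertex `wᵢⱼ` is terminal and winning exactly for the players
`i` and `j`; the vertices `out₁` and `out₂` realise the payoff vectors `(1, 1/2, 0, 0)` and
`(1, 0, 1/2, 0)`. -/
inductive GadgetVertex
  | s | a₁ | s₁ | t | a₂ | s₂ | out₁ | out₂ | w₀ | w₀₁ | w₀₂ | w₀₃
  deriving DecidableEq

open GadgetVertex in
instance : Fintype GadgetVertex where
  elems := {s, a₁, s₁, t, a₂, s₂, out₁, out₂, w₀, w₀₁, w₀₂, w₀₃}
  complete v := by cases v <;> decide

instance : MeasurableSpace GadgetVertex := ⊤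

instance : DiscreteMeasurableSpace GadgetVertex := ⟨fun _ => trivial⟩

/-- One half as a probability. -/
noncomputable def oneHalf : unitInterval := ⟨1 / 2, by norm_num, by norm_num⟩

open GadgetVertex in
/-- The vertices of the gadget with their outgoing transitions. -/
noncomputable def gadgetNode (p : unitInterval) : GadgetVertex → Node (Fin 4) GadgetVertex
  | s => .player 1 {a₁, out₁}
  | a₁ => .chance (.mix p s₁ w₀₃)
  | s₁ => .player 0 {t, w₀₁}
  | t => .player 2 {a₂, out₂}
  | a₂ => .chance (.mix p s₂ w₀)
  | s₂ => .player 0 {s, w₀₂}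
  | out₁ => .chance (.mix oneHalf w₀₁ w₀)
  | out₂ => .chance (.mix oneHalf w₀₂ w₀)
  | w₀ => .chance (.point w₀)
  | w₀₁ => .chance (.point w₀₁)
  | w₀₂ => .chance (.point w₀₂)
  | w₀₃ => .chance (.point w₀₃)

open GadgetVertex in
/-- The winning vertices of the four players in the gadget. -/
def gadgetWin : Fin 4 → Set GadgetVertex :=
  ![{w₀, w₀₁, w₀₂, w₀₃}, {w₀₁}, {w₀₂}, {w₀₃}]

theorem Node.succ_point {P V : Type*} [Fintype V] [DecidableEq V] (a : V) :
    (Node.chance (ProbDist.point a) : Node P V).succ = {a} := by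
  ext w
  by_cases h : w = a
  · subst h; simp [Node.succ, ProbDist.point]
  · simp [Node.succ, ProbDist.point, h]

theorem Node.succ_chance_nonempty {P V : Type*} [Fintype V] (p : ProbDist V) :
    (Node.chance p : Node P V).succ.Nonempty := by
  by_contra h
  rw [Set.not_nonempty_iff_eq_empty] at h
  have h0 : ∀ w, p.1 w ≤ 0 := fun w => not_lt.1 fun hw =>
    (Set.eq_empty_iff_forall_notMem.1 h w) hw
  have := Finset.sum_nonpos fun w (_ : w ∈ Finset.univ) => h0 w
  have h1 := p.2.2
  linarith

/-- The game `G(p)` with players `0, 1, 2, 3`; its initial vertex is `s`. -/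
noncomputable def gadget (p : unitInterval) : SSMG (Fin 4) GadgetVertex where
  node := gadgetNode p
  win := gadgetWin
  succ_nonempty v := by
    cases v <;> first
      | exact Node.succ_chance_nonempty _
      | exact Set.insert_nonempty _ _
  win_terminal i v hv := by
    fin_cases i <;> simp [gadgetWin] at hv <;> rcases hv with rfl | rfl | rfl | rfl <;>
      exact Node.succ_point _

/-! ### The two decision problems and their instances -/

/-- An instance of the square root sum problem: the list `d₁, …, dₙ` and the number `k`. -/
structure SqrtSumInstance where
  d : List ℕ
  k : ℕ

/-- The yes-instances of the square root sum problem. -/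
def SqrtSum (I : SqrtSumInstance) : Prop :=
  (I.k : ℝ) ≤ (I.d.map fun m => √(m : ℝ)).sum

/-- The rational number presented by a numerator and a denominator. -/
def fracVal (q : ℕ × ℕ+) : ℚ := (q.1 : ℚ) / ((q.2 : ℕ) : ℚ)

theorem fracVal_nonneg (q : ℕ × ℕ+) : 0 ≤ fracVal q := by
  unfold fracVal; positivity

/-- A vertex of a game given by finite data: players `0, …, k - 1`, vertices `0, …, N - 1`, the
probabilities given as fractions. -/
inductive RatNode (k N : ℕ) where
  | player (i : Fin k) (S : Fin N → Bool)
  | chance (p : {p : Fin N → ℕ × ℕ+ // ∑ w, fracVal (p w) = 1})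

/-- The vertex of the actual game that the data describe. -/
noncomputable def RatNode.toNode {k N : ℕ} : RatNode k N → Node (Fin k) (Fin N)
  | .player i S => .player i {w | S w = true}
  | .chance p => .chance ⟨fun w => (fracVal (p.1 w) : ℝ),
      fun w => Rat.cast_nonneg.2 (fracVal_nonneg (p.1 w)), by
        rw [← Rat.cast_sum, p.2, Rat.cast_one]⟩

/-- An instance of the problem StatNE: a game with rational probabilities, an initial vertex, and
two rational threshold vectors with entries in `[0, 1]`. -/
structure StatNEInstance where
  players : ℕ
  vertices : ℕ
  init : Fin vertices
  node : Fin vertices → RatNode players vertices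
  win : Fin players → Fin vertices → Bool
  succ_nonempty : ∀ v, (node v).toNode.succ.Nonempty
  win_terminal : ∀ i v, win i v = true → (node v).toNode.succ = {v}
  lower : Fin players → ℕ × ℕ+
  upper : Fin players → ℕ × ℕ+
  lower_le_one : ∀ i, fracVal (lower i) ≤ 1
  upper_le_one : ∀ i, fracVal (upper i) ≤ 1

/-- The game of an instance. -/
noncomputable def StatNEInstance.game (I : StatNEInstance) :
    SSMG (Fin I.players) (Fin I.vertices) where
  node v := (I.node v).toNode
  win i := {v | I.win i v = true}
  succ_nonempty := I.succ_nonempty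
  win_terminal i v hv := I.win_terminal i v hv

/-- The yes-instances of StatNE: there is a stationary Nash equilibrium whose payoff lies between
the two thresholds. -/
def StatNE (I : StatNEInstance) : Prop :=
  ∃ σ : I.game.Profile, I.game.IsStationaryNash I.init σ ∧
    ∀ i, (fracVal (I.lower i) : ℝ) ≤ I.game.payoff I.init σ i ∧
      I.game.payoff I.init σ i ≤ (fracVal (I.upper i) : ℝ)

/-! ### Encodings of the instances as words -/

open Computability in
/-- A list of natural numbers as a word: binary expansions, each followed by a comma. -/
def encodeNats (l : List ℕ) : List Γ' :=
  l.flatMap fun a => (encodeNat a).map Γ'.bit ++ [Γ'.comma]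

/-- The list of numbers that represents an instance of the square root sum problem. -/
def SqrtSumInstance.code (I : SqrtSumInstance) : List ℕ := I.k :: I.d

/-- The two numbers that represent a fraction. -/
def fracCode (q : ℕ × ℕ+) : List ℕ := [q.1, (q.2 : ℕ)]

/-- A truth value as a number. -/
def boolCode (b : Bool) : List ℕ := [b.toNat]

/-- A vector, entry by entry. -/
def vecCode {α : Type*} {n : ℕ} (c : α → List ℕ) (f : Fin n → α) : List ℕ :=
  (List.ofFn fun j => c (f j)).flatten

/-- A vertex controlled by player `i` is represented by `i + 1` and the characteristic vector of
its successors, a stochastic vertex by `0` and the vector of its transition probabilities. -/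
def RatNode.code {k N : ℕ} : RatNode k N → List ℕ
  | .player i S => ((i : ℕ) + 1) :: vecCode boolCode S
  | .chance p => 0 :: vecCode fracCode p.1

/-- The list of numbers that represents an instance of StatNE. -/
def StatNEInstance.code (I : StatNEInstance) : List ℕ :=
  [I.players, I.vertices, (I.init : ℕ)] ++ (vecCode RatNode.code I.node ++
    (vecCode (vecCode boolCode) I.win ++ (vecCode fracCode I.lower ++ vecCode fracCode I.upper)))

/-- A code whose words can be recognised at the beginning of a longer list. -/
def IsPrefixCode {α : Type*} (c : α → List ℕ) : Prop :=
  ∀ a b r s, c a ++ r = c b ++ s → a = b ∧ r = s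

theorem isPrefixCode_fracCode : IsPrefixCode fracCode := by
  rintro ⟨a, b⟩ ⟨a', b'⟩ r s h
  simp only [fracCode, List.cons_append, List.nil_append, List.cons.injEq, PNat.coe_inj] at h
  simp [h]

theorem isPrefixCode_boolCode : IsPrefixCode boolCode := by
  rintro a b r s h
  cases a <;> cases b <;> simp_all [boolCode]

theorem IsPrefixCode.vec {α : Type*} {c : α → List ℕ} (hc : IsPrefixCode c) (n : ℕ) :
    IsPrefixCode (vecCode c : (Fin n → α) → List ℕ) := by
  induction n with
  | zero =>
    intro a b r s h
    exact ⟨Subsingleton.elim _ _, by simpa [vecCode] using h⟩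
  | succ n ih =>
    intro a b r s h
    simp only [vecCode, List.ofFn_succ, List.flatten_cons, List.append_assoc] at h
    obtain ⟨h0, h1⟩ := hc _ _ _ _ h
    obtain ⟨h2, h3⟩ := ih (fun j => a j.succ) (fun j => b j.succ) r s h1
    refine ⟨funext fun j => ?_, h3⟩
    induction j using Fin.cases with
    | zero => exact h0
    | succ j => exact congrFun h2 j

theorem isPrefixCode_ratNode (k N : ℕ) : IsPrefixCode (RatNode.code : RatNode k N → List ℕ) := by
  rintro (⟨i, S⟩ | p) (⟨i', S'⟩ | p') r s h
  · simp only [RatNode.code, List.cons_append, List.cons.injEq, Nat.add_right_cancel_iff] at h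
    obtain ⟨h1, h2⟩ := isPrefixCode_boolCode.vec N _ _ _ _ h.2
    exact ⟨by rw [Fin.ext h.1, h1], h2⟩
  · simp [RatNode.code] at h
  · simp [RatNode.code] at h
  · simp only [RatNode.code, List.cons_append, List.cons.injEq, true_and] at h
    obtain ⟨h1, h2⟩ := isPrefixCode_fracCode.vec N _ _ _ _ h
    exact ⟨by rw [Subtype.ext h1], h2⟩

open Computability in
theorem encodeNats_injective : Function.Injective encodeNats := by
  have key : ∀ (u v : List Bool) (r s : List Γ'),
      u.map Γ'.bit ++ Γ'.comma :: r = v.map Γ'.bit ++ Γ'.comma :: s → u = v ∧ r = s := by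
    intro u
    induction u with
    | nil => rintro (_ | ⟨b, v⟩) r s h <;> simp_all
    | cons a u ih =>
      rintro (_ | ⟨b, v⟩) r s h
      · simp at h
      · simp only [List.map_cons, List.cons_append, List.cons.injEq, Γ'.bit.injEq] at h
        obtain ⟨h1, h2⟩ := ih v r s h.2
        exact ⟨by rw [h.1, h1], h2⟩
  intro l
  induction l with
  | nil => rintro (_ | ⟨b, m⟩) h <;> simp_all [encodeNats]
  | cons a l ih =>
    rintro (_ | ⟨b, m⟩) h
    · simp [encodeNats] at h
    · simp only [encodeNats, List.flatMap_cons, List.append_assoc, List.cons_append,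
        List.nil_append] at h
      obtain ⟨h1, h2⟩ := key _ _ _ _ h
      rw [encodingNatBool.encode_injective h1, ih h2]

theorem SqrtSumInstance.code_injective : Function.Injective SqrtSumInstance.code := by
  rintro ⟨d, k⟩ ⟨d', k'⟩ h
  simp only [SqrtSumInstance.code, List.cons.injEq] at h
  rw [h.1, h.2]

theorem StatNEInstance.code_injective : Function.Injective StatNEInstance.code := by
  rintro ⟨k, N, v, nd, w, _, _, x, y, _, _⟩ ⟨k', N', v', nd', w', _, _, x', y', _, _⟩ h
  simp only [StatNEInstance.code, List.cons_append, List.nil_append, List.cons.injEq] at h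
  obtain ⟨rfl, rfl, h1, h2⟩ := h
  obtain rfl := Fin.ext h1
  obtain ⟨rfl, h3⟩ := (isPrefixCode_ratNode _ _).vec _ _ _ _ _ h2
  obtain ⟨rfl, h4⟩ := (isPrefixCode_boolCode.vec _).vec _ _ _ _ _ h3
  obtain ⟨rfl, h5⟩ := isPrefixCode_fracCode.vec _ _ _ _ _ h4
  obtain ⟨rfl, -⟩ := isPrefixCode_fracCode.vec _ y y' [] [] (by simpa using h5)
  rfl

open Classical in
/-- The encoding given by an injective map to words. -/
noncomputable def encodingOfInjective {α Γ : Type*} (e : α → List Γ) (he : Function.Injective e) :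
    Computability.Encoding α Γ where
  encode := e
  decode := Function.partialInv e
  decode_encode := Function.partialInv_left he

/-- The encoding of instances of the square root sum problem, with numbers in binary. -/
noncomputable def sqrtSumEncoding : Computability.Encoding SqrtSumInstance Computability.Γ' :=
  encodingOfInjective (fun I => encodeNats I.code)
    (encodeNats_injective.comp SqrtSumInstance.code_injective)

/-- The encoding of instances of StatNE, with numbers in binary. -/
noncomputable def statNEEncoding : Computability.Encoding StatNEInstance Computability.Γ' :=
  encodingOfInjective (fun I => encodeNats I.code)
    (encodeNats_injective.comp StatNEInstance.code_injective)

/-! ### Polynomial-time reductions -/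

/-- `f` is a polynomial-time many-one reduction from the problem `A` to the problem `B`: it is
computed by a Turing machine in polynomial time and preserves the answer. -/
def IsPolyTimeReduction {α β Γ₀ Γ₁ : Type} (ea : Computability.Encoding α Γ₀)
    (eb : Computability.Encoding β Γ₁) (A : α → Prop) (B : β → Prop) (f : α → β) : Prop :=
  Nonempty (Turing.TM2ComputableInPolyTime ea.encode eb.encode f) ∧ ∀ a, A a ↔ B (f a)

/-!
The payoffs of a stationary profile, as functions of the initial vertex, are harmonic for the
induced Markov chain (`SSMG.StatProfile.payoff_eq_exp`), and every function that is superharmonic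
under a profile and at least `1` on `F_i` bounds the payoff of player `i`
(`SSMG.payoff_le_of_superharmonic`). Hence a stationary profile is an equilibrium as soon as no
single change of a choice is profitable, even against strategies with memory
(`SSMG.StatProfile.payoff_update_le`).

In the gadget, let player 0 send the play on with probability `α` at `s₁` and `β` at `s₂`. If
player 1 enters at `s`, she must get at least the outside option `1 / 2`; if player 2 enters at
`t`, so must she. Each of these conditions bounds one of `α` and `β` from above in terms of the
product `α * β` (`incentive_bound`), while the payoff of player 3 grows with this product. Together
they bound the product, and the bound is attained for `α = β = (1 - √(2 - 2 * p)) / p`. This gives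
the value `gadgetOpt p`. All of this is done for a copy of the gadget inside a larger game
(`IsGadget`), since the reduction needs many copies.

For the reduction, let `m` be the length of the input word, so that `k` and all `d` are smaller
than `2 ^ m`, and give the copy for the number `d` the parameter `p` with
`1 - p = d / 2 ^ (2 * m + 1)`. Then `√(2 - 2 * p) = √d / 2 ^ m`, and `(1 + p) * gadgetOpt p` is
half the sum of `√d / 2 ^ m` and `1 - p`. Player 3 chooses between a lottery in which she gets the
mean of the values `(1 + p) * (payoff in the copy)` up to a factor, and a lottery with the value
that corresponds to `k`, in which player 0 never wins. So player 0 can win almost surely in a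
stationary equilibrium if and only if `∑ √d ≥ k` (`Reduction.sqrtSum_iff_statNE`).

The game has a table of transition probabilities whose rows depend on a block only through `d` and
the position of the block. A machine writes it in polynomial time. To construct the machine,
programs of a small structured language with stacks are compiled to stack machines
(`Prog.nonempty_computableInPolyTime`), and the table is written by programs composed of emitters
(`Machine.Emits`) whose running times are bounded by polynomials.
-/

/-! ### Reachability probabilities under a strategy profile -/

/-- The expectation of `f` under a distribution on a finite set. -/
noncomputable def ProbDist.exp {V : Type*} [Fintype V] (μ : ProbDist V) (f : V → ℝ) : ℝ :=
  ∑ w, μ.1 w * f w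

namespace ProbDist

variable {V : Type*} [Fintype V]

theorem exp_mono_of_support (μ : ProbDist V) {f g : V → ℝ} (h : ∀ w, 0 < μ.1 w → f w ≤ g w) :
    μ.exp f ≤ μ.exp g := by
  refine Finset.sum_le_sum fun w _ => ?_
  rcases (μ.2.1 w).eq_or_lt with h0 | h0
  · simp [← h0]
  · exact mul_le_mul_of_nonneg_left (h w h0) h0.le

theorem exp_congr_of_support (μ : ProbDist V) {f g : V → ℝ} (h : ∀ w, 0 < μ.1 w → f w = g w) :
    μ.exp f = μ.exp g :=
  le_antisymm (μ.exp_mono_of_support fun w hw => (h w hw).le)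
    (μ.exp_mono_of_support fun w hw => (h w hw).ge)

@[simp] theorem exp_const (μ : ProbDist V) (c : ℝ) : μ.exp (fun _ => c) = c := by
  simp [exp, ← Finset.sum_mul, μ.2.2]

theorem integral_toMeasure [MeasurableSpace V] [DiscreteMeasurableSpace V]
    (μ : ProbDist V) (f : V → ℝ) : ∫ w, f w ∂μ.toMeasure = μ.exp f := by
  unfold toMeasure
  rw [MeasureTheory.integral_finsetSum_measure]
  · refine Finset.sum_congr rfl fun w _ => ?_
    rw [MeasureTheory.integral_smul_measure, MeasureTheory.integral_dirac,
      ENNReal.toReal_ofReal (μ.2.1 w), smul_eq_mul]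
  · intro w _
    exact (MeasureTheory.integrable_dirac (by simp)).smul_measure ENNReal.ofReal_ne_top

theorem eq_of_support_subset_singleton {μ : ProbDist V} {a : V}
    (h : ∀ w, 0 < μ.1 w → w = a) (f : V → ℝ) : μ.exp f = f a := by
  rw [μ.exp_congr_of_support (g := fun _ => f a) fun w hw => by rw [h w hw], exp_const]

theorem exp_point [DecidableEq V] (a : V) (f : V → ℝ) : (point a).exp f = f a := by
  simp [exp, point, Pi.single_apply]

theorem exp_mix [DecidableEq V] (p : unitInterval) (a b : V) (f : V → ℝ) :
    (mix p a b).exp f = p * f a + (1 - p) * f b := by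
  simp [exp, mix, Pi.single_apply, add_mul, Finset.sum_add_distrib]

/-- A distribution on a pair is determined by the probability of one of its elements. -/
theorem exp_of_support_subset_pair {μ : ProbDist V} {a b : V} (hab : a ≠ b)
    (h : ∀ w, 0 < μ.1 w → w ∈ ({a, b} : Set V)) (f : V → ℝ) :
    μ.exp f = μ.1 a * f a + (1 - μ.1 a) * f b := by
  classical
  have key : ∀ g : V → ℝ, μ.exp g = μ.1 a * g a + μ.1 b * g b := by
    intro g
    rw [exp, ← Finset.sum_subset (Finset.subset_univ {a, b}), Finset.sum_pair hab]
    intro w _ hw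
    have : ¬ 0 < μ.1 w := fun h0 => hw (by simpa using h w h0)
    rw [le_antisymm (not_lt.1 this) (μ.2.1 w), zero_mul]
  have h1 := key fun _ => 1
  rw [exp_const] at h1
  rw [key]
  have : μ.1 b = 1 - μ.1 a := by linarith
  rw [this]

theorem le_one (μ : ProbDist V) (a : V) : μ.1 a ≤ 1 := by
  rw [← μ.2.2]
  exact Finset.single_le_sum (fun w _ => μ.2.1 w) (Finset.mem_univ a)

end ProbDist

namespace SSMG

open MeasureTheory ProbabilityTheory Filter Topology

variable {P V : Type*} [Fintype V]

theorem next_support_of_win (G : SSMG P V) (σ : G.Profile) (x : List V) (v : V) {i : P}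
    (hv : v ∈ G.win i) (w : V) (hw : 0 < (G.next σ x v).1 w) : w = v := by
  have h := G.win_terminal i v hv
  unfold next at hw
  cases hn : G.node v with
  | player j S =>
    rw [hn] at h hw
    simp only [Node.succ] at h
    have := (σ j).legal x v S hn w hw
    rwa [h] at this
  | chance p =>
    rw [hn] at h hw
    simp only [Node.succ] at h
    have : w ∈ {w | 0 < p.1 w} := hw
    rwa [h] at this

/-- All strategies of the profile are stationary. -/
def StatProfile (G : SSMG P V) (σ : G.Profile) : Prop := ∀ i, (σ i).IsStationary

theorem StatProfile.next_eq {G : SSMG P V} {σ : G.Profile} (hσ : G.StatProfile σ)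
    (x : List V) (v : V) : G.next σ x v = G.next σ [] v := by
  unfold next
  cases hn : G.node v with
  | player j S => exact hσ j x v S hn
  | chance p => rfl

open Classical in
/-- The stationary strategy that deviates from `τ` by moving from `v` to `w`. -/
noncomputable def Strategy.deviate {G : SSMG P V} {i : P} (τ : G.Strategy i) (v w : V)
    (hw : ∀ S, G.node v = .player i S → w ∈ S) : G.Strategy i where
  act x u := if u = v then ProbDist.point w else τ.act [] u
  legal x u S hu w' hw' := by
    by_cases h : u = v
    · subst h
      rw [if_pos rfl] at hw'
      have : w' = w := by
        by_contra hne
        simp [ProbDist.point, hne] at hw'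
      exact this ▸ hw S hu
    · rw [if_neg h] at hw'
      exact τ.legal [] u S hu w' hw'

theorem StatProfile.deviate [DecidableEq P] {G : SSMG P V} {σ : G.Profile}
    (hσ : G.StatProfile σ) (i : P)
    (v w : V) (hw : ∀ S, G.node v = .player i S → w ∈ S) :
    G.StatProfile (Function.update σ i ((σ i).deviate v w hw)) := by
  intro j
  by_cases hj : j = i
  · subst hj
    simp only [Function.update_self]
    intro x u S hu
    rfl
  · rw [Function.update_of_ne hj]
    exact hσ j

theorem StatProfile.next_deviate_of_ne [DecidableEq P] {G : SSMG P V} {σ : G.Profile} (i : P)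
    (v w : V) (hw : ∀ S, G.node v = .player i S → w ∈ S) {u : V} (hu : u ≠ v) :
    G.next (Function.update σ i ((σ i).deviate v w hw)) [] u = G.next σ [] u := by
  unfold next
  cases hn : G.node u with
  | chance μ => rfl
  | player j S =>
    by_cases hj : j = i
    · subst hj
      simp [Strategy.deviate, hu]
    · simp [Function.update_of_ne hj]

variable [MeasurableSpace V] [DiscreteMeasurableSpace V]

instance (G : SSMG P V) (v₀ : V) (σ : G.Profile) : IsProbabilityMeasure (G.law v₀ σ) := by
  unfold law; infer_instance

/-- The distribution of the next vertex as a function of the finite history. -/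
def nextAt (G : SSMG P V) (σ : G.Profile) (n : ℕ) (h : Finset.Iic n → V) : ProbDist V :=
  G.next σ (List.ofFn fun j : Fin n => h ⟨j, Finset.mem_Iic.2 j.2.le⟩)
    (h ⟨n, Finset.mem_Iic.2 le_rfl⟩)

theorem integrable_of_finite_history (μ : Measure (ℕ → V)) [IsFiniteMeasure μ] (n : ℕ)
    (g : (Finset.Iic n → V) → ℝ) :
    Integrable (fun ω : ℕ → V => g (Preorder.frestrictLe n ω)) μ := by
  obtain ⟨C, hC⟩ := (Set.finite_range fun h => ‖g h‖).bddAbove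
  refine Integrable.of_bound
    ((Measurable.of_discrete (f := g)).comp (by fun_prop)).aestronglyMeasurable C
    (ae_of_all _ fun ω => hC ⟨_, rfl⟩)

/-- One step of the play: given the first `n + 1` vertices, the next one is drawn from
`nextAt`. -/
theorem integral_law_step (G : SSMG P V) (v₀ : V) (σ : G.Profile) (n : ℕ)
    (g : (Finset.Iic n → V) → V → ℝ) :
    ∫ ω, g (Preorder.frestrictLe n ω) (ω (n + 1)) ∂G.law v₀ σ =
      ∫ ω, (G.nextAt σ n (Preorder.frestrictLe n ω)).exp (g (Preorder.frestrictLe n ω))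
        ∂G.law v₀ σ := by
  have hmeas : Measurable fun z : (Finset.Iic n → V) × V => g z.1 z.2 := Measurable.of_discrete
  have h1 := Kernel.partialTraj_compProd_eq_map_traj (X := fun _ => V) (κ := G.kernel σ)
    (Nat.zero_le n) (x₀ := fun _ => v₀)
  have h2 : ∫ ω, g (Preorder.frestrictLe n ω) (ω (n + 1)) ∂G.law v₀ σ =
      ∫ z, g z.1 z.2 ∂(G.law v₀ σ).map
        (fun x : ℕ → V => (Preorder.frestrictLe (π := fun _ => V) n x, x (n + 1))) := by
    rw [integral_map (by fun_prop) hmeas.aestronglyMeasurable]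
  have hint : Integrable (fun z : (Finset.Iic n → V) × V => g z.1 z.2)
      ((Kernel.partialTraj (X := fun _ => V) (G.kernel σ) 0 n fun _ => v₀) ⊗ₘ G.kernel σ n) := by
    obtain ⟨C, hC⟩ := (Set.finite_range fun z : (Finset.Iic n → V) × V => ‖g z.1 z.2‖).bddAbove
    exact Integrable.of_bound hmeas.aestronglyMeasurable C (ae_of_all _ fun ω => hC ⟨_, rfl⟩)
  rw [h2, law, ← h1, Measure.integral_compProd hint,
    ← Kernel.traj_map_frestrictLe_apply, integral_map (by fun_prop)
      Measurable.of_discrete.aestronglyMeasurable]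
  exact integral_congr_ae (ae_of_all _ fun ω => ProbDist.integral_toMeasure _ _)

theorem integral_law_zero (G : SSMG P V) (v₀ : V) (σ : G.Profile) (f : V → ℝ) :
    ∫ ω, f (ω 0) ∂G.law v₀ σ = f v₀ := by
  have h := Kernel.traj_map_frestrictLe_apply (X := fun _ => V) (κ := G.kernel σ) 0 0
    (fun _ => v₀)
  rw [Kernel.partialTraj_self, Kernel.id_apply] at h
  have h2 : ∫ ω, f (ω 0) ∂G.law v₀ σ =
      ∫ z : Finset.Iic 0 → V, f (z ⟨0, by simp⟩) ∂(G.law v₀ σ).map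
        (Preorder.frestrictLe (π := fun _ => V) 0) := by
    rw [integral_map (by fun_prop) Measurable.of_discrete.aestronglyMeasurable]
    rfl
  rw [h2, law, h, integral_dirac]

theorem integrable_coord (G : SSMG P V) (v₀ : V) (σ : G.Profile) (n : ℕ) (f : V → ℝ) :
    Integrable (fun ω : ℕ → V => f (ω n)) (G.law v₀ σ) :=
  integrable_of_finite_history _ n fun h => f (h ⟨n, Finset.mem_Iic.2 le_rfl⟩)

/-- The indicator function of the winning vertices of player `i`. -/
noncomputable def winInd (G : SSMG P V) (i : P) : V → ℝ := (G.win i).indicator 1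

/-- Almost surely, a play that has reached a winning vertex of player `i` stays there. -/
theorem ae_win_succ (G : SSMG P V) (v₀ : V) (σ : G.Profile) (i : P) :
    ∀ᵐ ω ∂G.law v₀ σ, ∀ n, ω n ∈ G.win i → ω (n + 1) ∈ G.win i := by
  classical
  rw [ae_all_iff]
  intro n
  let g : (Finset.Iic n → V) → V → ℝ := fun h w =>
    if h ⟨n, Finset.mem_Iic.2 le_rfl⟩ ∈ G.win i ∧ w ∉ G.win i then 1 else 0
  have h0 : ∫ ω, g (Preorder.frestrictLe n ω) (ω (n + 1)) ∂G.law v₀ σ = 0 := by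
    rw [integral_law_step]
    refine integral_eq_zero_of_ae (ae_of_all _ fun ω => ?_)
    by_cases hω : ω n ∈ G.win i
    · refine (ProbDist.exp_congr_of_support _ (g := fun _ => 0) fun w hw => ?_).trans
        (ProbDist.exp_const _ _)
      have := G.next_support_of_win σ _ _ hω w hw
      subst this
      simp only [g, ite_eq_right_iff]
      exact fun h => absurd hω h.2
    · have : g (Preorder.frestrictLe n ω) = fun _ => 0 := by
        funext w
        simp only [g, ite_eq_right_iff]
        exact fun h => absurd h.1 hω
      simp only [this, ProbDist.exp_const, Pi.zero_apply]
  have hint : Integrable (fun ω : ℕ → V => g (Preorder.frestrictLe n ω) (ω (n + 1)))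
      (G.law v₀ σ) :=
    integrable_of_finite_history _ (n + 1) fun h =>
      g (fun j => h ⟨j.1, Finset.mem_Iic.2 ((Finset.mem_Iic.1 j.2).trans n.le_succ)⟩)
        (h ⟨n + 1, Finset.mem_Iic.2 le_rfl⟩)
  have hnn : 0 ≤ fun ω : ℕ → V => g (Preorder.frestrictLe n ω) (ω (n + 1)) := by
    intro ω
    simp only [g, Pi.zero_apply]
    split_ifs <;> norm_num
  rw [integral_eq_zero_iff_of_nonneg hnn hint] at h0
  filter_upwards [h0] with ω hω h1
  by_contra h2
  have : g (Preorder.frestrictLe n ω) (ω (n + 1)) = 1 := by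
    simp only [g]
    exact if_pos ⟨h1, h2⟩
  rw [this] at hω
  simp at hω

/-- The payoff is the limit of the probabilities of being in a winning vertex at time `n`. -/
theorem tendsto_integral_winInd (G : SSMG P V) (v₀ : V) (σ : G.Profile) (i : P) :
    Tendsto (fun n => ∫ ω, G.winInd i (ω n) ∂G.law v₀ σ) atTop (𝓝 (G.payoff v₀ σ i)) := by
  classical
  have hm : MeasurableSet {ω : ℕ → V | ∃ n, ω n ∈ G.win i} := by
    rw [Set.ofPred_exists]
    exact MeasurableSet.iUnion fun n =>
      (measurable_pi_apply n) (MeasurableSet.of_discrete (s := G.win i))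
  have h1 : G.payoff v₀ σ i =
      ∫ ω, ({ω : ℕ → V | ∃ n, ω n ∈ G.win i}.indicator 1 ω : ℝ) ∂G.law v₀ σ := by
    rw [integral_indicator_one hm]; rfl
  rw [h1]
  refine tendsto_integral_of_dominated_convergence (fun _ => 1)
    (fun n => (G.integrable_coord v₀ σ n _).1) (integrable_const _)
    (fun n => ae_of_all _ fun ω => ?_) ?_
  · unfold winInd Set.indicator
    split_ifs <;> simp
  · filter_upwards [G.ae_win_succ v₀ σ i] with ω hω
    by_cases h : ∃ n, ω n ∈ G.win i
    · obtain ⟨n, hn⟩ := h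
      have hge : ∀ m, n ≤ m → ω m ∈ G.win i := fun m hm =>
        Nat.le_induction hn (fun m _ => hω m) m hm
      refine tendsto_const_nhds.congr' ?_
      filter_upwards [eventually_ge_atTop n] with m hm
      have h2 : ω ∈ {ω : ℕ → V | ∃ n, ω n ∈ G.win i} := ⟨n, hn⟩
      rw [winInd, Set.indicator_of_mem (hge m hm), Set.indicator_of_mem h2]
      rfl
    · have h2 : ω ∉ {ω : ℕ → V | ∃ n, ω n ∈ G.win i} := h
      rw [Set.indicator_of_notMem h2]
      refine tendsto_const_nhds.congr fun m => ?_
      rw [winInd, Set.indicator_of_notMem fun h3 => h ⟨m, h3⟩]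

theorem payoff_nonneg (G : SSMG P V) (v₀ : V) (σ : G.Profile) (i : P) :
    0 ≤ G.payoff v₀ σ i := measureReal_nonneg

theorem payoff_le_one (G : SSMG P V) (v₀ : V) (σ : G.Profile) (i : P) :
    G.payoff v₀ σ i ≤ 1 := measureReal_le_one

/-- A superharmonic function that is at least `1` on the winning vertices bounds the payoff. -/
theorem payoff_le_of_superharmonic (G : SSMG P V) (v₀ : V) (σ : G.Profile) (i : P) (u : V → ℝ)
    (hwin : ∀ v, G.winInd i v ≤ u v) (hu : ∀ x v, (G.next σ x v).exp u ≤ u v) :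
    G.payoff v₀ σ i ≤ u v₀ := by
  have h1 : ∀ n, ∫ ω, u (ω n) ∂G.law v₀ σ ≤ u v₀ := by
    intro n
    induction n with
    | zero => exact (G.integral_law_zero v₀ σ u).le
    | succ n ih =>
      refine le_trans ?_ ih
      rw [G.integral_law_step v₀ σ n fun _ => u]
      exact integral_mono
        (integrable_of_finite_history _ n fun h => (G.nextAt σ n h).exp u)
        (G.integrable_coord v₀ σ n u) fun ω => hu _ _
  refine le_of_tendsto' (G.tendsto_integral_winInd v₀ σ i) fun n => le_trans ?_ (h1 n)
  exact integral_mono (G.integrable_coord v₀ σ n _) (G.integrable_coord v₀ σ n u)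
    fun ω => hwin _

/-! ### Stationary profiles -/

/-- The probability of being in `F_i` after `n` steps of the Markov chain of a stationary
profile. -/
noncomputable def stepVal (G : SSMG P V) (σ : G.Profile) (i : P) : ℕ → V → ℝ
  | 0 => G.winInd i
  | n + 1 => fun v => (G.next σ [] v).exp (G.stepVal σ i n)

/-- Under a stationary profile the play is a Markov chain. -/
theorem StatProfile.integral_eq_stepVal {G : SSMG P V} {σ : G.Profile} (hσ : G.StatProfile σ)
    (v₀ : V) (i : P) (n m : ℕ) :
    ∫ ω, G.stepVal σ i m (ω n) ∂G.law v₀ σ = G.stepVal σ i (n + m) v₀ := by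
  induction n generalizing m with
  | zero => rw [G.integral_law_zero v₀ σ, Nat.zero_add]
  | succ n ih =>
    rw [G.integral_law_step v₀ σ n fun _ => G.stepVal σ i m, Nat.succ_add_eq_add_succ,
      ← ih (m + 1)]
    refine integral_congr_ae (ae_of_all _ fun ω => ?_)
    change (G.next σ _ _).exp _ = _
    rw [hσ.next_eq]
    rfl

theorem StatProfile.tendsto_stepVal {G : SSMG P V} {σ : G.Profile} (hσ : G.StatProfile σ)
    (v : V) (i : P) :
    Tendsto (fun n => G.stepVal σ i n v) atTop (𝓝 (G.payoff v σ i)) := by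
  refine (G.tendsto_integral_winInd v σ i).congr fun n => ?_
  exact hσ.integral_eq_stepVal v i n 0

/-- The payoffs of a stationary profile, as a function of the initial vertex, are harmonic. -/
theorem StatProfile.payoff_eq_exp {G : SSMG P V} {σ : G.Profile} (hσ : G.StatProfile σ)
    (v : V) (i : P) :
    G.payoff v σ i = (G.next σ [] v).exp fun w => G.payoff w σ i := by
  refine tendsto_nhds_unique ((tendsto_add_atTop_iff_nat 1).2 (hσ.tendsto_stepVal v i)) ?_
  exact tendsto_finsetSum _ fun w _ => (hσ.tendsto_stepVal w i).const_mul _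

theorem StatProfile.payoff_eq_of_player {G : SSMG P V} {σ : G.Profile} (hσ : G.StatProfile σ)
    {v : V} {j : P} {S : Set V} (hv : G.node v = .player j S) (i : P) :
    G.payoff v σ i = ((σ j).act [] v).exp fun w => G.payoff w σ i := by
  rw [hσ.payoff_eq_exp v i, next, hv]

theorem StatProfile.payoff_eq_of_chance {G : SSMG P V} {σ : G.Profile} (hσ : G.StatProfile σ)
    {v : V} {μ : ProbDist V} (hv : G.node v = .chance μ) (i : P) :
    G.payoff v σ i = μ.exp fun w => G.payoff w σ i := by
  rw [hσ.payoff_eq_exp v i, next, hv]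

/-- Two stationary profiles that agree on a closed set of vertices have the same payoffs there. -/
theorem StatProfile.payoff_congr {G : SSMG P V} {σ σ' : G.Profile} (hσ : G.StatProfile σ)
    (hσ' : G.StatProfile σ') (C : Set V)
    (hC : ∀ v ∈ C, ∀ w, 0 < (G.next σ [] v).1 w → w ∈ C)
    (heq : ∀ v ∈ C, G.next σ' [] v = G.next σ [] v) (i : P) (v : V) (hv : v ∈ C) :
    G.payoff v σ' i = G.payoff v σ i := by
  have : ∀ n, ∀ v ∈ C, G.stepVal σ' i n v = G.stepVal σ i n v := by
    intro n
    induction n with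
    | zero => exact fun v _ => rfl
    | succ n ih =>
      intro v hv
      change (G.next σ' [] v).exp _ = (G.next σ [] v).exp _
      rw [heq v hv]
      exact ProbDist.exp_congr_of_support _ fun w hw => ih w (hC v hv w hw)
  refine tendsto_nhds_unique (hσ'.tendsto_stepVal v i) ?_
  simpa only [this _ v hv] using hσ.tendsto_stepVal v i

/-- From a closed set without winning vertices the payoff is zero. -/
theorem StatProfile.payoff_eq_zero {G : SSMG P V} {σ : G.Profile} (hσ : G.StatProfile σ)
    (C : Set V) (hC : ∀ v ∈ C, ∀ w, 0 < (G.next σ [] v).1 w → w ∈ C) (i : P)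
    (hwin : ∀ v ∈ C, v ∉ G.win i) (v : V) (hv : v ∈ C) : G.payoff v σ i = 0 := by
  have : ∀ n, ∀ v ∈ C, G.stepVal σ i n v = 0 := by
    intro n
    induction n with
    | zero => exact fun v hv => Set.indicator_of_notMem (hwin v hv) _
    | succ n ih =>
      intro v hv
      change (G.next σ [] v).exp _ = 0
      rw [ProbDist.exp_congr_of_support _ fun w hw => ih w (hC v hv w hw), ProbDist.exp_const]
  refine tendsto_nhds_unique (hσ.tendsto_stepVal v i) ?_
  simpa only [this _ v hv] using tendsto_const_nhds

/-- At a vertex without other successors the payoff is `1` or `0`. -/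
theorem StatProfile.payoff_of_terminal {G : SSMG P V} {σ : G.Profile} (hσ : G.StatProfile σ)
    {v : V} (hv : ∀ w, 0 < (G.next σ [] v).1 w → w = v) (i : P) :
    G.payoff v σ i = G.winInd i v := by
  have : ∀ n, G.stepVal σ i n v = G.winInd i v := by
    intro n
    induction n with
    | zero => rfl
    | succ n ih =>
      change (G.next σ [] v).exp _ = _
      rw [ProbDist.eq_of_support_subset_singleton hv, ih]
  refine tendsto_nhds_unique (hσ.tendsto_stepVal v i) ?_
  simpa only [this] using tendsto_const_nhds

theorem StatProfile.winInd_le_payoff {G : SSMG P V} {σ : G.Profile} (hσ : G.StatProfile σ)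
    (i : P) (v : V) : G.winInd i v ≤ G.payoff v σ i := by
  by_cases hv : v ∈ G.win i
  · exact (hσ.payoff_of_terminal (fun w => G.next_support_of_win σ [] v hv w) i).ge
  · rw [winInd, Set.indicator_of_notMem hv]
    exact G.payoff_nonneg v σ i

variable [DecidableEq P]

/-- One-shot deviations suffice: if no single change of a choice of player `i` improves her
payoff, then neither does any other strategy, stationary or not. -/
theorem StatProfile.payoff_update_le {G : SSMG P V} {σ : G.Profile} (hσ : G.StatProfile σ)
    (v₀ : V) (i : P)
    (h : ∀ v S, G.node v = .player i S → ∀ w ∈ S, G.payoff w σ i ≤ G.payoff v σ i)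
    (τ : G.Strategy i) : G.payoff v₀ (Function.update σ i τ) i ≤ G.payoff v₀ σ i := by
  refine G.payoff_le_of_superharmonic v₀ _ i (fun v => G.payoff v σ i)
    (hσ.winInd_le_payoff i) fun x v => ?_
  cases hn : G.node v with
  | chance μ => rw [hσ.payoff_eq_of_chance hn, next, hn]
  | player j S =>
    by_cases hj : j = i
    · subst hj
      have h2 : G.next (Function.update σ j τ) x v = τ.act x v := by
        rw [next, hn]; simp
      rw [h2]
      calc (τ.act x v).exp (fun w => G.payoff w σ j)
          ≤ (τ.act x v).exp (fun _ => G.payoff v σ j) :=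
            ProbDist.exp_mono_of_support _ fun w hw => h v S hn w (τ.legal x v S hn w hw)
        _ = G.payoff v σ j := ProbDist.exp_const _ _
    · have h2 : G.next (Function.update σ i τ) x v = G.next σ x v := by
        rw [next, next, hn]; simp [Function.update_of_ne hj]
      rw [h2, hσ.next_eq, ← hσ.payoff_eq_exp]

theorem StatProfile.payoff_deviate_self {G : SSMG P V} {σ : G.Profile} (hσ : G.StatProfile σ)
    (i : P) (v w : V) (hw : ∀ S, G.node v = .player i S → w ∈ S) {S : Set V}
    (hv : G.node v = .player i S) (j : P) :
    G.payoff v (Function.update σ i ((σ i).deviate v w hw)) j =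
      G.payoff w (Function.update σ i ((σ i).deviate v w hw)) j := by
  classical
  rw [(hσ.deviate i v w hw).payoff_eq_of_player hv, Function.update_self]
  simp only [Strategy.deviate, if_pos]
  convert! ProbDist.exp_point w _

end SSMG


/-! ### The gadget inside a larger game -/

theorem ProbDist.mem_of_exp_indicator_compl {V : Type*} [Fintype V] {μ : ProbDist V} {C : Set V}
    (h : μ.exp (Cᶜ.indicator 1) = 0) {w : V} (hw : 0 < μ.1 w) : w ∈ C := by
  by_contra hC
  have hnn : ∀ u ∈ Finset.univ, 0 ≤ μ.1 u * (Cᶜ.indicator 1 u : ℝ) := fun u _ =>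
    mul_nonneg (μ.2.1 u) (Set.indicator_nonneg (fun _ _ => zero_le_one) u)
  have h1 := (Finset.sum_eq_zero_iff_of_nonneg hnn).1 h w (Finset.mem_univ w)
  rw [Set.indicator_of_mem (show w ∈ Cᶜ from hC), Pi.one_apply, mul_one] at h1
  exact hw.ne' h1

/-- The stationary profile in which the owner of a vertex `v` always moves according to `c v`. -/
def SSMG.profileOf {P V : Type*} [Fintype V] (G : SSMG P V) (c : V → ProbDist V)
    (hc : ∀ i v S, G.node v = .player i S → ∀ w, 0 < (c v).1 w → w ∈ S) : G.Profile :=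
  fun i => { act := fun _ => c, legal := fun _ => hc i }

theorem SSMG.statProfile_profileOf {P V : Type*} [Fintype V] (G : SSMG P V) (c : V → ProbDist V)
    (hc : ∀ i v S, G.node v = .player i S → ∀ w, 0 < (c v).1 w → w ∈ S) :
    G.StatProfile (G.profileOf c hc) := fun _ _ _ _ _ => rfl

open GadgetVertex in
/-- The map `g` embeds a copy of the gadget `G(p)` into the game `G`. Distributions of stochastic
vertices are described by the expectations that they give. -/
structure IsGadget {V : Type*} [Fintype V] (G : SSMG (Fin 4) V) (p : ℝ)
    (g : GadgetVertex → V) : Prop where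
  inj : Function.Injective g
  node_s : G.node (g s) = .player 1 {g a₁, g out₁}
  node_s₁ : G.node (g s₁) = .player 0 {g t, g w₀₁}
  node_t : G.node (g t) = .player 2 {g a₂, g out₂}
  node_s₂ : G.node (g s₂) = .player 0 {g s, g w₀₂}
  node_a₁ : ∃ μ, G.node (g a₁) = .chance μ ∧
    ∀ f, μ.exp f = p * f (g s₁) + (1 - p) * f (g w₀₃)
  node_a₂ : ∃ μ, G.node (g a₂) = .chance μ ∧
    ∀ f, μ.exp f = p * f (g s₂) + (1 - p) * f (g w₀)
  node_out₁ : ∃ μ, G.node (g out₁) = .chance μ ∧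
    ∀ f, μ.exp f = 1 / 2 * f (g w₀₁) + (1 - 1 / 2) * f (g w₀)
  node_out₂ : ∃ μ, G.node (g out₂) = .chance μ ∧
    ∀ f, μ.exp f = 1 / 2 * f (g w₀₂) + (1 - 1 / 2) * f (g w₀)
  terminal : ∀ v ∈ ({w₀, w₀₁, w₀₂, w₀₃} : Set GadgetVertex), ∃ μ, G.node (g v) = .chance μ ∧
    ∀ f, μ.exp f = f (g v)
  win_iff : ∀ i v, g v ∈ G.win i ↔ v ∈ gadgetWin i

open GadgetVertex in
/-- Under the profile `σ`, player 1 moves from `s` to `a₁` with probability `x`, player 2 moves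
from `t` to `a₂` with probability `y`, and player 0 moves from `s₁` to `t` with probability `α`
and from `s₂` to `s` with probability `β`. -/
structure IsGadgetPlay {V : Type*} [Fintype V] (G : SSMG (Fin 4) V) (σ : G.Profile)
    (g : GadgetVertex → V) (x y α β : ℝ) : Prop where
  next_s : ∀ f, (G.next σ [] (g s)).exp f = x * f (g a₁) + (1 - x) * f (g out₁)
  next_t : ∀ f, (G.next σ [] (g t)).exp f = y * f (g a₂) + (1 - y) * f (g out₂)
  next_s₁ : ∀ f, (G.next σ [] (g s₁)).exp f = α * f (g t) + (1 - α) * f (g w₀₁)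
  next_s₂ : ∀ f, (G.next σ [] (g s₂)).exp f = β * f (g s) + (1 - β) * f (g w₀₂)

namespace IsGadget

open GadgetVertex SSMG

variable {V : Type*} [Fintype V] {G : SSMG (Fin 4) V} {p : ℝ} {g : GadgetVertex → V}

theorem next_of_chance {σ : G.Profile} {v : V} {μ : ProbDist V} (hv : G.node v = .chance μ) :
    G.next σ [] v = μ := by
  rw [SSMG.next, hv]

theorem next_of_player {σ : G.Profile} {v : V} {i : Fin 4} {S : Set V}
    (hv : G.node v = .player i S) : G.next σ [] v = (σ i).act [] v := by
  rw [SSMG.next, hv]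

theorem isGadgetPlay (hg : IsGadget G p g) (σ : G.Profile) :
    IsGadgetPlay G σ g ((G.next σ [] (g s)).1 (g a₁)) ((G.next σ [] (g t)).1 (g a₂))
      ((G.next σ [] (g s₁)).1 (g t)) ((G.next σ [] (g s₂)).1 (g s)) where
  next_s := by
    rw [next_of_player hg.node_s]
    exact ProbDist.exp_of_support_subset_pair (hg.inj.ne (by decide))
      ((σ 1).legal [] _ _ hg.node_s)
  next_t := by
    rw [next_of_player hg.node_t]
    exact ProbDist.exp_of_support_subset_pair (hg.inj.ne (by decide))
      ((σ 2).legal [] _ _ hg.node_t)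
  next_s₁ := by
    rw [next_of_player hg.node_s₁]
    exact ProbDist.exp_of_support_subset_pair (hg.inj.ne (by decide))
      ((σ 0).legal [] _ _ hg.node_s₁)
  next_s₂ := by
    rw [next_of_player hg.node_s₂]
    exact ProbDist.exp_of_support_subset_pair (hg.inj.ne (by decide))
      ((σ 0).legal [] _ _ hg.node_s₂)

theorem winInd_apply (hg : IsGadget G p g) (i : Fin 4) (v : GadgetVertex) :
    G.winInd i (g v) = (gadgetWin i).indicator 1 v := by
  by_cases h : v ∈ gadgetWin i
  · rw [winInd, Set.indicator_of_mem ((hg.win_iff i v).2 h), Set.indicator_of_mem h]; rfl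
  · rw [winInd, Set.indicator_of_notMem (mt (hg.win_iff i v).1 h), Set.indicator_of_notMem h]

/-- No play leaves the gadget. -/
theorem closed (hg : IsGadget G p g) (σ : G.Profile) :
    ∀ v ∈ Set.range g, ∀ w, 0 < (G.next σ [] v).1 w → w ∈ Set.range g := by
  have hplay := hg.isGadgetPlay σ
  have hterm : ∀ v ∈ ({w₀, w₀₁, w₀₂, w₀₃} : Set GadgetVertex), ∀ w,
      0 < (G.next σ [] (g v)).1 w → w ∈ Set.range g := by
    intro v hv w hw
    obtain ⟨μ, h1, h2⟩ := hg.terminal v hv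
    rw [next_of_chance h1] at hw
    exact ProbDist.mem_of_exp_indicator_compl (by simp [h2]) hw
  rintro _ ⟨v, rfl⟩ w hw
  cases v with
  | s => exact ProbDist.mem_of_exp_indicator_compl (by simp [hplay.next_s]) hw
  | t => exact ProbDist.mem_of_exp_indicator_compl (by simp [hplay.next_t]) hw
  | s₁ => exact ProbDist.mem_of_exp_indicator_compl (by simp [hplay.next_s₁]) hw
  | s₂ => exact ProbDist.mem_of_exp_indicator_compl (by simp [hplay.next_s₂]) hw
  | a₁ =>
    obtain ⟨μ, h1, h2⟩ := hg.node_a₁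
    rw [next_of_chance h1] at hw
    exact ProbDist.mem_of_exp_indicator_compl (by simp [h2]) hw
  | a₂ =>
    obtain ⟨μ, h1, h2⟩ := hg.node_a₂
    rw [next_of_chance h1] at hw
    exact ProbDist.mem_of_exp_indicator_compl (by simp [h2]) hw
  | out₁ =>
    obtain ⟨μ, h1, h2⟩ := hg.node_out₁
    rw [next_of_chance h1] at hw
    exact ProbDist.mem_of_exp_indicator_compl (by simp [h2]) hw
  | out₂ =>
    obtain ⟨μ, h1, h2⟩ := hg.node_out₂
    rw [next_of_chance h1] at hw
    exact ProbDist.mem_of_exp_indicator_compl (by simp [h2]) hw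
  | w₀ => exact hterm _ (by simp) w hw
  | w₀₁ => exact hterm _ (by simp) w hw
  | w₀₂ => exact hterm _ (by simp) w hw
  | w₀₃ => exact hterm _ (by simp) w hw

variable [MeasurableSpace V] [DiscreteMeasurableSpace V]

theorem payoff_terminal (hg : IsGadget G p g) {σ : G.Profile} (hσ : G.StatProfile σ) (i : Fin 4)
    (v : GadgetVertex) (hv : v ∈ ({w₀, w₀₁, w₀₂, w₀₃} : Set GadgetVertex)) :
    G.payoff (g v) σ i = (gadgetWin i).indicator 1 v := by
  rw [← hg.winInd_apply]
  obtain ⟨μ, h1, h2⟩ := hg.terminal v hv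
  refine hσ.payoff_of_terminal (fun w hw => ?_) i
  rw [next_of_chance h1] at hw
  refine ProbDist.mem_of_exp_indicator_compl (C := {g v}) ?_ hw
  rw [h2, Set.indicator_of_notMem (by simp)]

section Values

variable {σ : G.Profile} {x y α β : ℝ}

theorem payoff_s (hσ : G.StatProfile σ) (h : IsGadgetPlay G σ g x y α β) (i : Fin 4) :
    G.payoff (g s) σ i = x * G.payoff (g a₁) σ i + (1 - x) * G.payoff (g out₁) σ i := by
  rw [hσ.payoff_eq_exp, h.next_s]

theorem payoff_t (hσ : G.StatProfile σ) (h : IsGadgetPlay G σ g x y α β) (i : Fin 4) :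
    G.payoff (g t) σ i = y * G.payoff (g a₂) σ i + (1 - y) * G.payoff (g out₂) σ i := by
  rw [hσ.payoff_eq_exp, h.next_t]

theorem payoff_s₁ (hg : IsGadget G p g) (hσ : G.StatProfile σ)
    (h : IsGadgetPlay G σ g x y α β) (i : Fin 4) :
    G.payoff (g s₁) σ i =
      α * G.payoff (g t) σ i + (1 - α) * (gadgetWin i).indicator 1 w₀₁ := by
  rw [hσ.payoff_eq_exp, h.next_s₁, hg.payoff_terminal hσ i w₀₁ (by simp)]

theorem payoff_s₂ (hg : IsGadget G p g) (hσ : G.StatProfile σ)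
    (h : IsGadgetPlay G σ g x y α β) (i : Fin 4) :
    G.payoff (g s₂) σ i =
      β * G.payoff (g s) σ i + (1 - β) * (gadgetWin i).indicator 1 w₀₂ := by
  rw [hσ.payoff_eq_exp, h.next_s₂, hg.payoff_terminal hσ i w₀₂ (by simp)]

theorem payoff_a₁ (hg : IsGadget G p g) (hσ : G.StatProfile σ) (i : Fin 4) :
    G.payoff (g a₁) σ i =
      p * G.payoff (g s₁) σ i + (1 - p) * (gadgetWin i).indicator 1 w₀₃ := by
  obtain ⟨μ, h1, h2⟩ := hg.node_a₁
  rw [hσ.payoff_eq_of_chance h1, h2, hg.payoff_terminal hσ i w₀₃ (by simp)]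

theorem payoff_a₂ (hg : IsGadget G p g) (hσ : G.StatProfile σ) (i : Fin 4) :
    G.payoff (g a₂) σ i =
      p * G.payoff (g s₂) σ i + (1 - p) * (gadgetWin i).indicator 1 w₀ := by
  obtain ⟨μ, h1, h2⟩ := hg.node_a₂
  rw [hσ.payoff_eq_of_chance h1, h2, hg.payoff_terminal hσ i w₀ (by simp)]

theorem payoff_out₁ (hg : IsGadget G p g) (hσ : G.StatProfile σ) (i : Fin 4) :
    G.payoff (g out₁) σ i = 1 / 2 * (gadgetWin i).indicator 1 w₀₁ +
      (1 - 1 / 2) * (gadgetWin i).indicator 1 w₀ := by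
  obtain ⟨μ, h1, h2⟩ := hg.node_out₁
  rw [hσ.payoff_eq_of_chance h1, h2, hg.payoff_terminal hσ i w₀₁ (by simp),
    hg.payoff_terminal hσ i w₀ (by simp)]

theorem payoff_out₂ (hg : IsGadget G p g) (hσ : G.StatProfile σ) (i : Fin 4) :
    G.payoff (g out₂) σ i = 1 / 2 * (gadgetWin i).indicator 1 w₀₂ +
      (1 - 1 / 2) * (gadgetWin i).indicator 1 w₀ := by
  obtain ⟨μ, h1, h2⟩ := hg.node_out₂
  rw [hσ.payoff_eq_of_chance h1, h2, hg.payoff_terminal hσ i w₀₂ (by simp),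
    hg.payoff_terminal hσ i w₀ (by simp)]

theorem payoff_out₁_one (hg : IsGadget G p g) (hσ : G.StatProfile σ) :
    G.payoff (g out₁) σ 1 = 1 / 2 := by
  rw [hg.payoff_out₁ hσ]; simp [gadgetWin]

theorem payoff_out₂_two (hg : IsGadget G p g) (hσ : G.StatProfile σ) :
    G.payoff (g out₂) σ 2 = 1 / 2 := by
  rw [hg.payoff_out₂ hσ]; simp [gadgetWin]

theorem payoff_s_zero (hg : IsGadget G p g) (hσ : G.StatProfile σ)
    (h : IsGadgetPlay G σ g x y α β) :
    G.payoff (g s) σ 0 = x * (p * (α * (y * (p * (β * G.payoff (g s) σ 0 + (1 - β)) + (1 - p)) +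
      (1 - y)) + (1 - α)) + (1 - p)) + (1 - x) := by
  conv_lhs => rw [payoff_s hσ h, hg.payoff_a₁ hσ, hg.payoff_s₁ hσ h, payoff_t hσ h,
    hg.payoff_a₂ hσ, hg.payoff_s₂ hσ h, hg.payoff_out₁ hσ, hg.payoff_out₂ hσ]
  simp [gadgetWin]

theorem payoff_s_one (hg : IsGadget G p g) (hσ : G.StatProfile σ)
    (h : IsGadgetPlay G σ g x y α β) :
    G.payoff (g s) σ 1 =
      x * (p * ((1 - α) + α * (y * (p * (β * G.payoff (g s) σ 1))))) + (1 - x) / 2 := by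
  conv_lhs => rw [payoff_s hσ h, hg.payoff_a₁ hσ, hg.payoff_s₁ hσ h, payoff_t hσ h,
    hg.payoff_a₂ hσ, hg.payoff_s₂ hσ h, hg.payoff_out₁ hσ, hg.payoff_out₂ hσ]
  simp [gadgetWin]
  ring

theorem payoff_t_two (hg : IsGadget G p g) (hσ : G.StatProfile σ)
    (h : IsGadgetPlay G σ g x y α β) :
    G.payoff (g t) σ 2 =
      y * (p * ((1 - β) + β * (x * (p * (α * G.payoff (g t) σ 2))))) + (1 - y) / 2 := by
  conv_lhs => rw [payoff_t hσ h, hg.payoff_a₂ hσ, hg.payoff_s₂ hσ h, payoff_s hσ h,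
    hg.payoff_a₁ hσ, hg.payoff_s₁ hσ h, hg.payoff_out₁ hσ, hg.payoff_out₂ hσ]
  simp [gadgetWin]
  ring

theorem payoff_s_two (hg : IsGadget G p g) (hσ : G.StatProfile σ)
    (h : IsGadgetPlay G σ g x y α β) :
    G.payoff (g s) σ 2 = x * (p * (α * G.payoff (g t) σ 2)) := by
  conv_lhs => rw [payoff_s hσ h, hg.payoff_a₁ hσ, hg.payoff_s₁ hσ h, hg.payoff_out₁ hσ]
  simp [gadgetWin]

theorem payoff_s_three (hg : IsGadget G p g) (hσ : G.StatProfile σ)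
    (h : IsGadgetPlay G σ g x y α β) :
    G.payoff (g s) σ 3 = x * (p * (α * (y * (p * (β * G.payoff (g s) σ 3)))) + (1 - p)) := by
  conv_lhs => rw [payoff_s hσ h, hg.payoff_a₁ hσ, hg.payoff_s₁ hσ h, payoff_t hσ h,
    hg.payoff_a₂ hσ, hg.payoff_s₂ hσ h, hg.payoff_out₁ hσ, hg.payoff_out₂ hσ]
  simp [gadgetWin]

end Values

end IsGadget

/-! ### The optimal payoff of player 3 in the gadget -/

/-- The maximal payoff of player 3 in a stationary equilibrium of `G(p)`. -/
noncomputable def gadgetOpt (p : ℝ) : ℝ := (√(2 - 2 * p) - p + 1) / (2 * p + 2)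

/-- If moving from `s` to `a₁` with positive probability `x` pays at least the outside option
`1 / 2`, then the probability `α` of being sent on by player 0 is small. -/
theorem incentive_bound {p x y α β v : ℝ} (hx : 0 < x)
    (hxc : x * (p ^ 2 * α * β * y) ≤ 1)
    (hv : v = x * (p * ((1 - α) + α * (y * (p * (β * v))))) + (1 - x) / 2) (h : 1 / 2 ≤ v) :
    1 - p ^ 2 * α * β * y ≤ 2 * (p * (1 - α)) := by
  have h1 : v * (1 - x * (p ^ 2 * α * β * y)) = x * (p * (1 - α)) + (1 - x) / 2 := by
    linear_combination hv
  have h2 : 1 / 2 * (1 - x * (p ^ 2 * α * β * y)) ≤ x * (p * (1 - α)) + (1 - x) / 2 := by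
    rw [← h1]; exact mul_le_mul_of_nonneg_right h (by linarith)
  have h3 : x * (1 - p ^ 2 * α * β * y) ≤ x * (2 * (p * (1 - α))) := by linarith
  exact le_of_mul_le_mul_left h3 hx

/-- With `A = p * α` and `B = p * β`, the two incentive bounds limit the probability `A * B` of
completing a round: by the inequality of the means both of them hold for `√(A * B)`, and they say
that `(1 - √(A * B)) ^ 2` is at least `2 - 2 * p`. -/
theorem loop_bound {p A B : ℝ} (hA : 0 ≤ A) (hB : 0 ≤ B) (hAB : A * B ≤ 1)
    (h1 : 1 - A * B ≤ 2 * (p - A)) (h2 : 1 - A * B ≤ 2 * (p - B)) :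
    A * B ≤ (1 - √(2 - 2 * p)) ^ 2 := by
  have hq : √(A * B) ^ 2 = A * B := Real.sq_sqrt (mul_nonneg hA hB)
  have hq1 : √(A * B) ≤ 1 := Real.sqrt_le_one.2 hAB
  have hamgm : 2 * √(A * B) ≤ A + B := by
    refine abs_le_of_sq_le_sq' ?_ (by positivity) |>.2
    nlinarith [sq_nonneg (A - B)]
  have hr : √(2 - 2 * p) ≤ 1 - √(A * B) := by
    rw [Real.sqrt_le_left (by linarith)]
    nlinarith
  rw [← hq]
  exact pow_le_pow_left₀ (Real.sqrt_nonneg _) (by linarith) 2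

theorem gadgetOpt_eq {p : ℝ} (hp : -1 < p) (hp1 : p ≤ 1) :
    gadgetOpt p * (2 * (2 - √(2 - 2 * p))) = √(2 - 2 * p) := by
  have hr : √(2 - 2 * p) ^ 2 = 2 - 2 * p := Real.sq_sqrt (by linarith)
  rw [gadgetOpt, div_mul_eq_mul_div, div_eq_iff (by linarith)]
  linear_combination -2 * hr

/-- The bound on the payoff `v` of player 3: the probability of completing a round is at most
`(1 - r) ^ 2` with `r = √(2 - 2 * p)`, and `1 - (1 - r) ^ 2 = r * (2 - r)`. -/
theorem payoff_bound {p x y α β v : ℝ} (hp : 1 / 2 ≤ p) (hp1 : p < 1)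
    (hx : x ∈ Set.Icc (0 : ℝ) 1) (hy : y ∈ Set.Icc (0 : ℝ) 1)
    (hα : α ∈ Set.Icc (0 : ℝ) 1) (hβ : β ∈ Set.Icc (0 : ℝ) 1) (hv0 : 0 ≤ v)
    (hv : v = x * (p * (α * (y * (p * (β * v)))) + (1 - p)))
    (h1 : 0 < x → 1 - p ^ 2 * α * β * y ≤ 2 * (p * (1 - α)))
    (h2 : 0 < x → 0 < α → 0 < y → 1 - p ^ 2 * β * α * x ≤ 2 * (p * (1 - β))) :
    v ≤ gadgetOpt p := by
  have hr : √(2 - 2 * p) ^ 2 = 2 - 2 * p := Real.sq_sqrt (by linarith)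
  have hr0 : 0 < √(2 - 2 * p) := Real.sqrt_pos.2 (by linarith)
  have hr1 : √(2 - 2 * p) ≤ 1 := Real.sqrt_le_one.2 (by linarith)
  have hA : 0 ≤ p * α := mul_nonneg (by linarith) hα.1
  have hB : 0 ≤ p * β := mul_nonneg (by linarith) hβ.1
  have hA1 : p * α ≤ 1 := mul_le_one₀ hp1.le hα.1 hα.2
  have hB1 : p * β ≤ 1 := mul_le_one₀ hp1.le hβ.1 hβ.2
  have hAB0 : 0 ≤ (p * α) * (p * β) := mul_nonneg hA hB
  have hAB1 : (p * α) * (p * β) ≤ 1 := mul_le_one₀ hA1 hB hB1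
  have hZ : (p * α) * (p * β) * (x * y) ≤ (1 - √(2 - 2 * p)) ^ 2 := by
    by_cases h0 : (p * α) * (p * β) * (x * y) = 0
    · rw [h0]; positivity
    · have hx0 : 0 < x := hx.1.lt_of_ne fun h => h0 (by rw [← h]; ring)
      have hy0 : 0 < y := hy.1.lt_of_ne fun h => h0 (by rw [← h]; ring)
      have hα0 : 0 < α := hα.1.lt_of_ne fun h => h0 (by rw [← h]; ring)
      have h3 := h1 hx0
      have h4 := h2 hx0 hα0 hy0
      have hle : (p * α) * (p * β) * (x * y) ≤ (p * α) * (p * β) :=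
        mul_le_of_le_one_right hAB0 (mul_le_one₀ hx.2 hy.1 hy.2)
      have h5 := mul_le_of_le_one_right hAB0 hy.2
      have h6 := mul_le_of_le_one_right hAB0 hx.2
      exact hle.trans (loop_bound (p := p) hA hB hAB1 (by linarith) (by linarith))
  have h3 : v * (1 - (p * α) * (p * β) * (x * y)) = x * (1 - p) := by linear_combination hv
  have h4 : v * (√(2 - 2 * p) * (2 - √(2 - 2 * p))) ≤ √(2 - 2 * p) * (√(2 - 2 * p) / 2) := by
    have h5 : v * (√(2 - 2 * p) * (2 - √(2 - 2 * p))) ≤ v * (1 - (p * α) * (p * β) * (x * y)) :=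
      mul_le_mul_of_nonneg_left (by linarith) hv0
    have h6 : x * (1 - p) ≤ 1 - p := mul_le_of_le_one_left (by linarith) hx.2
    linarith
  have h5 : v * (2 - √(2 - 2 * p)) ≤ √(2 - 2 * p) / 2 := by
    refine le_of_mul_le_mul_left ?_ hr0
    linarith
  have h6 := gadgetOpt_eq (by linarith) hp1.le
  refine le_of_mul_le_mul_right ?_ (show 0 < 2 * (2 - √(2 - 2 * p)) by linarith)
  linarith

/-- The probability with which player 0 sends the play on in the optimal equilibrium. For `p = 1`
the play must not be sent on, as it would never end. -/
noncomputable def loopProb (p : ℝ) : ℝ := if p < 1 then (1 - √(2 - 2 * p)) / p else 0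

theorem loopProb_mem {p : ℝ} (hp : 1 / 2 ≤ p) : loopProb p ∈ Set.Icc (0 : ℝ) 1 := by
  unfold loopProb
  split_ifs with h
  · have hr1 : √(2 - 2 * p) ≤ 1 := Real.sqrt_le_one.2 (by linarith)
    have hr : 1 - p ≤ √(2 - 2 * p) := Real.le_sqrt_of_sq_le (by nlinarith)
    constructor
    · exact div_nonneg (by linarith) (by linarith)
    · rw [div_le_one (by linarith)]; linarith
  · simp

theorem loopProb_spec {p : ℝ} (hp : 1 / 2 ≤ p) (hp1 : p ≤ 1) :
    (p * loopProb p) ^ 2 < 1 ∧ 1 - (p * loopProb p) ^ 2 ≤ 2 * (p * (1 - loopProb p)) ∧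
      1 - p = gadgetOpt p * (1 - (p * loopProb p) ^ 2) := by
  rcases hp1.eq_or_lt with rfl | h
  · norm_num [loopProb, gadgetOpt]
  · have hr : √(2 - 2 * p) ^ 2 = 2 - 2 * p := Real.sq_sqrt (by linarith)
    have hr0 : 0 < √(2 - 2 * p) := Real.sqrt_pos.2 (by linarith)
    have hr1 : √(2 - 2 * p) ≤ 1 := Real.sqrt_le_one.2 (by linarith)
    have h1 : p * loopProb p = 1 - √(2 - 2 * p) := by
      rw [loopProb, if_pos h, mul_div_cancel₀ _ (by linarith)]
    have h2 := gadgetOpt_eq (by linarith) hp1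
    refine ⟨?_, ?_, ?_⟩
    · rw [h1]; nlinarith
    · have : p * (1 - loopProb p) = p - p * loopProb p := by ring
      rw [this, h1]; nlinarith
    · rw [h1]
      linear_combination -hr / 2 - √(2 - 2 * p) / 2 * h2

namespace IsGadget

open GadgetVertex SSMG

variable {V : Type*} [Fintype V] {G : SSMG (Fin 4) V} {p : ℝ} {g : GadgetVertex → V}
  [MeasurableSpace V] [DiscreteMeasurableSpace V] {σ : G.Profile}

theorem payoff_three_le (hg : IsGadget G p g) (hp : 1 / 2 ≤ p) (hp1 : p < 1)
    (hσ : G.StatProfile σ) (h1 : 1 / 2 ≤ G.payoff (g s) σ 1)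
    (h2 : 0 < (G.next σ [] (g s)).1 (g a₁) → 0 < (G.next σ [] (g s₁)).1 (g t) →
      1 / 2 ≤ G.payoff (g t) σ 2) : G.payoff (g s) σ 3 ≤ gadgetOpt p := by
  have hplay := hg.isGadgetPlay σ
  have hI : ∀ v w, (G.next σ [] v).1 w ∈ Set.Icc (0 : ℝ) 1 := fun v w =>
    ⟨(G.next σ [] v).2.1 w, ProbDist.le_one _ w⟩
  have hx := hI (g s) (g a₁)
  have hy := hI (g t) (g a₂)
  have hα := hI (g s₁) (g t)
  have hβ := hI (g s₂) (g s)
  have e1 := hg.payoff_s_one hσ hplay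
  have e2 := hg.payoff_t_two hσ hplay
  have e3 := hg.payoff_s_three hσ hplay
  generalize (G.next σ [] (g s)).1 (g a₁) = x at *
  generalize (G.next σ [] (g t)).1 (g a₂) = y at *
  generalize (G.next σ [] (g s₁)).1 (g t) = α at *
  generalize (G.next σ [] (g s₂)).1 (g s) = β at *
  have hle : p ^ 2 * α * β ≤ 1 :=
    mul_le_one₀ (mul_le_one₀ (pow_le_one₀ (by linarith) hp1.le) hα.1 hα.2) hβ.1 hβ.2
  have hle' : p ^ 2 * β * α ≤ 1 := by linarith
  have h0 : 0 ≤ p ^ 2 * α * β := mul_nonneg (mul_nonneg (sq_nonneg p) hα.1) hβ.1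
  refine payoff_bound hp hp1 hx hy hα hβ (G.payoff_nonneg _ σ 3) e3 (fun hx0 => ?_)
    (fun hx0 hα0 hy0 => ?_)
  · exact incentive_bound hx0
      (mul_le_one₀ hx.2 (mul_nonneg h0 hy.1) (mul_le_one₀ hle hy.1 hy.2)) e1 h1
  · exact incentive_bound hy0
      (mul_le_one₀ hy.2 (mul_nonneg (by linarith) hx.1) (mul_le_one₀ hle' hx.1 hx.2)) e2
      (h2 hx0 hα0)

theorem payoff_three_eq_zero (hg : IsGadget G 1 g) (hσ : G.StatProfile σ) :
    G.payoff (g s) σ 3 = 0 := by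
  -- For `p = 1` the vertex `w₀₃` cannot be reached.
  refine hσ.payoff_eq_zero {v | v ∈ Set.range g ∧ v ≠ g w₀₃} ?_ 3 ?_ (g s)
    ⟨⟨s, rfl⟩, hg.inj.ne (by decide)⟩
  · rintro _ ⟨⟨v, rfl⟩, hv⟩ w hw
    refine ⟨hg.closed σ _ ⟨v, rfl⟩ w hw, ?_⟩
    have hplay := hg.isGadgetPlay σ
    have hne : ∀ u, u ≠ w₀₃ → ({g w₀₃} : Set V)ᶜᶜ.indicator (1 : V → ℝ) (g u) = 0 := fun u hu =>
      Set.indicator_of_notMem (by simpa using hg.inj.ne hu) _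
    suffices h : (G.next σ [] (g v)).exp (({g w₀₃} : Set V)ᶜᶜ.indicator 1) = 0 from
      ProbDist.mem_of_exp_indicator_compl h hw
    have hterm : ∀ v ∈ ({w₀, w₀₁, w₀₂, w₀₃} : Set GadgetVertex), v ≠ w₀₃ →
        (G.next σ [] (g v)).exp (({g w₀₃} : Set V)ᶜᶜ.indicator 1) = 0 := by
      intro v hv hv'
      obtain ⟨μ, h1, h2⟩ := hg.terminal v hv
      rw [next_of_chance h1, h2, hne v hv']
    cases v with
    | s => rw [hplay.next_s, hne _ (by decide), hne _ (by decide)]; simp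
    | t => rw [hplay.next_t, hne _ (by decide), hne _ (by decide)]; simp
    | s₁ => rw [hplay.next_s₁, hne _ (by decide), hne _ (by decide)]; simp
    | s₂ => rw [hplay.next_s₂, hne _ (by decide), hne _ (by decide)]; simp
    | a₁ =>
      obtain ⟨μ, h1, h2⟩ := hg.node_a₁
      rw [next_of_chance h1, h2, hne _ (by decide)]; simp
    | a₂ =>
      obtain ⟨μ, h1, h2⟩ := hg.node_a₂
      rw [next_of_chance h1, h2, hne _ (by decide), hne _ (by decide)]; simp
    | out₁ =>
      obtain ⟨μ, h1, h2⟩ := hg.node_out₁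
      rw [next_of_chance h1, h2, hne _ (by decide), hne _ (by decide)]; simp
    | out₂ =>
      obtain ⟨μ, h1, h2⟩ := hg.node_out₂
      rw [next_of_chance h1, h2, hne _ (by decide), hne _ (by decide)]; simp
    | w₀ => exact hterm _ (by simp) (by decide)
    | w₀₁ => exact hterm _ (by simp) (by decide)
    | w₀₂ => exact hterm _ (by simp) (by decide)
    | w₀₃ => exact absurd rfl hv
  · rintro _ ⟨⟨v, rfl⟩, hv⟩ h
    rw [hg.win_iff] at h
    exact hv (by rw [show v = w₀₃ from h])

/-- The payoffs of the optimal equilibrium. -/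
theorem payoff_of_loopProb (hg : IsGadget G p g) (hp : 1 / 2 ≤ p) (hp1 : p ≤ 1)
    (hσ : G.StatProfile σ) (h : IsGadgetPlay G σ g 1 1 (loopProb p) (loopProb p)) :
    G.payoff (g s) σ 0 = 1 ∧ 1 / 2 ≤ G.payoff (g s) σ 1 ∧ 1 / 2 ≤ G.payoff (g t) σ 2 ∧
      G.payoff (g s) σ 3 = gadgetOpt p := by
  obtain ⟨hc, h1, h3⟩ := loopProb_spec hp hp1
  have hc' : 0 < 1 - (p * loopProb p) ^ 2 := by linarith
  have e0 := hg.payoff_s_zero hσ h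
  have e1 := hg.payoff_s_one hσ h
  have e2 := hg.payoff_t_two hσ h
  have e3 := hg.payoff_s_three hσ h
  refine ⟨mul_right_cancel₀ hc'.ne' (by linear_combination e0),
    le_of_mul_le_mul_right ?_ hc', le_of_mul_le_mul_right ?_ hc',
    mul_right_cancel₀ hc'.ne' (by linear_combination e3 + h3)⟩
  · have : G.payoff (g s) σ 1 * (1 - (p * loopProb p) ^ 2) = p * (1 - loopProb p) := by
      linear_combination e1
    linarith
  · have : G.payoff (g t) σ 2 * (1 - (p * loopProb p) ^ 2) = p * (1 - loopProb p) := by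
      linear_combination e2
    linarith

end IsGadget

/-! ### The gadget on its own -/

section Gadget

open GadgetVertex

theorem isGadget_gadget (p : unitInterval) : IsGadget (gadget p) p id where
  inj := Function.injective_id
  node_s := rfl
  node_s₁ := rfl
  node_t := rfl
  node_s₂ := rfl
  node_a₁ := ⟨_, rfl, ProbDist.exp_mix p s₁ w₀₃⟩
  node_a₂ := ⟨_, rfl, ProbDist.exp_mix p s₂ w₀⟩
  node_out₁ := ⟨_, rfl, ProbDist.exp_mix oneHalf w₀₁ w₀⟩
  node_out₂ := ⟨_, rfl, ProbDist.exp_mix oneHalf w₀₂ w₀⟩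
  terminal v hv := by
    rcases hv with rfl | rfl | rfl | rfl <;> exact ⟨_, rfl, ProbDist.exp_point _⟩
  win_iff _ _ := Iff.rfl

theorem ProbDist.mem_of_mix_pos {V : Type*} [Fintype V] [DecidableEq V] {p : unitInterval}
    {a b w : V} (h : 0 < (ProbDist.mix p a b).1 w) : w = a ∨ w = b := by
  by_contra! hne
  simp [ProbDist.mix, hne.1, hne.2] at h

theorem ProbDist.eq_of_point_pos {V : Type*} [Fintype V] [DecidableEq V]
    {a w : V} (h : 0 < (ProbDist.point a).1 w) : w = a := by
  by_contra hne
  simp [ProbDist.point, hne] at h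

/-- The choices in the optimal equilibrium of the gadget. -/
noncomputable def gadgetChoice (p : ℝ) (hp : 1 / 2 ≤ p) : GadgetVertex → ProbDist GadgetVertex
  | s => .point a₁
  | s₁ => .mix ⟨loopProb p, loopProb_mem hp⟩ t w₀₁
  | t => .point a₂
  | s₂ => .mix ⟨loopProb p, loopProb_mem hp⟩ s w₀₂
  | v => .point v

theorem isGreatest_payoff_gadget (p : unitInterval) (hp : 1 / 2 ≤ (p : ℝ)) (hp1 : (p : ℝ) < 1) :
    IsGreatest {x : ℝ | ∃ σ : (gadget p).Profile, (gadget p).IsStationaryNash s σ ∧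
      (gadget p).payoff s σ 3 = x} (gadgetOpt p) := by
  have hg := isGadget_gadget p
  constructor
  · let σ : (gadget p).Profile := (gadget p).profileOf (gadgetChoice p hp) (by
      intro i v S hv w hw
      cases v <;> simp only [gadget, gadgetNode, Node.player.injEq, reduceCtorEq] at hv <;>
        simp only [gadgetChoice] at hw <;> obtain ⟨-, rfl⟩ := hv <;> first
        | exact Or.inl (ProbDist.eq_of_point_pos hw)
        | exact ProbDist.mem_of_mix_pos hw)
    have hσ : (gadget p).StatProfile σ := SSMG.statProfile_profileOf _ _ _
    have hplay : IsGadgetPlay (gadget p) σ id 1 1 (loopProb p) (loopProb p) :=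
      { next_s := fun f => (ProbDist.exp_point (V := GadgetVertex) _ f).trans (by simp)
        next_t := fun f => (ProbDist.exp_point (V := GadgetVertex) _ f).trans (by simp)
        next_s₁ := fun f => ProbDist.exp_mix _ _ _ _
        next_s₂ := fun f => ProbDist.exp_mix _ _ _ _ }
    obtain ⟨h0, h1, h2, h3⟩ := hg.payoff_of_loopProb hp hp1.le hσ hplay
    refine ⟨σ, ⟨hσ, fun i τ => ?_⟩, h3⟩
    -- Player 0 wins almost surely; for the other players it suffices to compare single moves.
    by_cases hi : i = 0
    · subst hi
      exact ((gadget p).payoff_le_one _ _ _).trans h0.ge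
    · refine hσ.payoff_update_le s i (fun v S hv w hw => ?_) τ
      cases v <;> simp only [gadget, gadgetNode, Node.player.injEq, reduceCtorEq] at hv
      · obtain ⟨rfl, rfl⟩ := hv
        rcases hw with rfl | rfl
        · have := IsGadget.payoff_s hσ hplay 1
          exact (by simpa using this : (gadget p).payoff s σ 1 = _).ge
        · exact (hg.payoff_out₁_one hσ).trans_le h1
      · exact absurd hv.1.symm hi
      · obtain ⟨rfl, rfl⟩ := hv
        rcases hw with rfl | rfl
        · have := IsGadget.payoff_t hσ hplay 2
          exact (by simpa using this : (gadget p).payoff t σ 2 = _).ge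
        · exact (hg.payoff_out₂_two hσ).trans_le h2
      · exact absurd hv.1.symm hi
  · rintro _ ⟨σ, ⟨hσ, hN⟩, rfl⟩
    have hout₁ : ∀ S, (gadget p).node s = .player 1 S → out₁ ∈ S := by
      intro S hS
      obtain ⟨-, rfl⟩ := Node.player.inj (hg.node_s.symm.trans hS)
      simp
    have hout₂ : ∀ S, (gadget p).node t = .player 2 S → out₂ ∈ S := by
      intro S hS
      obtain ⟨-, rfl⟩ := Node.player.inj (hg.node_t.symm.trans hS)
      simp
    refine hg.payoff_three_le hp hp1 hσ ?_ fun hx hα => ?_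
    · have h := hN 1 ((σ 1).deviate s out₁ hout₁)
      have hσ' := SSMG.StatProfile.deviate hσ 1 s out₁ hout₁
      rw [SSMG.StatProfile.payoff_deviate_self hσ 1 s out₁ hout₁ hg.node_s] at h
      exact (hg.payoff_out₁_one hσ').symm.trans_le h
    · have h := hN 2 ((σ 2).deviate t out₂ hout₂)
      have hσ' := SSMG.StatProfile.deviate hσ 2 t out₂ hout₂
      have hplay := hg.isGadgetPlay σ
      have hplay' := hg.isGadgetPlay (Function.update σ 2 ((σ 2).deviate t out₂ hout₂))
      have e := hg.payoff_s_two hσ hplay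
      have e' := hg.payoff_s_two hσ' hplay'
      have ht : (gadget p).payoff t _ 2 = 1 / 2 :=
        (SSMG.StatProfile.payoff_deviate_self hσ 2 t out₂ hout₂ hg.node_t 2).trans
          (hg.payoff_out₂_two hσ')
      simp only [id] at e e' hx hα ⊢
      rw [SSMG.StatProfile.next_deviate_of_ne 2 t out₂ hout₂ (by decide),
        SSMG.StatProfile.next_deviate_of_ne 2 t out₂ hout₂ (by decide), ht] at e'
      rw [e, e'] at h
      have hpos : 0 < ((gadget p).next σ [] s).1 a₁ * (p * ((gadget p).next σ [] s₁).1 t) :=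
        mul_pos hx (mul_pos (by linarith) hα)
      refine le_of_mul_le_mul_left ?_ hpos
      linarith

end Gadget


/-! ### The game of the reduction -/

/-- The numbers on which a row of the transition table depends: the width `m` of the binary
numbers, the number `n` of gadgets, the number `k` and the entry `d` of the list. -/
structure RowEnv where
  m : ℕ
  n : ℕ
  k : ℕ
  d : ℕ

/-- The numerators in the transition table. -/
inductive Numer
  | lit (c : ℕ) | d | compD | k | compK

/-- The denominators in the transition table. -/
inductive Denom
  | lit (c : ℕ+) | pow | copies | twoCopies | powK

/-- `compD` and `compK` are the numerators of the complementary probabilities. -/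
def Numer.val (e : RowEnv) : Numer → ℕ
  | lit c => c
  | d => e.d
  | compD => 2 ^ (2 * e.m + 1) - e.d
  | k => e.k
  | compK => 2 ^ e.m - e.k

def Denom.val (e : RowEnv) : Denom → ℕ+
  | lit c => c
  | pow => ⟨2 ^ (2 * e.m + 1), by positivity⟩
  | copies => ⟨e.n + 1, by positivity⟩
  | twoCopies => ⟨2 * (e.n + 1), by positivity⟩
  | powK => ⟨2 ^ e.m, by positivity⟩

/-- A row of the transition table. The vertices are 13 *hub* vertices and 8 vertices for each of
`n` blocks. The row of a vertex in a block has the entries `own` in the columns of this block and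
the entries `other` in those of other blocks; a player never moves to another block. -/
inductive RowSpec
  | player (i : Fin 4) (hub : Fin 13 → Bool) (own : Fin 8 → Bool)
  | chance (hub : Fin 13 → Numer × Denom) (own other : Fin 8 → Numer × Denom)

namespace Reduction

/-- The entry for probability zero. -/
def noMove : Numer × Denom := (.lit 0, .lit 1)

/-- The row of a vertex that is never left. -/
def terminalRow (h : Fin 13) : RowSpec :=
  .chance (fun c => if c = h then (.lit 1, .lit 1) else noMove) (fun _ => noMove) fun _ => noMove

/-- The rows of the hub vertices: `0` is the initial vertex, where player 3 chooses between the
*game* `1` and the *threshold* `2`. The game leads to vertices `0` and `6` of a random block. The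
threshold leads, by way of `3`, `4` and vertex `7` of the blocks, to the vertices `5`, where
everybody loses, and `10`, where only player 3 wins. The vertices `6, …, 9, 11, 12` are
`w₀, w₀₁, w₀₂, w₀₃, out₁, out₂`. -/
def hubRow : Fin 13 → RowSpec
  | 0 => .player 3 (fun | 1 | 2 => true | _ => false) fun _ => false
  | 1 => .chance (fun | 6 => (.lit 1, .copies) | _ => noMove) (fun _ => noMove)
      (fun | 0 | 6 => (.lit 1, .twoCopies) | _ => noMove)
  | 2 => .chance (fun | 3 => (.lit 1, .lit 4) | 5 => (.lit 3, .lit 4) | _ => noMove)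
      (fun _ => noMove) fun _ => noMove
  | 3 => .chance (fun | 4 => (.lit 1, .copies) | _ => noMove) (fun _ => noMove)
      (fun | 7 => (.lit 1, .copies) | _ => noMove)
  | 4 => .chance (fun | 5 => (.compK, .powK) | 10 => (.k, .powK) | _ => noMove)
      (fun _ => noMove) fun _ => noMove
  | 11 => .chance (fun | 6 | 7 => (.lit 1, .lit 2) | _ => noMove) (fun _ => noMove)
      fun _ => noMove
  | 12 => .chance (fun | 6 | 8 => (.lit 1, .lit 2) | _ => noMove) (fun _ => noMove)
      fun _ => noMove
  | h => terminalRow h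

/-- The rows of the vertices of a block: `0, …, 5` are `s, a₁, s₁, t, a₂, s₂`, the vertex `6` leads
to `s` with the same probability as `a₁` to `s₁`, and `7` belongs to the threshold. -/
def blockRow : Fin 8 → RowSpec
  | 0 => .player 1 (fun | 11 => true | _ => false) (fun | 1 => true | _ => false)
  | 1 => .chance (fun | 9 => (.d, .pow) | _ => noMove)
      (fun | 2 => (.compD, .pow) | _ => noMove) fun _ => noMove
  | 2 => .player 0 (fun | 7 => true | _ => false) (fun | 3 => true | _ => false)
  | 3 => .player 2 (fun | 12 => true | _ => false) (fun | 4 => true | _ => false)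
  | 4 => .chance (fun | 6 => (.d, .pow) | _ => noMove)
      (fun | 5 => (.compD, .pow) | _ => noMove) fun _ => noMove
  | 5 => .player 0 (fun | 8 => true | _ => false) (fun | 0 => true | _ => false)
  | 6 => .chance (fun | 6 => (.d, .pow) | _ => noMove)
      (fun | 0 => (.compD, .pow) | _ => noMove) fun _ => noMove
  | 7 => .chance (fun | 5 => (.compD, .pow) | 10 => (.d, .pow) | _ => noMove)
      (fun _ => noMove) fun _ => noMove

/-- The winning vertices of the four players, all of them in the hub. -/
def winRow : Fin 4 → Fin 13 → Bool
  | 0 => fun | 6 | 7 | 8 | 9 => true | _ => false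
  | 1 => fun | 7 => true | _ => false
  | 2 => fun | 8 => true | _ => false
  | 3 => fun | 9 | 10 => true | _ => false

/-- The numbering of the vertices. -/
def vertexEquiv (n : ℕ) : Fin 13 ⊕ Fin n × Fin 8 ≃ Fin (13 + n * 8) :=
  ((Equiv.refl _).sumCongr finProdFinEquiv).trans finSumFinEquiv

/-- The hub vertices. -/
def hub (n : ℕ) (h : Fin 13) : Fin (13 + n * 8) := vertexEquiv n (.inl h)

/-- The vertices of the blocks. -/
def blk {n : ℕ} (j : Fin n) (c : Fin 8) : Fin (13 + n * 8) := vertexEquiv n (.inr (j, c))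

/-- A function on the vertices that is given by its values on the hub, on one block `o` (if there
is such a block) and on all the other blocks. -/
def cell {α : Type*} {n : ℕ} (f : Fin 13 → α) (own other : Fin 8 → α) (o : Option (Fin n))
    (v : Fin (13 + n * 8)) : α :=
  Sum.elim f (fun x => if o = some x.1 then own x.2 else other x.2) ((vertexEquiv n).symm v)

@[simp] theorem cell_hub {α : Type*} {n : ℕ} (f : Fin 13 → α) (own other : Fin 8 → α)
    (o : Option (Fin n)) (h : Fin 13) : cell f own other o (hub n h) = f h := by
  simp [cell, hub]

@[simp] theorem cell_blk {α : Type*} {n : ℕ} (f : Fin 13 → α) (own other : Fin 8 → α)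
    (o : Option (Fin n)) (j : Fin n) (c : Fin 8) :
    cell f own other o (blk j c) = if o = some j then own c else other c := by
  simp [cell, blk]

theorem vertex_cases {n : ℕ} {motive : Fin (13 + n * 8) → Prop} (h1 : ∀ h, motive (hub n h))
    (h2 : ∀ (j : Fin n) c, motive (blk j c)) (v : Fin (13 + n * 8)) : motive v := by
  obtain ⟨x | x, rfl⟩ := (vertexEquiv n).surjective v
  · exact h1 x
  · exact h2 x.1 x.2

@[simp] theorem hub_inj {n : ℕ} {h h' : Fin 13} : hub n h = hub n h' ↔ h = h' := by
  simp [hub]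

@[simp] theorem blk_inj {n : ℕ} {j j' : Fin n} {c c' : Fin 8} :
    blk j c = blk j' c' ↔ j = j' ∧ c = c' := by
  simp [blk]

@[simp] theorem hub_ne_blk {n : ℕ} {h : Fin 13} {j : Fin n} {c : Fin 8} : hub n h ≠ blk j c := by
  simp [hub, blk]

@[simp] theorem blk_ne_hub {n : ℕ} {h : Fin 13} {j : Fin n} {c : Fin 8} : blk j c ≠ hub n h := by
  simp [hub, blk]

theorem sum_vertices {n : ℕ} {M : Type*} [AddCommMonoid M] (f : Fin (13 + n * 8) → M) :
    ∑ v, f v = ∑ h, f (hub n h) + ∑ j : Fin n, ∑ c, f (blk j c) := by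
  rw [← (vertexEquiv n).sum_comp, Fintype.sum_sum_type, Fintype.sum_prod_type]
  rfl

/-- The fraction that an entry of the table stands for. -/
def entry (e : RowEnv) (q : Numer × Denom) : ℕ × ℕ+ := (q.1.val e, q.2.val e)

/-- The probability that an entry of the table stands for. -/
noncomputable def prob (e : RowEnv) (q : Numer × Denom) : ℝ := (q.1.val e : ℝ) / (q.2.val e : ℕ)

theorem cast_fracVal_entry (e : RowEnv) (q : Numer × Denom) :
    (fracVal (entry e q) : ℝ) = prob e q := by
  simp [fracVal, entry, prob]

end Reduction

open Reduction in
/-- The entries of the row are probabilities with sum one. -/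
def RowSpec.Valid (e : RowEnv) (o : Option (Fin e.n)) : RowSpec → Prop
  | .player _ _ _ => True
  | .chance f own other =>
    ∑ v, fracVal (cell (entry e ∘ f) (entry e ∘ own) (entry e ∘ other) o v) = 1

open Reduction in
/-- The vertex that a row of the table describes. -/
def RowSpec.toRatNode (e : RowEnv) (o : Option (Fin e.n)) :
    (r : RowSpec) → r.Valid e o → RatNode 4 (13 + e.n * 8)
  | .player i f own, _ => .player i (cell f own (fun _ => false) o)
  | .chance f own other, h =>
    .chance ⟨cell (entry e ∘ f) (entry e ∘ own) (entry e ∘ other) o, h⟩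

namespace Reduction

theorem sum_cell (e : RowEnv) (o : Option (Fin e.n)) (f : Fin 13 → Numer × Denom)
    (own other : Fin 8 → Numer × Denom) (F : Fin (13 + e.n * 8) → ℝ) :
    ∑ v, (fracVal (cell (entry e ∘ f) (entry e ∘ own) (entry e ∘ other) o v) : ℝ) * F v =
      ∑ h, prob e (f h) * F (hub e.n h) +
        ∑ j, ∑ c, prob e (if o = some j then own c else other c) * F (blk j c) := by
  rw [sum_vertices]
  simp only [cell_hub, cell_blk, Function.comp_apply, ← apply_ite (entry e), cast_fracVal_entry]

theorem prob_noMove (e : RowEnv) : prob e noMove = 0 := by simp [prob, noMove, Numer.val]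

theorem sum_own (e : RowEnv) (i : Fin e.n) (own : Fin 8 → Numer × Denom)
    (F : Fin (13 + e.n * 8) → ℝ) :
    ∑ j, ∑ c, prob e (if some i = some j then own c else noMove) * F (blk j c) =
      ∑ c, prob e (own c) * F (blk i c) := by
  rw [Finset.sum_eq_single i]
  · simp
  · intro j _ hj
    simp [Ne.symm hj, prob_noMove]
  · simp

theorem valid_chance (e : RowEnv) (o : Option (Fin e.n)) (f : Fin 13 → Numer × Denom)
    (own other : Fin 8 → Numer × Denom)
    (h : ∑ h, prob e (f h) + ∑ j, ∑ c, prob e (if o = some j then own c else other c) = 1) :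
    (RowSpec.chance f own other).Valid e o := by
  have := sum_cell e o f own other fun _ => 1
  simp only [mul_one] at this
  rw [h] at this
  unfold RowSpec.Valid
  exact_mod_cast this

theorem sum_own_one (e : RowEnv) (i : Fin e.n) (own : Fin 8 → Numer × Denom) :
    ∑ j, ∑ c, prob e (if some i = some j then own c else noMove) = ∑ c, prob e (own c) := by
  simpa using sum_own e i own fun _ => 1

/-- The numbers that are written in binary are smaller than the denominators. -/
structure _root_.RowEnv.Small (e : RowEnv) : Prop where
  k_lt : e.k < 2 ^ e.m
  d_lt : e.d < 2 ^ e.m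

theorem _root_.RowEnv.Small.d_le {e : RowEnv} (he : e.Small) : 2 * e.d ≤ 2 ^ (2 * e.m + 1) := by
  have h1 : 2 ^ e.m ≤ 2 ^ (2 * e.m) := Nat.pow_le_pow_right (by norm_num) (by omega)
  have h2 := he.d_lt
  rw [pow_succ]
  omega

/-- The probability `p` of the gadget for the entry `d`. -/
noncomputable def gadgetProb (e : RowEnv) : ℝ := 1 - e.d / 2 ^ (2 * e.m + 1)

theorem prob_d (e : RowEnv) : prob e (.d, .pow) = 1 - gadgetProb e := by
  simp [prob, gadgetProb, Numer.val, Denom.val]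

theorem prob_compD {e : RowEnv} (he : e.Small) : prob e (.compD, .pow) = gadgetProb e := by
  have := he.d_le
  simp only [prob, gadgetProb, Numer.val, Denom.val, PNat.mk_coe]
  rw [Nat.cast_sub (by omega)]
  push_cast
  rw [sub_div, div_self (by positivity)]

theorem prob_k (e : RowEnv) : prob e (.k, .powK) = e.k / 2 ^ e.m := by
  simp [prob, Numer.val, Denom.val]

theorem prob_compK {e : RowEnv} (he : e.Small) :
    prob e (.compK, .powK) = 1 - e.k / 2 ^ e.m := by
  simp only [prob, Numer.val, Denom.val, PNat.mk_coe]
  rw [Nat.cast_sub he.k_lt.le]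
  push_cast
  rw [sub_div, div_self (by positivity)]

theorem prob_lit (e : RowEnv) (c : ℕ) (c' : ℕ+) :
    prob e (.lit c, .lit c') = (c : ℝ) / (c' : ℕ) := rfl

theorem prob_copies (e : RowEnv) : prob e (.lit 1, .copies) = 1 / (e.n + 1) := by
  simp [prob, Numer.val, Denom.val]

theorem prob_twoCopies (e : RowEnv) : prob e (.lit 1, .twoCopies) = 1 / (2 * (e.n + 1)) := by
  simp [prob, Numer.val, Denom.val]

theorem hubRow_valid {e : RowEnv} (he : e.Small) (h : Fin 13) : (hubRow h).Valid e none := by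
  fin_cases h
  all_goals try exact trivial
  all_goals
    refine valid_chance _ _ _ _ _ ?_
    simp [Fin.sum_univ_succ, prob_noMove, prob_copies, prob_twoCopies, prob_lit, prob_k,
      prob_compK he]
  all_goals norm_num
  all_goals field_simp
  all_goals ring

theorem blockRow_valid {e : RowEnv} (he : e.Small) (j : Fin e.n) (c : Fin 8) :
    (blockRow c).Valid e (some j) := by
  fin_cases c
  all_goals try exact trivial
  all_goals
    refine valid_chance _ _ _ _ _ ?_
    rw [sum_own_one]
    simp [Fin.sum_univ_succ, prob_noMove, prob_d, prob_compD he]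

end Reduction


/-! ### Binary numbers -/

open Computability in
theorem encodeNat_eq_bits (n : ℕ) : encodeNat n = n.bits := by
  have key : ∀ p : PosNum, encodePosNum p = (p : ℕ).bits := by
    intro p
    induction p with
    | one => simp [encodePosNum]
    | bit0 p ih =>
      rw [encodePosNum, ih, PosNum.cast_bit0, ← two_mul, Nat.bit0_bits _ (PosNum.cast_pos p).ne']
    | bit1 p ih =>
      rw [encodePosNum, ih, PosNum.cast_bit1, ← two_mul, Nat.bit1_bits]
  have h := Num.to_of_nat n
  unfold encodeNat
  cases hn : (n : Num) with
  | zero => rw [hn] at h; rw [← h]; simp [encodeNum]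
  | pos p => rw [hn] at h; rw [← h]; exact key p

theorem Nat.length_bits_le_encodeNats {a : ℕ} {l : List ℕ} (h : a ∈ l) :
    a.bits.length < (encodeNats l).length := by
  induction l with
  | nil => simp at h
  | cons b l ih =>
    simp only [encodeNats, List.flatMap_cons, List.length_append, List.length_map,
      encodeNat_eq_bits, List.length_singleton] at ih ⊢
    rcases List.mem_cons.1 h with rfl | h
    · omega
    · have := ih h
      omega

theorem Nat.lt_two_pow_of_length_bits_le {a m : ℕ} (h : a.bits.length ≤ m) : a < 2 ^ m := by
  rw [Nat.size_eq_bits_len] at h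
  exact Nat.size_le.1 h

/-! ### The reduction -/

namespace Reduction

/-- The environment for the entry `d` of the list of the instance `I`. The width is the length of
the input word, so that all numbers of `I` have fewer bits. -/
abbrev rowEnv (I : SqrtSumInstance) (d : ℕ) : RowEnv where
  m := (encodeNats I.code).length
  n := I.d.length
  k := I.k
  d := d

theorem rowEnv_small {I : SqrtSumInstance} {d : ℕ} (hd : d = 0 ∨ d ∈ I.d) :
    (rowEnv I d).Small where
  k_lt := Nat.lt_two_pow_of_length_bits_le
    (Nat.length_bits_le_encodeNats (by simp [SqrtSumInstance.code])).le
  d_lt := by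
    rcases hd with rfl | hd
    · positivity
    · exact Nat.lt_two_pow_of_length_bits_le
        (Nat.length_bits_le_encodeNats (by simp [SqrtSumInstance.code, hd])).le

theorem rowEnv_small_zero (I : SqrtSumInstance) : (rowEnv I 0).Small := rowEnv_small (.inl rfl)

theorem rowEnv_small_get (I : SqrtSumInstance) (j : Fin I.d.length) :
    (rowEnv I I.d[j]).Small := rowEnv_small (.inr (List.getElem_mem _))

/-- The vertices of the game of the reduction. -/
def node (I : SqrtSumInstance) (v : Fin (13 + I.d.length * 8)) :
    RatNode 4 (13 + I.d.length * 8) :=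
  match (vertexEquiv _).symm v with
  | .inl h => (hubRow h).toRatNode (rowEnv I 0) none (hubRow_valid (rowEnv_small_zero I) h)
  | .inr (j, c) => (blockRow c).toRatNode (rowEnv I I.d[j]) (some j)
      (blockRow_valid (rowEnv_small_get I j) j c)

theorem node_hub (I : SqrtSumInstance) (h : Fin 13) : node I (hub _ h) =
    (hubRow h).toRatNode (rowEnv I 0) none (hubRow_valid (rowEnv_small_zero I) h) := by
  have : (vertexEquiv I.d.length).symm (hub I.d.length h) = .inl h := by simp [hub]
  unfold node
  rw [this]

theorem node_blk (I : SqrtSumInstance) (j : Fin I.d.length) (c : Fin 8) : node I (blk j c) =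
    (blockRow c).toRatNode (rowEnv I I.d[j]) (some j)
      (blockRow_valid (rowEnv_small_get I j) j c) := by
  have : (vertexEquiv I.d.length).symm (blk j c) = .inr (j, c) := by simp [blk]
  unfold node
  rw [this]

theorem exp_toRatNode {e : RowEnv} {o : Option (Fin e.n)} {r : RowSpec} (h : r.Valid e o)
    {f : Fin 13 → Numer × Denom} {own other : Fin 8 → Numer × Denom}
    (hr : r = .chance f own other) :
    ∃ μ, (r.toRatNode e o h).toNode = .chance μ ∧ ∀ F, μ.exp F =
      ∑ h, prob e (f h) * F (hub e.n h) +
        ∑ j, ∑ c, prob e (if o = some j then own c else other c) * F (blk j c) := by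
  subst hr
  exact ⟨_, rfl, fun F => sum_cell e o f own other F⟩

theorem exp_toRatNode_own {e : RowEnv} {i : Fin e.n} {r : RowSpec} (h : r.Valid e (some i))
    {f : Fin 13 → Numer × Denom} {own : Fin 8 → Numer × Denom}
    (hr : r = .chance f own fun _ => noMove) :
    ∃ μ, (r.toRatNode e (some i) h).toNode = .chance μ ∧ ∀ F, μ.exp F =
      ∑ h, prob e (f h) * F (hub e.n h) + ∑ c, prob e (own c) * F (blk i c) := by
  obtain ⟨μ, h1, h2⟩ := exp_toRatNode h hr
  exact ⟨μ, h1, fun F => by rw [h2, sum_own]⟩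

theorem terminal_hub (I : SqrtSumInstance) {h : Fin 13} (hh : hubRow h = terminalRow h) :
    ∃ μ, (node I (hub _ h)).toNode = .chance μ ∧ ∀ F, μ.exp F = F (hub _ h) := by
  rw [node_hub]
  obtain ⟨μ, h1, h2⟩ := exp_toRatNode (hubRow_valid (rowEnv_small_zero I) h) hh
  refine ⟨μ, h1, fun F => ?_⟩
  rw [h2]
  simp [prob_noMove, prob_lit, apply_ite (prob _)]

theorem hubRow_of_winRow {i : Fin 4} {h : Fin 13} (hw : winRow i h = true) :
    hubRow h = terminalRow h := by
  have : h = 6 ∨ h = 7 ∨ h = 8 ∨ h = 9 ∨ h = 10 := by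
    revert hw
    fin_cases i <;> revert h <;> decide
  rcases this with rfl | rfl | rfl | rfl | rfl <;> rfl

theorem succ_nonempty (I : SqrtSumInstance) (v : Fin (13 + I.d.length * 8)) :
    (node I v).toNode.succ.Nonempty := by
  have h1 : ∀ (r : RowSpec) e o (h : r.Valid e o),
      (∀ i f own, r = .player i f own → ∃ c, f c = true) →
      (r.toRatNode e o h).toNode.succ.Nonempty := by
    intro r e o h hp
    cases r with
    | chance => exact Node.succ_chance_nonempty _
    | player i f own =>
      obtain ⟨c, hc⟩ := hp i f own rfl
      exact ⟨hub _ c, by simpa [RowSpec.toRatNode, RatNode.toNode, Node.succ] using hc⟩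
  induction v using vertex_cases with
  | h1 h =>
    rw [node_hub]
    refine h1 _ _ _ _ fun i f own hr => ?_
    fin_cases h <;> simp only [hubRow, terminalRow, reduceCtorEq] at hr
    obtain ⟨-, rfl, -⟩ := hr
    exact ⟨1, rfl⟩
  | h2 j c =>
    rw [node_blk]
    refine h1 _ _ _ _ fun i f own hr => ?_
    fin_cases c <;> simp only [blockRow, reduceCtorEq, RowSpec.player.injEq] at hr <;>
      obtain ⟨-, rfl, -⟩ := hr
    · exact ⟨11, rfl⟩
    · exact ⟨7, rfl⟩
    · exact ⟨12, rfl⟩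
    · exact ⟨8, rfl⟩

/-- The winning vertices of the game of the reduction. -/
def win {n : ℕ} (i : Fin 4) : Fin (13 + n * 8) → Bool :=
  cell (winRow i) (fun _ => false) (fun _ => false) none

theorem win_terminal (I : SqrtSumInstance) (i : Fin 4) (v : Fin (13 + I.d.length * 8))
    (hv : win i v = true) : (node I v).toNode.succ = {v} := by
  induction v using vertex_cases with
  | h1 h =>
    rw [win, cell_hub] at hv
    obtain ⟨μ, h1, h2⟩ := terminal_hub I (hubRow_of_winRow hv)
    rw [h1]
    ext w
    simp only [Node.succ, Set.mem_ofPred_eq, Set.mem_singleton_iff]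
    constructor
    · exact fun hw => ProbDist.mem_of_exp_indicator_compl (C := {hub _ h}) (by simp [h2]) hw
    · rintro rfl
      have := h2 (({hub _ h} : Set _).indicator 1)
      rw [ProbDist.exp, Finset.sum_eq_single (hub _ h)] at this
      · simp only [Set.mem_singleton_iff, Set.indicator_of_mem, Pi.one_apply, mul_one] at this
        rw [this]
        exact one_pos
      · intro w _ hw
        simp [hw]
      · simp
  | h2 j c => simp [win] at hv

end Reduction

/-- The instance of StatNE that is computed from the instance `I` of the square root sum
problem. -/
def reduction (I : SqrtSumInstance) : StatNEInstance where
  players := 4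
  vertices := 13 + I.d.length * 8
  init := Reduction.hub _ 0
  node := Reduction.node I
  win := Reduction.win
  succ_nonempty := Reduction.succ_nonempty I
  win_terminal := Reduction.win_terminal I
  lower i := if i = 0 then (1, 1) else (0, 1)
  upper _ := (1, 1)
  lower_le_one i := by split_ifs <;> simp [fracVal]
  upper_le_one i := by simp [fracVal]


/-! ### Correctness of the reduction -/

namespace Reduction

open GadgetVertex SSMG

/-- The game of the reduction. -/
noncomputable def game (I : SqrtSumInstance) : SSMG (Fin 4) (Fin (13 + I.d.length * 8)) :=
  (reduction I).game

theorem statNE_reduction_iff (I : SqrtSumInstance) :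
    StatNE (reduction I) ↔ ∃ σ : (game I).Profile, (game I).IsStationaryNash (hub _ 0) σ ∧
      (game I).payoff (hub _ 0) σ 0 = 1 := by
  have hlow : ∀ i : Fin 4, (fracVal ((reduction I).lower i) : ℝ) = if i = 0 then 1 else 0 := by
    intro i
    change ((fracVal (if i = 0 then ((1 : ℕ), (1 : ℕ+)) else (0, 1)) : ℚ) : ℝ) = _
    split_ifs <;> simp [fracVal]
  have hup : ∀ i : Fin 4, (fracVal ((reduction I).upper i) : ℝ) = 1 := by
    intro i
    change ((fracVal ((1 : ℕ), (1 : ℕ+)) : ℚ) : ℝ) = _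
    simp [fracVal]
  constructor
  · rintro ⟨σ, hN, h⟩
    refine ⟨σ, hN, ((game I).payoff_le_one _ _ _).antisymm ?_⟩
    have := (h (0 : Fin 4)).1
    rw [hlow, if_pos rfl] at this
    exact this
  · rintro ⟨σ, hN, h⟩
    refine ⟨σ, hN, fun i => ⟨(hlow i).trans_le ?_, ?_⟩⟩
    · split_ifs with hi
      · rw [hi]; exact h.ge
      · exact (game I).payoff_nonneg _ _ _
    · exact ((game I).payoff_le_one _ _ _).trans (hup i).ge

theorem game_node (I : SqrtSumInstance) (v : Fin (13 + I.d.length * 8)) :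
    (game I).node v = (node I v).toNode := rfl

theorem mem_game_win (I : SqrtSumInstance) (i : Fin 4) (v : Fin (13 + I.d.length * 8)) :
    v ∈ (game I).win i ↔ win i v = true := Iff.rfl

/-- The copy of the gadget in a block. -/
def embed {n : ℕ} (j : Fin n) : GadgetVertex → Fin (13 + n * 8)
  | s => blk j 0
  | a₁ => blk j 1
  | s₁ => blk j 2
  | t => blk j 3
  | a₂ => blk j 4
  | s₂ => blk j 5
  | w₀ => hub n 6
  | w₀₁ => hub n 7
  | w₀₂ => hub n 8
  | w₀₃ => hub n 9
  | out₁ => hub n 11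
  | out₂ => hub n 12

/-- The probability `p` in block `j`. -/
noncomputable def prb (I : SqrtSumInstance) (j : Fin I.d.length) : ℝ :=
  gadgetProb (rowEnv I I.d[j])

theorem node_player_blk (I : SqrtSumInstance) (j : Fin I.d.length) (c : Fin 8) {i : Fin 4}
    {f : Fin 13 → Bool} {own : Fin 8 → Bool} (h : blockRow c = .player i f own)
    {c' : Fin 8} {b : Fin 13} (hf : ∀ x, f x = true ↔ x = b) (ho : ∀ x, own x = true ↔ x = c') :
    (game I).node (blk j c) = .player i {blk j c', hub _ b} := by
  have key : ∀ (r : RowSpec) (hr : r.Valid (rowEnv I I.d[j]) (some j)), r = .player i f own →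
      (r.toRatNode _ _ hr).toNode = .player i {blk j c', hub _ b} := by
    rintro _ hr rfl
    simp only [RowSpec.toRatNode, RatNode.toNode, Node.player.injEq, true_and]
    ext w
    induction w using vertex_cases with
    | h1 x => simp [hf]
    | h2 j' x => simp only [Set.mem_ofPred_eq, cell_blk]; split_ifs with hj <;> aesop
  rw [game_node, node_blk]
  exact key _ _ h

theorem node_chance_blk (I : SqrtSumInstance) (j : Fin I.d.length) (c : Fin 8)
    {f : Fin 13 → Numer × Denom} {own : Fin 8 → Numer × Denom}
    (h : blockRow c = .chance f own fun _ => noMove) :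
    ∃ μ, (game I).node (blk j c) = .chance μ ∧ ∀ F, μ.exp F =
      ∑ h, prob (rowEnv I I.d[j]) (f h) * F (hub _ h) +
        ∑ c, prob (rowEnv I I.d[j]) (own c) * F (blk j c) := by
  rw [game_node, node_blk]
  exact exp_toRatNode_own (e := rowEnv I I.d[j]) (i := j) _ h

theorem node_chance_hub (I : SqrtSumInstance) (h : Fin 13) {f : Fin 13 → Numer × Denom}
    {own other : Fin 8 → Numer × Denom} (hr : hubRow h = .chance f own other) :
    ∃ μ, (game I).node (hub _ h) = .chance μ ∧ ∀ F, μ.exp F =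
      ∑ h, prob (rowEnv I 0) (f h) * F (hub _ h) +
        ∑ j : Fin I.d.length, ∑ c, prob (rowEnv I 0) (other c) * F (blk j c) := by
  rw [game_node, node_hub]
  obtain ⟨μ, h1, h2⟩ := exp_toRatNode (hubRow_valid (rowEnv_small_zero I) h) hr
  exact ⟨μ, h1, fun F => by rw [h2]; simp⟩

theorem node_a₁ (I : SqrtSumInstance) (j : Fin I.d.length) :
    ∃ μ, (game I).node (blk j 1) = .chance μ ∧ ∀ F, μ.exp F =
      prb I j * F (blk j 2) + (1 - prb I j) * F (hub _ 9) := by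
  obtain ⟨μ, h1, h2⟩ := node_chance_blk I j 1 rfl
  refine ⟨μ, h1, fun F => ?_⟩
  rw [h2]
  simp [-Fin.getElem_fin, Fin.sum_univ_succ, prob_noMove, prob_d,
    prob_compD (rowEnv_small_get I j), prb]
  ring

theorem node_a₂ (I : SqrtSumInstance) (j : Fin I.d.length) :
    ∃ μ, (game I).node (blk j 4) = .chance μ ∧ ∀ F, μ.exp F =
      prb I j * F (blk j 5) + (1 - prb I j) * F (hub _ 6) := by
  obtain ⟨μ, h1, h2⟩ := node_chance_blk I j 4 rfl
  refine ⟨μ, h1, fun F => ?_⟩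
  rw [h2]
  simp [-Fin.getElem_fin, Fin.sum_univ_succ, prob_noMove, prob_d,
    prob_compD (rowEnv_small_get I j), prb]
  ring

theorem node_entry (I : SqrtSumInstance) (j : Fin I.d.length) :
    ∃ μ, (game I).node (blk j 6) = .chance μ ∧ ∀ F, μ.exp F =
      prb I j * F (blk j 0) + (1 - prb I j) * F (hub _ 6) := by
  obtain ⟨μ, h1, h2⟩ := node_chance_blk I j 6 rfl
  refine ⟨μ, h1, fun F => ?_⟩
  rw [h2]
  simp [-Fin.getElem_fin, Fin.sum_univ_succ, prob_noMove, prob_d,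
    prob_compD (rowEnv_small_get I j), prb]
  ring

theorem node_threshold_blk (I : SqrtSumInstance) (j : Fin I.d.length) :
    ∃ μ, (game I).node (blk j 7) = .chance μ ∧ ∀ F, μ.exp F =
      prb I j * F (hub _ 5) + (1 - prb I j) * F (hub _ 10) := by
  obtain ⟨μ, h1, h2⟩ := node_chance_blk I j 7 rfl
  refine ⟨μ, h1, fun F => ?_⟩
  rw [h2]
  simp [-Fin.getElem_fin, Fin.sum_univ_succ, prob_noMove, prob_d,
    prob_compD (rowEnv_small_get I j), prb]

theorem node_out₁ (I : SqrtSumInstance) :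
    ∃ μ, (game I).node (hub _ 11) = .chance μ ∧ ∀ F, μ.exp F =
      1 / 2 * F (hub _ 7) + (1 - 1 / 2) * F (hub _ 6) := by
  obtain ⟨μ, h1, h2⟩ := node_chance_hub I 11 rfl
  refine ⟨μ, h1, fun F => ?_⟩
  rw [h2]
  simp [Fin.sum_univ_succ, prob_noMove, prob_lit]
  ring

theorem node_out₂ (I : SqrtSumInstance) :
    ∃ μ, (game I).node (hub _ 12) = .chance μ ∧ ∀ F, μ.exp F =
      1 / 2 * F (hub _ 8) + (1 - 1 / 2) * F (hub _ 6) := by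
  obtain ⟨μ, h1, h2⟩ := node_chance_hub I 12 rfl
  refine ⟨μ, h1, fun F => ?_⟩
  rw [h2]
  simp [Fin.sum_univ_succ, prob_noMove, prob_lit]
  ring

theorem node_game (I : SqrtSumInstance) :
    ∃ μ, (game I).node (hub _ 1) = .chance μ ∧ ∀ F, μ.exp F =
      1 / (I.d.length + 1) * F (hub _ 6) +
        ∑ j : Fin I.d.length, 1 / (2 * (I.d.length + 1)) * (F (blk j 0) + F (blk j 6)) := by
  obtain ⟨μ, h1, h2⟩ := node_chance_hub I 1 rfl
  refine ⟨μ, h1, fun F => ?_⟩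
  rw [h2]
  simp [Fin.sum_univ_succ, prob_noMove, prob_copies, prob_twoCopies, mul_add]

theorem node_threshold (I : SqrtSumInstance) :
    ∃ μ, (game I).node (hub _ 2) = .chance μ ∧ ∀ F, μ.exp F =
      1 / 4 * F (hub _ 3) + 3 / 4 * F (hub _ 5) := by
  obtain ⟨μ, h1, h2⟩ := node_chance_hub I 2 rfl
  refine ⟨μ, h1, fun F => ?_⟩
  rw [h2]
  simp [Fin.sum_univ_succ, prob_noMove, prob_lit]

theorem node_threshold_sum (I : SqrtSumInstance) :
    ∃ μ, (game I).node (hub _ 3) = .chance μ ∧ ∀ F, μ.exp F =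
      1 / (I.d.length + 1) * F (hub _ 4) +
        ∑ j : Fin I.d.length, 1 / (I.d.length + 1) * F (blk j 7) := by
  obtain ⟨μ, h1, h2⟩ := node_chance_hub I 3 rfl
  refine ⟨μ, h1, fun F => ?_⟩
  rw [h2]
  simp [Fin.sum_univ_succ, prob_noMove, prob_copies]

theorem node_threshold_k (I : SqrtSumInstance) :
    ∃ μ, (game I).node (hub _ 4) = .chance μ ∧ ∀ F, μ.exp F =
      (1 - I.k / 2 ^ (rowEnv I 0).m) * F (hub _ 5) +
        I.k / 2 ^ (rowEnv I 0).m * F (hub _ 10) := by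
  obtain ⟨μ, h1, h2⟩ := node_chance_hub I 4 rfl
  refine ⟨μ, h1, fun F => ?_⟩
  rw [h2]
  simp [Fin.sum_univ_succ, prob_noMove, prob_k, prob_compK (rowEnv_small_zero I)]

theorem node_init (I : SqrtSumInstance) :
    (game I).node (hub _ 0) = .player 3 {hub _ 1, hub _ 2} := by
  rw [game_node, node_hub]
  refine congrArg (Node.player 3) (Set.ext fun w => ?_)
  induction w using vertex_cases with
  | h1 x =>
    simp only [Set.mem_ofPred_eq, cell_hub, Set.mem_insert_iff, Set.mem_singleton_iff, hub_inj]
    revert x; decide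
  | h2 j' x => simp

theorem node_s (I : SqrtSumInstance) (j : Fin I.d.length) :
    (game I).node (blk j 0) = .player 1 {blk j 1, hub _ 11} :=
  node_player_blk I j 0 rfl (by decide) (by decide)

theorem node_s₁ (I : SqrtSumInstance) (j : Fin I.d.length) :
    (game I).node (blk j 2) = .player 0 {blk j 3, hub _ 7} :=
  node_player_blk I j 2 rfl (by decide) (by decide)

theorem node_t (I : SqrtSumInstance) (j : Fin I.d.length) :
    (game I).node (blk j 3) = .player 2 {blk j 4, hub _ 12} :=
  node_player_blk I j 3 rfl (by decide) (by decide)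

theorem node_s₂ (I : SqrtSumInstance) (j : Fin I.d.length) :
    (game I).node (blk j 5) = .player 0 {blk j 0, hub _ 8} :=
  node_player_blk I j 5 rfl (by decide) (by decide)

theorem isGadget (I : SqrtSumInstance) (j : Fin I.d.length) :
    IsGadget (game I) (prb I j) (embed j) where
  inj := by
    intro u v h
    cases u <;> cases v <;> first | rfl | (exfalso; revert h; simp [embed])
  node_s := node_s I j
  node_s₁ := node_s₁ I j
  node_t := node_t I j
  node_s₂ := node_s₂ I j
  node_a₁ := node_a₁ I j
  node_a₂ := node_a₂ I j
  node_out₁ := node_out₁ I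
  node_out₂ := node_out₂ I
  terminal v hv := by
    rcases hv with rfl | rfl | rfl | rfl
    · exact terminal_hub I (h := 6) rfl
    · exact terminal_hub I (h := 7) rfl
    · exact terminal_hub I (h := 8) rfl
    · exact terminal_hub I (h := 9) rfl
  win_iff i v := by
    rw [mem_game_win]
    fin_cases i <;> cases v <;> simp [embed, win, winRow, gadgetWin]

theorem prb_mem (I : SqrtSumInstance) (j : Fin I.d.length) : 1 / 2 ≤ prb I j ∧ prb I j ≤ 1 := by
  have h := (rowEnv_small_get I j).d_le
  have h' : (2 * I.d[j] : ℝ) ≤ 2 ^ (2 * (rowEnv I 0).m + 1) := by exact_mod_cast h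
  constructor
  · unfold prb gadgetProb
    have : (I.d[j] : ℝ) / 2 ^ (2 * (rowEnv I 0).m + 1) ≤ 1 / 2 := by
      rw [div_le_div_iff₀ (by positivity) (by norm_num)]
      linarith
    linarith
  · unfold prb gadgetProb
    have : (0 : ℝ) ≤ (I.d[j] : ℝ) / 2 ^ (2 * (rowEnv I 0).m + 1) := by positivity
    linarith

/-- The choice of the probability `p` makes the square root of `d` appear, scaled by the same
factor in every block. -/
theorem one_add_prb_mul_gadgetOpt (I : SqrtSumInstance) (j : Fin I.d.length) :
    (1 + prb I j) * gadgetOpt (prb I j) =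
      1 / 2 * (√(I.d[j]) / 2 ^ (rowEnv I 0).m + (1 - prb I j)) := by
  have hr : √(2 - 2 * prb I j) = √(I.d[j]) / 2 ^ (rowEnv I 0).m := by
    rw [← Real.sqrt_sq (show (0 : ℝ) ≤ 2 ^ (rowEnv I 0).m by positivity),
      ← Real.sqrt_div (by positivity)]
    congr 1
    unfold prb gadgetProb
    rw [pow_succ, mul_comm 2 (rowEnv I 0).m, pow_mul]
    field_simp
    ring
  have := (prb_mem I j).1
  rw [gadgetOpt, hr]
  field_simp
  ring

/-! #### Payoffs under a stationary profile -/

section Payoffs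

variable {I : SqrtSumInstance} {σ : (game I).Profile} (hσ : (game I).StatProfile σ)
include hσ

theorem payoff_terminal {h : Fin 13} (hh : hubRow h = terminalRow h) (i : Fin 4) :
    (game I).payoff (hub _ h) σ i = if winRow i h then 1 else 0 := by
  obtain ⟨μ, h1, h2⟩ := terminal_hub I hh
  rw [hσ.payoff_of_terminal]
  · have : hub _ h ∈ (game I).win i ↔ winRow i h = true := by
      rw [mem_game_win, win, cell_hub]
    by_cases hw : winRow i h = true
    · rw [winInd, Set.indicator_of_mem (this.2 hw), if_pos hw, Pi.one_apply]
    · rw [winInd, Set.indicator_of_notMem (mt this.1 hw), if_neg hw]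
  · intro w hw
    rw [IsGadget.next_of_chance h1] at hw
    exact ProbDist.mem_of_exp_indicator_compl (C := {hub _ h}) (by simp [h2]) hw

theorem payoff_game (i : Fin 4) :
    (game I).payoff (hub _ 1) σ i = 1 / (I.d.length + 1) * (if winRow i 6 then 1 else 0) +
      ∑ j : Fin I.d.length, 1 / (2 * (I.d.length + 1)) *
        ((1 + prb I j) * (game I).payoff (blk j 0) σ i +
          (1 - prb I j) * (if winRow i 6 then 1 else 0)) := by
  obtain ⟨μ, h1, h2⟩ := node_game I
  rw [hσ.payoff_eq_of_chance h1, h2, payoff_terminal hσ rfl]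
  congr 1
  refine Finset.sum_congr rfl fun j _ => ?_
  obtain ⟨μ', h1', h2'⟩ := node_entry I j
  rw [hσ.payoff_eq_of_chance h1' i, h2', payoff_terminal hσ rfl]
  ring

theorem payoff_threshold_zero : (game I).payoff (hub _ 2) σ 0 = 0 := by
  refine hσ.payoff_eq_zero
    {v | (∃ j, v = blk j 7) ∨ v ∈ ({hub _ 2, hub _ 3, hub _ 4, hub _ 5, hub _ 10} : Set _)}
    ?_ 0 ?_ _ (by simp)
  · rintro v hv w hw
    have aux : ∀ {v w : Fin (13 + I.d.length * 8)} {C : Set _},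
        (∃ μ, (game I).node v = .chance μ ∧ μ.exp (Cᶜ.indicator 1) = 0) →
        0 < ((game I).next σ [] v).1 w → w ∈ C := by
      rintro v w C ⟨μ, h1, h2⟩ hw
      rw [IsGadget.next_of_chance h1] at hw
      exact ProbDist.mem_of_exp_indicator_compl h2 hw
    refine aux ?_ hw
    rcases hv with ⟨j, rfl⟩ | rfl | rfl | rfl | rfl | rfl
    · obtain ⟨μ, h1, h2⟩ := node_threshold_blk I j
      exact ⟨μ, h1, by rw [h2]; simp⟩
    · obtain ⟨μ, h1, h2⟩ := node_threshold I
      exact ⟨μ, h1, by rw [h2]; simp⟩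
    · obtain ⟨μ, h1, h2⟩ := node_threshold_sum I
      exact ⟨μ, h1, by rw [h2]; simp⟩
    · obtain ⟨μ, h1, h2⟩ := node_threshold_k I
      exact ⟨μ, h1, by rw [h2]; simp⟩
    · obtain ⟨μ, h1, h2⟩ := terminal_hub I (h := 5) rfl
      exact ⟨μ, h1, by rw [h2]; simp⟩
    · obtain ⟨μ, h1, h2⟩ := terminal_hub I (h := 10) rfl
      exact ⟨μ, h1, by rw [h2]; simp⟩
  · rintro v (⟨j, rfl⟩ | rfl | rfl | rfl | rfl | rfl) <;> simp [mem_game_win, win, winRow]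

theorem payoff_threshold_three : (game I).payoff (hub _ 2) σ 3 =
    1 / (4 * (I.d.length + 1)) *
      (I.k / 2 ^ (rowEnv I 0).m + ∑ j : Fin I.d.length, (1 - prb I j)) := by
  obtain ⟨μ, h1, h2⟩ := node_threshold I
  obtain ⟨μ', h1', h2'⟩ := node_threshold_sum I
  obtain ⟨μ'', h1'', h2''⟩ := node_threshold_k I
  have hb : ∀ j : Fin I.d.length, (game I).payoff (blk j 7) σ 3 = 1 - prb I j := by
    intro j
    obtain ⟨ν, h3, h4⟩ := node_threshold_blk I j
    rw [hσ.payoff_eq_of_chance h3, h4, payoff_terminal hσ rfl, payoff_terminal hσ rfl]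
    simp [winRow]
  rw [hσ.payoff_eq_of_chance h1, h2, hσ.payoff_eq_of_chance h1', h2',
    hσ.payoff_eq_of_chance h1'', h2'', payoff_terminal hσ rfl, payoff_terminal hσ rfl]
  simp only [hb, winRow, ← Finset.mul_sum, Bool.false_eq_true, if_false, if_true]
  field_simp
  ring

end Payoffs

/-- What player 3 gains by preferring the game to the threshold, if every gadget has its optimal
payoff. -/
theorem opt_sub_threshold (I : SqrtSumInstance) :
    (∑ j : Fin I.d.length, 1 / (2 * (I.d.length + 1)) *
        ((1 + prb I j) * gadgetOpt (prb I j))) -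
      1 / (4 * (I.d.length + 1)) *
        (I.k / 2 ^ (rowEnv I 0).m + ∑ j : Fin I.d.length, (1 - prb I j)) =
    1 / (4 * (I.d.length + 1) * 2 ^ (rowEnv I 0).m) *
      ((I.d.map fun m => √(m : ℝ)).sum - I.k) := by
  have h : (I.d.map fun m => √(m : ℝ)).sum = ∑ j : Fin I.d.length, √(I.d[j] : ℝ) := by
    rw [← List.sum_ofFn]
    congr 1
    refine Eq.trans ?_ (List.ofFn_getElem_eq_map I.d fun m : ℕ => √(m : ℝ)).symm
    simp [List.bind_eq_flatMap, ← List.map_eq_flatMap]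
  simp only [one_add_prb_mul_gadgetOpt, ← Finset.mul_sum, Finset.sum_add_distrib,
    ← Finset.sum_div, h]
  field_simp
  ring

/-! #### From the sum of square roots to an equilibrium -/

/-- The choices in the equilibrium: player 3 enters the game, and every gadget is played
optimally. -/
noncomputable def choice (I : SqrtSumInstance) (v : Fin (13 + I.d.length * 8)) :
    ProbDist (Fin (13 + I.d.length * 8)) :=
  match (vertexEquiv _).symm v with
  | .inl _ => .point (hub _ 1)
  | .inr (j, 0) => .point (blk j 1)
  | .inr (j, 2) => .mix ⟨loopProb (prb I j), loopProb_mem (prb_mem I j).1⟩ (blk j 3) (hub _ 7)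
  | .inr (j, 3) => .point (blk j 4)
  | .inr (j, _) => .mix ⟨loopProb (prb I j), loopProb_mem (prb_mem I j).1⟩ (blk j 0) (hub _ 8)

theorem choice_hub (I : SqrtSumInstance) (h : Fin 13) :
    choice I (hub _ h) = .point (hub _ 1) := by
  have : (vertexEquiv I.d.length).symm (hub I.d.length h) = .inl h := by simp [hub]
  unfold choice
  rw [this]

theorem vertexEquiv_symm_blk {n : ℕ} (j : Fin n) (c : Fin 8) :
    (vertexEquiv n).symm (blk j c) = .inr (j, c) := by simp [blk]

/-- The vertices that are controlled by a player. -/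
theorem player_cases {I : SqrtSumInstance} {v : Fin (13 + I.d.length * 8)} {i : Fin 4}
    {S : Set (Fin (13 + I.d.length * 8))} (hv : (game I).node v = .player i S) :
    (v = hub _ 0 ∧ i = 3 ∧ S = {hub _ 1, hub _ 2}) ∨ ∃ j,
      (v = blk j 0 ∧ i = 1 ∧ S = {blk j 1, hub _ 11}) ∨
      (v = blk j 2 ∧ i = 0 ∧ S = {blk j 3, hub _ 7}) ∨
      (v = blk j 3 ∧ i = 2 ∧ S = {blk j 4, hub _ 12}) ∨
      (v = blk j 5 ∧ i = 0 ∧ S = {blk j 0, hub _ 8}) := by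
  induction v using vertex_cases with
  | h1 h =>
    left
    by_cases h0 : h = 0
    · subst h0
      rw [node_init] at hv
      simp only [Node.player.injEq] at hv
      exact ⟨rfl, hv.1.symm, hv.2.symm⟩
    · exfalso
      have : ∃ f own other, hubRow h = .chance f own other := by
        fin_cases h
        · exact absurd rfl h0
        all_goals exact ⟨_, _, _, rfl⟩
      obtain ⟨f, own, other, hr⟩ := this
      obtain ⟨μ, h1, -⟩ := node_chance_hub I h hr
      rw [h1] at hv
      cases hv
  | h2 j c =>
    right
    refine ⟨j, ?_⟩
    have aux : (∃ μ, (game I).node (blk j c) = .chance μ) → False := by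
      rintro ⟨μ, h1⟩
      rw [h1] at hv
      cases hv
    fin_cases c
    · obtain ⟨h1, h2⟩ := Node.player.inj ((node_s I j).symm.trans hv)
      exact .inl ⟨rfl, h1.symm, h2.symm⟩
    · exact (aux ((node_a₁ I j).imp fun _ h => h.1)).elim
    · obtain ⟨h1, h2⟩ := Node.player.inj ((node_s₁ I j).symm.trans hv)
      exact .inr (.inl ⟨rfl, h1.symm, h2.symm⟩)
    · obtain ⟨h1, h2⟩ := Node.player.inj ((node_t I j).symm.trans hv)
      exact .inr (.inr (.inl ⟨rfl, h1.symm, h2.symm⟩))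
    · exact (aux ((node_a₂ I j).imp fun _ h => h.1)).elim
    · obtain ⟨h1, h2⟩ := Node.player.inj ((node_s₂ I j).symm.trans hv)
      exact .inr (.inr (.inr ⟨rfl, h1.symm, h2.symm⟩))
    · exact (aux ((node_entry I j).imp fun _ h => h.1)).elim
    · exact (aux ((node_threshold_blk I j).imp fun _ h => h.1)).elim

theorem choice_legal (I : SqrtSumInstance) (i : Fin 4) (v : Fin (13 + I.d.length * 8))
    (S : Set (Fin (13 + I.d.length * 8))) (hv : (game I).node v = .player i S)
    (w : Fin (13 + I.d.length * 8)) (hw : 0 < (choice I v).1 w) : w ∈ S := by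
  rcases player_cases hv with ⟨rfl, -, rfl⟩ | ⟨j, ⟨rfl, -, rfl⟩ | ⟨rfl, -, rfl⟩ | ⟨rfl, -, rfl⟩ |
    ⟨rfl, -, rfl⟩⟩
  · rw [choice_hub] at hw
    exact .inl (ProbDist.eq_of_point_pos hw)
  all_goals
    simp only [choice, vertexEquiv_symm_blk] at hw
  · exact .inl (ProbDist.eq_of_point_pos hw)
  · exact ProbDist.mem_of_mix_pos hw
  · exact .inl (ProbDist.eq_of_point_pos hw)
  · exact ProbDist.mem_of_mix_pos hw

theorem exists_equilibrium (I : SqrtSumInstance) (hI : SqrtSum I) :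
    ∃ σ : (game I).Profile, (game I).IsStationaryNash (hub _ 0) σ ∧
      (game I).payoff (hub _ 0) σ 0 = 1 := by
  let σ : (game I).Profile := (game I).profileOf (choice I) (choice_legal I)
  have hσ : (game I).StatProfile σ := statProfile_profileOf _ _ _
  have hnext : ∀ v i S, (game I).node v = .player i S → (game I).next σ [] v = choice I v :=
    fun v i S hv => IsGadget.next_of_player hv
  have hplay : ∀ j, IsGadgetPlay (game I) σ (embed j) 1 1
      (loopProb (prb I j)) (loopProb (prb I j)) := by
    intro j
    constructor <;> intro f <;> simp only [embed]
    · rw [hnext _ _ _ (node_s I j)]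
      simp only [choice, vertexEquiv_symm_blk]
      rw [ProbDist.exp_point]; ring
    · rw [hnext _ _ _ (node_t I j)]
      simp only [choice, vertexEquiv_symm_blk]
      rw [ProbDist.exp_point]; ring
    · rw [hnext _ _ _ (node_s₁ I j)]
      simp only [choice, vertexEquiv_symm_blk]
      rw [ProbDist.exp_mix]
    · rw [hnext _ _ _ (node_s₂ I j)]
      simp only [choice, vertexEquiv_symm_blk]
      rw [ProbDist.exp_mix]
  have hval := fun j => (isGadget I j).payoff_of_loopProb (prb_mem I j).1 (prb_mem I j).2 hσ
    (hplay j)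
  have hinit : ∀ i, (game I).payoff (hub _ 0) σ i = (game I).payoff (hub _ 1) σ i := by
    intro i
    rw [hσ.payoff_eq_exp, hnext _ _ _ (node_init I), choice_hub, ProbDist.exp_point]
  have h0 : (game I).payoff (hub _ 0) σ 0 = 1 := by
    rw [hinit, payoff_game hσ]
    have : ∀ j : Fin I.d.length, (game I).payoff (blk j 0) σ 0 = 1 := fun j => (hval j).1
    simp only [this, winRow]
    norm_num
    field_simp
    ring
  refine ⟨σ, ⟨hσ, fun i τ => ?_⟩, h0⟩
  -- Player 0 wins almost surely; for the other players it suffices to compare single moves.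
  by_cases hi : i = 0
  · subst hi
    exact ((game I).payoff_le_one _ _ _).trans h0.ge
  refine hσ.payoff_update_le _ i (fun v S hv w hw => ?_) τ
  rcases player_cases hv with ⟨rfl, rfl, rfl⟩ | ⟨j, ⟨rfl, rfl, rfl⟩ | ⟨rfl, rfl, rfl⟩ |
    ⟨rfl, rfl, rfl⟩ | ⟨rfl, rfl, rfl⟩⟩
  · rw [hinit]
    rcases hw with rfl | rfl
    · exact le_rfl
    · have : ∀ j : Fin I.d.length, (game I).payoff (blk j 0) σ 3 = gadgetOpt (prb I j) :=
        fun j => (hval j).2.2.2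
      rw [payoff_threshold_three hσ, payoff_game hσ]
      simp only [this, winRow, Bool.false_eq_true, if_false, mul_zero, zero_add, add_zero]
      rw [← sub_nonneg, opt_sub_threshold]
      exact mul_nonneg (by positivity) (sub_nonneg.2 hI)
  · rcases hw with rfl | rfl
    · have := IsGadget.payoff_s hσ (hplay j) 1
      rw [one_mul, sub_self, zero_mul, add_zero] at this
      exact this.ge
    · exact ((isGadget I j).payoff_out₁_one hσ).trans_le (hval j).2.1
  · exact absurd rfl hi
  · rcases hw with rfl | rfl
    · have := IsGadget.payoff_t hσ (hplay j) 2
      rw [one_mul, sub_self, zero_mul, add_zero] at this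
      exact this.ge
    · exact ((isGadget I j).payoff_out₂_two hσ).trans_le (hval j).2.2.1
  · exact absurd rfl hi

/-! #### From an equilibrium to the sum of square roots -/

/-- A deviation inside one block does not change the payoffs in the other blocks. -/
theorem payoff_deviate_of_ne {I : SqrtSumInstance} {σ : (game I).Profile}
    (hσ : (game I).StatProfile σ) (i : Fin 4) {j j' : Fin I.d.length} (hj : j' ≠ j) (c : Fin 8)
    (w : Fin (13 + I.d.length * 8)) (hw : ∀ S, (game I).node (blk j c) = .player i S → w ∈ S) :
    (game I).payoff (blk j' 0) (Function.update σ i ((σ i).deviate (blk j c) w hw)) i =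
      (game I).payoff (blk j' 0) σ i := by
  refine hσ.payoff_congr (hσ.deviate i _ w hw) (Set.range (embed j')) ((isGadget I j').closed σ)
    (fun v hv => StatProfile.next_deviate_of_ne i _ w hw ?_) i _ ⟨s, rfl⟩
  rintro rfl
  obtain ⟨v, hv⟩ := hv
  cases v <;> simp [embed, hj] at hv

/-- In an equilibrium in which player 3 enters the game, a deviation in block `j` does not
increase the payoff from this block. -/
theorem payoff_block_deviate_le {I : SqrtSumInstance} {σ : (game I).Profile}
    (hN : (game I).IsStationaryNash (hub _ 0) σ)
    (hgame : (game I).next σ [] (hub _ 0) = .point (hub _ 1)) (i : Fin 4)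
    (j : Fin I.d.length) (c : Fin 8) (w : Fin (13 + I.d.length * 8))
    (hw : ∀ S, (game I).node (blk j c) = .player i S → w ∈ S) :
    (game I).payoff (blk j 0) (Function.update σ i ((σ i).deviate (blk j c) w hw)) i ≤
      (game I).payoff (blk j 0) σ i := by
  obtain ⟨hσ, hN⟩ := hN
  replace hσ : (game I).StatProfile σ := hσ
  have hσ' := hσ.deviate i _ w hw
  have h := hN i ((σ i).deviate (blk j c) w hw)
  have hgame' : (game I).next (Function.update σ i ((σ i).deviate (blk j c) w hw)) [] (hub _ 0) =
      .point (hub _ 1) := by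
    rw [StatProfile.next_deviate_of_ne i _ w hw (by simp), hgame]
  rw [hσ.payoff_eq_exp (hub _ 0), hgame, hσ'.payoff_eq_exp (hub _ 0), hgame',
    ProbDist.exp_point, ProbDist.exp_point, payoff_game hσ, payoff_game hσ', add_le_add_iff_left,
    ← Finset.add_sum_erase _ _ (Finset.mem_univ j), ← Finset.add_sum_erase _ _ (Finset.mem_univ j),
    Finset.sum_congr rfl fun j' hj' => by
      rw [payoff_deviate_of_ne hσ i (Finset.ne_of_mem_erase hj') c w hw], add_le_add_iff_right]
    at h
  have hp := (prb_mem I j).1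
  have h2 := le_of_mul_le_mul_left h (by positivity)
  rw [add_le_add_iff_right] at h2
  exact le_of_mul_le_mul_left h2 (by linarith)

theorem sqrtSum_of_equilibrium (I : SqrtSumInstance) (σ : (game I).Profile)
    (hN : (game I).IsStationaryNash (hub _ 0) σ) (h0 : (game I).payoff (hub _ 0) σ 0 = 1) :
    SqrtSum I := by
  have hσ : (game I).StatProfile σ := hN.1
  have hinit : ∀ f, ((game I).next σ [] (hub _ 0)).exp f =
      ((game I).next σ [] (hub _ 0)).1 (hub _ 1) * f (hub _ 1) +
        (1 - ((game I).next σ [] (hub _ 0)).1 (hub _ 1)) * f (hub _ 2) := by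
    rw [IsGadget.next_of_player (node_init I)]
    exact ProbDist.exp_of_support_subset_pair (by simp) ((σ 3).legal [] _ _ (node_init I))
  -- Player 0 cannot win by way of the threshold.
  have hgame : ((game I).next σ [] (hub _ 0)).1 (hub _ 1) = 1 := by
    rw [hσ.payoff_eq_exp, hinit, payoff_threshold_zero hσ, mul_zero, add_zero] at h0
    have h1 := ProbDist.le_one ((game I).next σ [] (hub _ 0)) (hub _ 1)
    have h2 := mul_le_of_le_one_right (((game I).next σ [] (hub _ 0)).2.1 (hub _ 1))
      ((game I).payoff_le_one (hub _ 1) σ 0)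
    linarith
  have hpoint : (game I).next σ [] (hub _ 0) = .point (hub _ 1) := by
    refine Subtype.ext (funext fun v => ?_)
    have := hinit (Pi.single v 1)
    rw [hgame] at this
    simp only [ProbDist.exp, Pi.single_apply, mul_ite, mul_one, mul_zero, Finset.sum_ite_eq',
      Finset.mem_univ, if_true, sub_self] at this
    rw [this]
    simp [ProbDist.point, Pi.single_apply, eq_comm]
  have hopt : ∀ j : Fin I.d.length, (game I).payoff (blk j 0) σ 3 ≤ gadgetOpt (prb I j) := by
    intro j
    have hg := isGadget I j
    obtain ⟨hp, hp1⟩ := prb_mem I j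
    rcases hp1.eq_or_lt with h1 | h1
    · rw [h1] at hg ⊢
      exact (hg.payoff_three_eq_zero hσ).trans_le (by norm_num [gadgetOpt])
    have hw₁ : ∀ S, (game I).node (blk j 0) = .player 1 S → hub _ 11 ∈ S := by
      intro S hS
      obtain ⟨-, rfl⟩ := Node.player.inj ((node_s I j).symm.trans hS)
      simp
    have hw₂ : ∀ S, (game I).node (blk j 3) = .player 2 S → hub _ 12 ∈ S := by
      intro S hS
      obtain ⟨-, rfl⟩ := Node.player.inj ((node_t I j).symm.trans hS)
      simp
    refine hg.payoff_three_le hp h1 hσ ?_ fun hx hα => ?_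
    · have h := payoff_block_deviate_le hN hpoint 1 j 0 _ hw₁
      rw [hσ.payoff_deviate_self 1 _ _ hw₁ (node_s I j)] at h
      exact (hg.payoff_out₁_one (hσ.deviate 1 _ _ hw₁)).symm.trans_le h
    · have h := payoff_block_deviate_le hN hpoint 2 j 3 _ hw₂
      have hσ' := hσ.deviate 2 _ _ hw₂
      have e : (game I).payoff (blk j 0) σ 2 = _ := hg.payoff_s_two hσ (hg.isGadgetPlay σ)
      have e' : (game I).payoff (blk j 0) _ 2 = _ := hg.payoff_s_two hσ' (hg.isGadgetPlay _)
      have ht : (game I).payoff (embed j t) _ 2 = 1 / 2 :=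
        (hσ.payoff_deviate_self 2 _ _ hw₂ (node_t I j) 2).trans (hg.payoff_out₂_two hσ')
      have n1 := StatProfile.next_deviate_of_ne (σ := σ) 2 _ _ hw₂ (u := embed j s)
        (by simp [embed])
      have n2 := StatProfile.next_deviate_of_ne (σ := σ) 2 _ _ hw₂ (u := embed j s₁)
        (by simp [embed])
      rw [n1, n2, ht] at e'
      rw [e, e'] at h
      have hpos := mul_pos hx (mul_pos (show 0 < prb I j by linarith) hα)
      refine le_of_mul_le_mul_left ?_ hpos
      linarith
  -- Player 3 does not gain by choosing the threshold.
  have hw : ∀ S, (game I).node (hub _ 0) = .player 3 S → hub _ 2 ∈ S := by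
    intro S hS
    obtain ⟨-, rfl⟩ := Node.player.inj ((node_init I).symm.trans hS)
    simp
  have h := hN.2 3 ((σ 3).deviate (hub _ 0) (hub _ 2) hw)
  rw [hσ.payoff_deviate_self 3 _ _ hw (node_init I),
    payoff_threshold_three (hσ.deviate 3 _ _ hw), hσ.payoff_eq_exp (hub _ 0), hpoint,
    ProbDist.exp_point, payoff_game hσ] at h
  simp only [winRow, Bool.false_eq_true, if_false, mul_zero, zero_add, add_zero] at h
  have h2 : ∑ j : Fin I.d.length, 1 / (2 * (I.d.length + 1) : ℝ) *
      ((1 + prb I j) * (game I).payoff (blk j 0) σ 3) ≤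
      ∑ j : Fin I.d.length, 1 / (2 * (I.d.length + 1) : ℝ) *
        ((1 + prb I j) * gadgetOpt (prb I j)) := by
    refine Finset.sum_le_sum fun j _ => mul_le_mul_of_nonneg_left
      (mul_le_mul_of_nonneg_left (hopt j) ?_) (by positivity)
    linarith [(prb_mem I j).1]
  have h3 := sub_nonneg.2 (h.trans h2)
  rw [opt_sub_threshold] at h3
  exact sub_nonneg.1 (nonneg_of_mul_nonneg_right h3 (by positivity))

theorem sqrtSum_iff_statNE (I : SqrtSumInstance) : SqrtSum I ↔ StatNE (reduction I) := by
  rw [statNE_reduction_iff]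
  exact ⟨exists_equilibrium I, fun ⟨σ, hN, h0⟩ => sqrtSum_of_equilibrium I σ hN h0⟩

end Reduction


/-! ### A structured programming language for stack machines -/

/-- Programs for a machine with stacks indexed by `K`, symbols `Γ` and a finite control register
`σ`. `loop k f p P` repeats the following: pop a symbol from the stack `k`, update the register by
`f`, and leave the loop if the register fails the test `p`; otherwise run `P`. -/
inductive Prog (K Γ σ : Type) where
  | push (k : K) (f : σ → Γ)
  | pop (k : K) (f : σ → Option Γ → σ)
  | load (f : σ → σ)
  | seq (P Q : Prog K Γ σ)
  | ite (p : σ → Bool) (P Q : Prog K Γ σ)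
  | loop (k : K) (f : σ → Option Γ → σ) (p : σ → Bool) (P : Prog K Γ σ)

namespace Prog

open Turing StateTransition

variable {K Γ σ : Type} [DecidableEq K]

/-- `Exec P v S t v' S'`: started with register `v` and stacks `S`, the program `P` stops after
`t` steps with register `v'` and stacks `S'`. -/
inductive Exec : Prog K Γ σ → σ → (K → List Γ) → ℕ → σ → (K → List Γ) → Prop
  | push (k f v S) : Exec (.push k f) v S 1 v (Function.update S k (f v :: S k))
  | pop (k f v S) : Exec (.pop k f) v S 1 (f v (S k).head?) (Function.update S k (S k).tail)
  | load (f v S) : Exec (.load f) v S 1 (f v) S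
  | seq {P Q v S t v' S' t' v'' S''} : Exec P v S t v' S' → Exec Q v' S' t' v'' S'' →
      Exec (.seq P Q) v S (t + t') v'' S''
  | ite_true {p P Q v S t v' S'} : p v = true → Exec P v S t v' S' →
      Exec (.ite p P Q) v S (1 + t) v' S'
  | ite_false {p P Q v S t v' S'} : p v = false → Exec Q v S t v' S' →
      Exec (.ite p P Q) v S (1 + t) v' S'
  | loop_done {k f p P v S} : p (f v (S k).head?) = false →
      Exec (.loop k f p P) v S 1 (f v (S k).head?) (Function.update S k (S k).tail)
  | loop_step {k f p P v S t v' S' t' v'' S''} : p (f v (S k).head?) = true →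
      Exec P (f v (S k).head?) (Function.update S k (S k).tail) t v' S' →
      Exec (.loop k f p P) v' S' t' v'' S'' → Exec (.loop k f p P) v S (1 + t + t') v'' S''

/-- The positions in a program at which the control can be. -/
def Lab : Prog K Γ σ → Type
  | push _ _ | pop _ _ | load _ => Unit
  | seq P Q => P.Lab ⊕ Q.Lab
  | ite _ P Q => Option (P.Lab ⊕ Q.Lab)
  | loop _ _ _ P => Option P.Lab

instance Lab.fintype : (P : Prog K Γ σ) → Fintype P.Lab
  | push _ _ | pop _ _ | load _ => inferInstanceAs (Fintype Unit)
  | seq P Q =>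
    letI := Lab.fintype P
    letI := Lab.fintype Q
    inferInstanceAs (Fintype (P.Lab ⊕ Q.Lab))
  | ite _ P Q =>
    letI := Lab.fintype P
    letI := Lab.fintype Q
    inferInstanceAs (Fintype (Option (P.Lab ⊕ Q.Lab)))
  | loop _ _ _ P =>
    letI := Lab.fintype P
    inferInstanceAs (Fintype (Option P.Lab))

/-- The position at which a program starts. -/
def entry : (P : Prog K Γ σ) → P.Lab
  | push _ _ | pop _ _ | load _ => ()
  | seq P _ => .inl P.entry
  | ite _ _ _ | loop _ _ _ _ => none

/-- Continue at a label, or halt. -/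
def exitStmt {Λ : Type} : Option Λ → TM2.Stmt (fun _ : K => Γ) Λ σ
  | some l => .goto fun _ => l
  | none => .halt

/-- The statements of a stack machine whose labels contain the positions of `P`, by way of `emb`,
and that continues at `ex` after `P`. -/
def code {Λ : Type} : (P : Prog K Γ σ) → (P.Lab → Λ) → Option Λ → P.Lab →
    TM2.Stmt (fun _ : K => Γ) Λ σ
  | push k f, _, ex, _ => .push k f (exitStmt ex)
  | pop k f, _, ex, _ => .pop k f (exitStmt ex)
  | load f, _, ex, _ => .load f (exitStmt ex)
  | seq P Q, emb, _, .inl l => P.code (emb ∘ .inl) (some (emb (.inr Q.entry))) l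
  | seq _ Q, emb, ex, .inr l => Q.code (emb ∘ .inr) ex l
  | ite p P Q, emb, _, none => .branch p (.goto fun _ => emb (some (.inl P.entry)))
      (.goto fun _ => emb (some (.inr Q.entry)))
  | ite _ P _, emb, ex, some (.inl l) => P.code (emb ∘ some ∘ .inl) ex l
  | ite _ _ Q, emb, ex, some (.inr l) => Q.code (emb ∘ some ∘ .inr) ex l
  | loop k f p P, emb, ex, none =>
      .pop k f (.branch p (.goto fun _ => emb (some P.entry)) (exitStmt ex))
  | loop _ _ _ P, emb, _, some l => P.code (emb ∘ some) (some (emb none)) l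

/-- `c'` is reached from `c` in exactly `t` steps. -/
def Reach {Λ : Type} (M : Λ → TM2.Stmt (fun _ : K => Γ) Λ σ) (c : TM2.Cfg (fun _ : K => Γ) Λ σ)
    (t : ℕ) (c' : TM2.Cfg (fun _ : K => Γ) Λ σ) : Prop :=
  (flip bind (TM2.step M))^[t] (some c) = some c'

section

variable {Λ : Type} {M : Λ → TM2.Stmt (fun _ : K => Γ) Λ σ}

theorem Reach.trans {c c' c'' : TM2.Cfg (fun _ : K => Γ) Λ σ} {t t' : ℕ} (h : Reach M c t c')
    (h' : Reach M c' t' c'') : Reach M c (t + t') c'' := by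
  unfold Reach at *
  rw [Nat.add_comm, Function.iterate_add_apply, h, h']

theorem Reach.step {l : Λ} {v : σ} {S : K → List Γ} {q : TM2.Stmt (fun _ : K => Γ) Λ σ}
    (h : M l = q) : Reach M ⟨some l, v, S⟩ 1 (TM2.stepAux q v S) := by
  subst h; rfl

theorem stepAux_exitStmt (ex : Option Λ) (v : σ) (S : K → List Γ) :
    TM2.stepAux (exitStmt ex) v S = ⟨ex, v, S⟩ := by
  cases ex <;> rfl

/-- The compiled program does what the program does, in the same number of steps. -/
theorem Exec.reach {P : Prog K Γ σ} {v v' : σ} {S S' : K → List Γ} {t : ℕ}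
    (h : Exec P v S t v' S') : ∀ {emb : P.Lab → Λ} {ex : Option Λ},
    (∀ l, M (emb l) = P.code emb ex l) → Reach M ⟨some (emb P.entry), v, S⟩ t ⟨ex, v', S'⟩ := by
  induction h with
  | push k f v S =>
    intro emb ex hM
    have h1 : Reach M _ 1 (TM2.stepAux (.push k f (exitStmt ex)) v S) := Reach.step (hM ())
    rwa [TM2.stepAux, stepAux_exitStmt] at h1
  | pop k f v S =>
    intro emb ex hM
    have h1 : Reach M _ 1 (TM2.stepAux (.pop k f (exitStmt ex)) v S) := Reach.step (hM ())
    rwa [TM2.stepAux, stepAux_exitStmt] at h1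
  | load f v S =>
    intro emb ex hM
    have h1 : Reach M _ 1 (TM2.stepAux (.load f (exitStmt ex)) v S) := Reach.step (hM ())
    rwa [TM2.stepAux, stepAux_exitStmt] at h1
  | seq _ _ ih1 ih2 =>
    intro emb ex hM
    exact (ih1 fun l => hM (.inl l)).trans (ih2 fun l => hM (.inr l))
  | @ite_true p P Q v S t v' S' hp _ ih =>
    intro emb ex hM
    have h1 := Reach.step (v := v) (S := S) (hM none)
    rw [code, TM2.stepAux, hp] at h1
    exact h1.trans (ih fun l => hM (some (.inl l)))
  | @ite_false p P Q v S t v' S' hp _ ih =>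
    intro emb ex hM
    have h1 := Reach.step (v := v) (S := S) (hM none)
    rw [code, TM2.stepAux, hp] at h1
    exact h1.trans (ih fun l => hM (some (.inr l)))
  | @loop_done k f p P v S hp =>
    intro emb ex hM
    have h1 := Reach.step (v := v) (S := S) (hM none)
    rwa [code, TM2.stepAux, TM2.stepAux, hp, Bool.cond_false, stepAux_exitStmt] at h1
  | @loop_step k f p P v S t v' S' t' v'' S'' hp _ _ ih1 ih2 =>
    intro emb ex hM
    have h1 := Reach.step (v := v) (S := S) (hM none)
    rw [code, TM2.stepAux, TM2.stepAux, hp] at h1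
    exact (h1.trans (ih1 fun l => hM (some l))).trans (ih2 hM)

end

/-- The machine that runs a program. -/
def toFinTM2 [Fintype K] [Fintype Γ] [Fintype σ] (P : Prog K Γ σ) (k₀ k₁ : K) (v₀ : σ) :
    FinTM2 where
  K := K
  k₀ := k₀
  k₁ := k₁
  Γ _ := Γ
  Λ := P.Lab
  main := P.entry
  σ := σ
  initialState := v₀
  m := P.code id none

theorem initList_toFinTM2 [Fintype K] [Fintype Γ] [Fintype σ] (P : Prog K Γ σ) (k₀ k₁ : K)
    (v₀ : σ) (l : List Γ) :
    initList (P.toFinTM2 k₀ k₁ v₀) (List.map (Equiv.refl Γ).invFun l) =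
      (⟨some P.entry, v₀, Function.update (fun _ => []) k₀ l⟩ :
        TM2.Cfg (fun _ : K => Γ) P.Lab σ) := by
  refine (congrArg (initList (P.toFinTM2 k₀ k₁ v₀)) (List.map_id l)).trans ?_
  refine congrArg (TM2.Cfg.mk _ _) (funext fun (k : K) => ?_)
  by_cases hk : k = k₀
  · subst hk
    exact (dif_pos rfl).trans (Function.update_self k l (fun _ => [])).symm
  · exact (dif_neg hk).trans (Function.update_of_ne hk l (fun _ => [])).symm

theorem haltList_toFinTM2 [Fintype K] [Fintype Γ] [Fintype σ] (P : Prog K Γ σ) (k₀ k₁ : K)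
    (v₀ : σ) (l : List Γ) :
    haltList (P.toFinTM2 k₀ k₁ v₀) (List.map (Equiv.refl Γ).invFun l) =
      (⟨none, v₀, Function.update (fun _ => []) k₁ l⟩ :
        TM2.Cfg (fun _ : K => Γ) P.Lab σ) := by
  refine (congrArg (haltList (P.toFinTM2 k₀ k₁ v₀)) (List.map_id l)).trans ?_
  refine congrArg (TM2.Cfg.mk _ _) (funext fun (k : K) => ?_)
  by_cases hk : k = k₁
  · subst hk
    exact (dif_pos rfl).trans (Function.update_self k l (fun _ => [])).symm
  · exact (dif_neg hk).trans (Function.update_of_ne hk l (fun _ => [])).symm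

/-- A program that turns the encoding of `a` on the stack `k₀` into the encoding of `f a` on the
stack `k₁` shows that `f` is computable in polynomial time. -/
theorem nonempty_computableInPolyTime [Fintype K] [Fintype Γ] [Fintype σ] (P : Prog K Γ σ)
    (k₀ k₁ : K) (v₀ : σ) {α β : Type} (ea : α → List Γ) (eb : β → List Γ) (f : α → β)
    (q : Polynomial ℕ)
    (h : ∀ a, ∃ t ≤ q.eval (ea a).length, Exec P v₀ (Function.update (fun _ => []) k₀ (ea a)) t v₀
      (Function.update (fun _ => []) k₁ (eb (f a)))) :
    Nonempty (TM2ComputableInPolyTime ea eb f) := by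
  choose t ht hexec using h
  refine ⟨{ tm := P.toFinTM2 k₀ k₁ v₀, inputAlphabet := Equiv.refl _,
            outputAlphabet := Equiv.refl _, time := q, outputsFun := fun a => ?_ }⟩
  refine ⟨⟨t a, ?_⟩, ht a⟩
  have h1 := (hexec a).reach (M := P.code id none) (emb := id) (ex := none) fun _ => rfl
  have e1 := P.initList_toFinTM2 k₀ k₁ v₀ (ea a)
  have e2 := P.haltList_toFinTM2 k₀ k₁ v₀ (eb (f a))
  rw [Option.map_some]
  refine Eq.trans ?_ (congrArg some e2.symm)
  refine Eq.trans ?_ h1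
  exact congrArg (fun c => (flip bind (P.toFinTM2 k₀ k₁ v₀).step)^[t a] (some c)) e1

end Prog


/-! ### Arithmetic on lists of binary digits -/

/-- The binary digits of a number as symbols. -/
def digits (n : ℕ) : List Computability.Γ' := n.bits.map .bit

/-- The binary digits of `n + c`, where `c ∈ {0, 1}` and `l` are the digits of `n`. -/
def incBits : List Bool → Bool → List Bool
  | [], c => if c then [true] else []
  | b :: l, c => (b ^^ c) :: incBits l (b && c)

theorem incBits_bits (n : ℕ) (c : Bool) : incBits n.bits c = (n + c.toNat).bits := by
  induction n using Nat.binaryRec' generalizing c with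
  | zero => cases c <;> simp [incBits]
  | bit b n h ih =>
    rw [Nat.bits_append_bit n b h, incBits, ih]
    cases b <;> cases c
    · rw [Bool.toNat_false, add_zero, Nat.bits_append_bit n false h]; simp
    · have : Nat.bit false n + true.toNat = Nat.bit true n := by simp [Nat.bit]
      rw [this, Nat.bits_append_bit n true fun _ => rfl]
      simp
    · rw [Bool.toNat_false, add_zero, Nat.bits_append_bit n true h]; simp
    · have : Nat.bit true n + true.toNat = Nat.bit false (n + 1) := by simp [Nat.bit]; ring
      rw [this, Nat.bits_append_bit (n + 1) false (by simp)]
      simp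

/-- The two's complement with width `w` of the number with digits `l`, where `seen` says whether a
digit `1` has occurred before. The result has `w + 1` digits if no digit `1` occurs. -/
def negBits : ℕ → List Bool → Bool → List Bool
  | 0, _, seen => if seen then [] else [true]
  | w + 1, l, seen => (l.headD false ^^ seen) :: negBits w l.tail (seen || l.headD false)

theorem negBits_bits (w n : ℕ) (h : n = 0 ∨ n.bits.length < w) :
    negBits w n.bits false = (2 ^ w - n).bits ∧ negBits w n.bits true = (2 ^ w - 1 - n).bits := by
  induction w generalizing n with
  | zero =>
    have : n = 0 := by simpa using h
    subst this
    simp [negBits]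
  | succ w ih =>
    obtain ⟨b, n, hb, rfl⟩ : ∃ b m, (m = 0 → b = true ∨ n = 0) ∧ n = Nat.bit b m :=
      ⟨n.testBit 0, n / 2, fun h0 => by
        rcases Nat.lt_or_ge n 1 with h1 | h1
        · right; omega
        · left
          have : n = 1 := by omega
          subst this
          rfl, (Nat.bit_testBit_zero_shiftRight_one n).symm⟩
    have hhead : (Nat.bit b n).bits.headD false = b ∧ (Nat.bit b n).bits.tail = n.bits := by
      by_cases h0 : n = 0 → b = true
      · rw [Nat.bits_append_bit n b h0]; simp
      · push Not at h0
        obtain ⟨rfl, h1⟩ := h0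
        simp only [ne_eq, Bool.not_eq_true] at h1
        subst h1
        simp [Nat.bit]
    have hn : n = 0 ∨ n.bits.length < w := by
      rcases h with h | h
      · left; exact (Nat.bit_eq_zero_iff.1 h).1
      · by_cases h0 : n = 0
        · exact .inl h0
        · rw [Nat.bits_append_bit n b fun h1 => absurd h1 h0] at h
          right; simpa using h
    have hlt : n < 2 ^ w := by
      rcases hn with rfl | hn
      · positivity
      · exact Nat.lt_two_pow_of_length_bits_le hn.le
    have hlt' : n ≠ 0 → n + 1 < 2 ^ w := by
      intro h0
      have h1 : n.bits.length ≤ w - 1 := by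
        have := hn.resolve_left h0
        omega
      have h2 := Nat.lt_two_pow_of_length_bits_le h1
      obtain ⟨v, rfl⟩ : ∃ v, w = v + 1 := ⟨w - 1, by have := hn.resolve_left h0; omega⟩
      rw [Nat.add_sub_cancel] at h2
      rw [pow_succ]
      omega
    have hone : w = 0 → b = false := by
      rintro rfl
      have h0 : n = 0 := by simpa using hn
      subst h0
      cases b
      · rfl
      · simp [Nat.bit] at h
    obtain ⟨ih1, ih2⟩ := ih n hn
    simp only [negBits, hhead.1, hhead.2, Bool.xor_false, Bool.false_or, Bool.xor_true,
      Bool.true_or]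
    constructor
    · cases b
      · have e : 2 ^ (w + 1) - Nat.bit false n = Nat.bit false (2 ^ w - n) := by
          simp only [Nat.bit, cond_false, pow_succ]; omega
        rw [ih1, e, Nat.bits_append_bit _ false (by omega)]
      · have e : 2 ^ (w + 1) - Nat.bit true n = Nat.bit true (2 ^ w - 1 - n) := by
          simp only [Nat.bit, cond_true, pow_succ]; omega
        rw [ih2, e, Nat.bits_append_bit _ true fun _ => rfl]
    · have e : 2 ^ (w + 1) - 1 - Nat.bit b n = Nat.bit (!b) (2 ^ w - 1 - n) := by
        cases b <;> simp only [Nat.bit, cond_true, cond_false, pow_succ, Bool.not_true,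
          Bool.not_false] <;> omega
      rw [ih2, e, Nat.bits_append_bit _ (!b)]
      intro h0
      by_cases h1 : n = 0
      · subst h1
        have : w = 0 := by
          by_contra hw
          have := Nat.one_lt_two_pow hw
          omega
        simp [hone this]
      · have := hlt' h1
        omega

/-! ### Subroutines -/

namespace Machine

open Computability Prog

/-- The stacks of the machine: input, output under construction (in reverse order), final output,
three work stacks, the numbers `k`, `2 ^ m - k`, `d`, `2 ^ (2 * m + 1) - d`, `2 ^ (2 * m + 1)`,
`2 ^ m` and `n + 1` in binary, the numbers `m` and `2 * m + 1` in unary, and the numbers of blocks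
before and after the current one in unary. -/
inductive Stk
  | inp | out | res | t₁ | t₂ | t₃ | numK | compK | numD | compD | pow | powK | copies
  | unaryM | unaryW | before | after
  deriving DecidableEq

open Stk in
instance : Fintype Stk where
  elems := {inp, out, res, t₁, t₂, t₃, numK, compK, numD, compD, pow, powK, copies, unaryM, unaryW,
    before, after}
  complete k := by cases k <;> decide

/-- The control register: a symbol and a flag. -/
abbrev Reg := Option Γ' × Bool

/-- The contents of the stacks. -/
abbrev Stacks := Stk → List Γ'

/-- Programs over these stacks. -/
abbrev Pgm := Prog Stk Γ' Reg

/-- Whatever the register contains, `P` transforms the stacks from `S` to `S'` in at most `n`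
steps. -/
def RunsTo (P : Pgm) (S S' : Stacks) (n : ℕ) : Prop :=
  ∀ v, ∃ v' t, t ≤ n ∧ P.Exec v S t v' S'

theorem RunsTo.seq {P Q : Pgm} {S S' S'' : Stacks} {n n' : ℕ} (h : RunsTo P S S' n)
    (h' : RunsTo Q S' S'' n') : RunsTo (.seq P Q) S S'' (n + n') := fun v => by
  obtain ⟨v', t, ht, hP⟩ := h v
  obtain ⟨v'', t', ht', hQ⟩ := h' v'
  exact ⟨v'', _, add_le_add ht ht', .seq hP hQ⟩

theorem RunsTo.mono {P : Pgm} {S S' : Stacks} {n n' : ℕ} (h : RunsTo P S S' n) (hn : n ≤ n') :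
    RunsTo P S S' n' := fun v =>
  let ⟨v', t, ht, hP⟩ := h v
  ⟨v', t, ht.trans hn, hP⟩

theorem RunsTo.congr {P : Pgm} {S S' S'' : Stacks} {n : ℕ} (h : RunsTo P S S' n)
    (hS : S' = S'') : RunsTo P S S'' n := hS ▸ h

theorem runsTo_push (k : Stk) (a : Γ') (S : Stacks) :
    RunsTo (.push k fun _ => a) S (Function.update S k (a :: S k)) 1 := fun v =>
  ⟨v, 1, le_rfl, .push k (fun _ => a) v S⟩

/-- Do nothing. -/
def skip : Pgm := .load id

theorem runsTo_skip (S : Stacks) : RunsTo skip S S 1 := fun v => ⟨v, 1, le_rfl, .load id v S⟩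

/-- The symbol in the register. -/
def sym (v : Reg) : Γ' := v.1.getD .comma

/-- The digit in the register, `0` if there is none. -/
def bitVal : Option Γ' → Bool
  | some (.bit b) => b
  | _ => false

/-- Pop a symbol into the register. -/
def popReg (k : Stk) : Pgm := .pop k fun v a => (a, v.2)

/-- Pop symbols from `k` and run `P` for each of them, until a symbol fails the test `p`. -/
def popWhile (p : Option Γ' → Bool) (k : Stk) (P : Pgm) : Pgm :=
  .loop k (fun v a => (a, v.2)) (fun v => p v.1) P

/-- Pop all symbols from `k` and run `P` for each of them. -/
def forPop (k : Stk) (P : Pgm) : Pgm := popWhile Option.isSome k P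

/-- The invariant rule for loops. Here `F a rest` is the contents of the stacks in state `a`, when
`rest` remains to be processed, and `fl` is an assertion about the flag. -/
theorem exec_popWhile {A : Type*} (p : Option Γ' → Bool) (k : Stk) (P : Pgm)
    (F : A → List Γ' → Stacks) (fl : A → List Γ' → Bool → Prop) (next : A → Γ' → A)
    (l tail : List Γ') (n : ℕ) (hl : ∀ x ∈ l, p (some x) = true) (ht : p tail.head? = false)
    (hF : ∀ a rest, F a rest k = rest ++ tail)
    (hbody : ∀ a x rest c, x ∈ l → fl a (x :: rest) c → ∃ v' t, t ≤ n ∧ fl (next a x) rest v'.2 ∧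
      P.Exec (some x, c) (Function.update (F a (x :: rest)) k (rest ++ tail)) t v'
        (F (next a x) rest))
    (a : A) (v : Reg) (h : fl a l v.2) :
    ∃ c t, t ≤ l.length * (n + 1) + 1 ∧ fl (l.foldl next a) [] c ∧
      (popWhile p k P).Exec v (F a l) t (tail.head?, c)
        (Function.update (F (l.foldl next a) []) k tail.tail) := by
  induction l generalizing a v with
  | nil =>
    refine ⟨v.2, 1, by simp, h, ?_⟩
    have h1 := Exec.loop_done (k := k) (f := fun (v : Reg) (a : Option Γ') => (a, v.2))
      (p := fun v => p v.1) (P := P) (v := v) (S := F a []) (by rw [hF]; exact ht)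
    rw [hF] at h1
    exact h1
  | cons x l ih =>
    obtain ⟨v', t, ht1, hfl, hP⟩ := hbody a x l v.2 List.mem_cons_self h
    obtain ⟨c, t', ht', hc, hloop⟩ := ih (fun y hy => hl y (List.mem_cons_of_mem _ hy))
      (fun a y rest c hy => hbody a y rest c (List.mem_cons_of_mem _ hy)) (next a x) v' hfl
    refine ⟨c, 1 + t + t', ?_, hc, ?_⟩
    · rw [List.length_cons, Nat.succ_mul]
      omega
    · refine Exec.loop_step (v' := v') (S' := F (next a x) l) ?_ ?_ hloop
      · simpa only [hF, List.cons_append, List.head?_cons] using hl x List.mem_cons_self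
      · simpa only [hF, List.cons_append, List.head?_cons, List.tail_cons] using hP

/-- Invariant rule for loops whose body does not use the flag. -/
theorem runsTo_forPop {A : Type*} (k : Stk) (P : Pgm) (F : A → List Γ' → Stacks)
    (I : A → List Γ' → Prop) (next : A → Γ' → A) (l : List Γ') (n : ℕ)
    (hF : ∀ a rest, F a rest k = rest)
    (hbody : ∀ a x rest c, x ∈ l → I a (x :: rest) → I (next a x) rest ∧ ∃ v' t, t ≤ n ∧
      P.Exec (some x, c) (Function.update (F a (x :: rest)) k rest) t v' (F (next a x) rest))
    (a : A) (h : I a l) :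
    RunsTo (forPop k P) (F a l) (F (l.foldl next a) []) (l.length * (n + 1) + 1) := fun v => by
  obtain ⟨c, t, ht, -, hP⟩ := exec_popWhile Option.isSome k P F (fun a rest _ => I a rest) next l
    [] n (fun _ _ => rfl) rfl (fun a rest => by rw [hF, List.append_nil])
    (fun a x rest c hx hI => by
      obtain ⟨h1, v', t, ht, hP⟩ := hbody a x rest c hx hI
      exact ⟨v', t, ht, h1, by rwa [List.append_nil]⟩) a v h
  have : Function.update (F (l.foldl next a) []) k ([] : List Γ').tail =
      F (l.foldl next a) [] := by
    rw [eq_comm, Function.eq_update_self_iff, hF]; rfl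
  exact ⟨(none, c), t, ht, this ▸ hP⟩

theorem foldl_cons (u acc : List Γ') : u.foldl (fun a x => x :: a) acc = u.reverse ++ acc := by
  induction u generalizing acc with
  | nil => rfl
  | cons x u ih => simp [ih]

theorem exec_push {k : Stk} {f : Reg → Γ'} {v : Reg} {S S' : Stacks}
    (h : Function.update S k (f v :: S k) = S') : Exec (.push k f) v S 1 v S' :=
  h ▸ .push k f v S

theorem exec_load {f : Reg → Reg} {v v' : Reg} {S : Stacks} (h : f v = v') :
    Exec (.load f) v S 1 v' S :=
  h ▸ .load f v S

/-- Move the contents of the stack `k` to `k'`, which reverses the order. -/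
def move (k k' : Stk) : Pgm := forPop k (.push k' sym)

theorem runsTo_move {k k' : Stk} (h : k ≠ k') (S : Stacks) :
    RunsTo (move k k') S
      (Function.update (Function.update S k []) k' ((S k).reverse ++ S k'))
      (2 * (S k).length + 1) := by
  have := runsTo_forPop k (.push k' sym)
    (fun a rest => Function.update (Function.update S k rest) k' (a ++ S k'))
    (fun _ _ => True) (fun a x => x :: a) (S k) 1
    (fun a rest => by rw [Function.update_of_ne h, Function.update_self])
    (fun a x rest c _ _ => ⟨trivial, (some x, c), 1, le_rfl, by
      convert! Exec.push k' sym (some x, c) _ using 1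
      funext j
      by_cases h1 : j = k'
      · subst h1; simp [sym, Function.update_of_ne h.symm]
      · by_cases h2 : j = k
        · subst h2; simp [h1]
        · simp [h1, h2]⟩) [] trivial
  have e : Function.update (Function.update S k (S k)) k' ([] ++ S k') = S := by simp
  rw [e, foldl_cons, List.append_nil] at this
  exact this.mono (by omega)

/-- Empty the stack `k`. -/
def drain (k : Stk) : Pgm := forPop k skip

theorem runsTo_drain (k : Stk) (S : Stacks) :
    RunsTo (drain k) S (Function.update S k []) (2 * (S k).length + 1) := by
  have := runsTo_forPop k skip (fun (_ : Unit) rest => Function.update S k rest)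
    (fun _ _ => True) (fun a _ => a) (S k) 1 (fun a rest => by simp)
    (fun a x rest c _ _ => ⟨trivial, (some x, c), 1, le_rfl, by
      rw [Function.update_idem]; exact Exec.load id _ _⟩) () trivial
  rw [Function.update_eq_self] at this
  exact this.mono (by omega)

/-- Append the contents of the stack `k` to the output. -/
def copyOut (k : Stk) : Pgm :=
  .seq (forPop k (.seq (.push .t₁ sym) (.push .out sym))) (move .t₁ k)

theorem runsTo_copyOut {k : Stk} (h1 : k ≠ .t₁) (h2 : k ≠ .out) (S : Stacks) (ht : S .t₁ = []) :
    RunsTo (copyOut k) S (Function.update S Stk.out ((S k).reverse ++ S .out))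
      (5 * (S k).length + 2) := by
  have := runsTo_forPop k (.seq (.push .t₁ sym) (.push .out sym))
    (fun a rest => Function.update (Function.update (Function.update S k rest) Stk.t₁ a)
      Stk.out (a ++ S .out))
    (fun _ _ => True) (fun a x => x :: a) (S k) 2
    (fun a rest => by rw [Function.update_of_ne h2, Function.update_of_ne h1,
      Function.update_self])
    (fun a x rest c _ _ => ⟨trivial, (some x, c), 2, le_rfl, by
      convert! Exec.seq (Exec.push Stk.t₁ sym (some x, c) _) (Exec.push Stk.out sym (some x, c) _)
        using 1
      funext j
      by_cases h3 : j = .out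
      · subst h3; simp [sym, Function.update_of_ne h2.symm]
      · by_cases h4 : j = .t₁
        · subst h4; simp [sym, Function.update_of_ne h1.symm]
        · by_cases h5 : j = k
          · subst h5; simp [h3, h4]
          · simp [h3, h4, h5]⟩) [] trivial
  have e1 : Function.update (Function.update (Function.update S k (S k)) Stk.t₁ []) Stk.out
      ([] ++ S .out) = S := by
    funext j
    by_cases h3 : j = .out
    · subst h3; simp
    · by_cases h4 : j = .t₁
      · subst h4; simp [ht]
      · simp [h3, h4]
  rw [e1, foldl_cons, List.append_nil] at this
  refine ((this.seq (runsTo_move h1.symm _)).mono ?_).congr ?_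
  · simp; omega
  · funext j
    by_cases h3 : j = .out
    · subst h3; simp [Function.update_of_ne h2.symm]
    · by_cases h4 : j = .t₁
      · subst h4; simp [ht, Function.update_of_ne h1.symm]
      · by_cases h5 : j = k
        · subst h5; simp [h3, h4]
        · simp [h3, h4, h5]

/-- Push the word `u` on the stack `k`, its last symbol first. -/
def pushWord (k : Stk) : List Γ' → Pgm
  | [] => skip
  | a :: u => .seq (pushWord k u) (.push k fun _ => a)

theorem runsTo_pushWord (k : Stk) (u : List Γ') (S : Stacks) :
    RunsTo (pushWord k u) S (Function.update S k (u ++ S k)) (u.length + 1) := by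
  induction u with
  | nil => simpa [pushWord] using runsTo_skip S
  | cons a u ih =>
    refine (ih.seq (runsTo_push k a _)).congr ?_
    simp

/-- Load a number that is terminated by a comma from the input to the empty stack `k`. -/
def loadNumber (k : Stk) : Pgm :=
  .seq (popWhile (fun a => a.isSome && a != some .comma) Stk.inp (.push .t₁ sym)) (move .t₁ k)

theorem runsTo_loadNumber {k : Stk} (h1 : k ≠ .t₁) (h2 : k ≠ .inp) (S : Stacks) (n : ℕ)
    (rest : List Γ') (hinp : S .inp = digits n ++ .comma :: rest) (ht : S .t₁ = [])
    (hk : S k = []) :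
    RunsTo (loadNumber k) S (Function.update (Function.update S Stk.inp rest) k (digits n))
      (4 * n.bits.length + 2) := by
  have h : RunsTo (popWhile (fun a => a.isSome && a != some .comma) Stk.inp (.push .t₁ sym)) S
      (Function.update (Function.update S Stk.inp rest) Stk.t₁ (digits n).reverse)
      (2 * n.bits.length + 1) := by
    intro v
    obtain ⟨c, t, ht1, -, hP⟩ := exec_popWhile (fun a => a.isSome && a != some .comma) Stk.inp
      (.push .t₁ sym)
      (fun a rest' =>
        Function.update (Function.update S Stk.inp (rest' ++ .comma :: rest)) Stk.t₁ a)
      (fun _ _ _ => True) (fun a x => x :: a) (digits n) (.comma :: rest) 1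
      (by intro x hx; simp only [digits, List.mem_map] at hx; obtain ⟨b, -, rfl⟩ := hx; rfl)
      rfl (fun a rest => by simp)
      (fun a x rest' c _ _ => ⟨(some x, c), 1, le_rfl, trivial, by
        convert! Exec.push Stk.t₁ sym (some x, c) _ using 1
        funext j
        cases j <;> simp [sym]⟩) [] v trivial
    refine ⟨(some .comma, c), t, ht1.trans ?_, ?_⟩
    · simp [digits]; omega
    · convert! hP using 1
      · funext j
        cases j <;> simp [ht, hinp]
      · funext j
        cases j <;> simp
  refine ((h.seq (runsTo_move h1.symm _)).mono ?_).congr ?_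
  · simp [digits]; omega
  · funext j
    by_cases h3 : j = k
    · subst h3; simp [h1, h2, hk]
    · by_cases h4 : j = .t₁
      · subst h4; simp [ht, h3]
      · simp [h3, h4]

/-- Add one to the binary number on the stack `k`. -/
def increment (k : Stk) : Pgm :=
  .seq (.load fun v => (v.1, true)) <|
  .seq (forPop k (.seq (.push .t₁ fun v => .bit (bitVal v.1 ^^ v.2))
    (.load fun v => (v.1, bitVal v.1 && v.2)))) <|
  .seq (.ite (fun v => v.2) (.push .t₁ fun _ => .bit true) skip) (move .t₁ k)

theorem exec_increment_loop {k : Stk} (h1 : k ≠ .t₁) (S : Stacks) (u : List Bool) (c : Bool)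
    (r : Option Γ') (acc : List Γ') :
    ∃ v t, t ≤ 3 * u.length + 3 ∧ Exec (.seq (forPop k (.seq
        (.push .t₁ fun v => .bit (bitVal v.1 ^^ v.2)) (.load fun v => (v.1, bitVal v.1 && v.2))))
        (.ite (fun v => v.2) (.push .t₁ fun _ => .bit true) skip)) (r, c)
      (Function.update (Function.update S k (u.map .bit)) Stk.t₁ acc) t v
      (Function.update (Function.update S k []) Stk.t₁
        (((incBits u c).map .bit).reverse ++ acc)) := by
  induction u generalizing c r acc with
  | nil =>
    refine ⟨(none, c), 1 + (1 + 1), le_rfl, .seq (v' := (none, c))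
      (S' := Function.update (Function.update S k []) Stk.t₁ acc) ?_ ?_⟩
    · have := Exec.loop_done (k := k) (f := fun (v : Reg) (a : Option Γ') => (a, v.2))
        (p := fun v => v.1.isSome) (P := .seq
          (.push .t₁ fun v => .bit (bitVal v.1 ^^ v.2)) (.load fun v => (v.1, bitVal v.1 && v.2)))
        (v := (r, c)) (S := Function.update (Function.update S k []) Stk.t₁ acc) (by simp [h1])
      convert! this using 1
      · simp [h1]
      · rw [eq_comm, Function.update_eq_self_iff]; simp [h1]
    · cases c
      · refine .ite_false rfl ?_
        simpa [incBits, skip] using Exec.load (K := Stk) (Γ := Γ') id ((none, false) : Reg) _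
      · refine .ite_true rfl ?_
        convert! Exec.push Stk.t₁ (fun _ => Γ'.bit true) ((none, true) : Reg) _ using 1
        simp [incBits]
  | cons b u ih =>
    obtain ⟨v, t, ht, hP⟩ := ih (b && c) (some (.bit b)) (.bit (b ^^ c) :: acc)
    cases hP with
    | seq hA hB =>
      rename_i t1 v1 S1 t2
      refine ⟨v, (1 + 2 + t1) + t2, ?_,
        .seq (.loop_step (v' := (some (.bit b), b && c)) ?_ ?_ (by exact hA)) ?_⟩
      · simp only [List.length_cons]; omega
      · simp [h1]
      · refine .seq (exec_push ?_) (exec_load ?_)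
        · funext j
          by_cases h3 : j = .t₁
          · subst h3; simp [h1, h1.symm, bitVal]
          · by_cases h4 : j = k
            · subst h4; simp [h1]
            · simp [h3, h4]
        · simp [h1, bitVal]
      · simpa [incBits] using hB

theorem runsTo_increment {k : Stk} (h1 : k ≠ .t₁) (S : Stacks) (n : ℕ) (ht : S .t₁ = [])
    (hk : S k = digits n) :
    RunsTo (increment k) S (Function.update S k (digits (n + 1))) (5 * n.bits.length + 7) := by
  intro v
  obtain ⟨v', t, ht', hP⟩ := exec_increment_loop h1 S n.bits true v.1 []
  cases hP with
  | seq hA hB =>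
    rename_i t1 v1 S1 t2
    obtain ⟨v'', t'', ht'', hC⟩ := runsTo_move h1.symm (Function.update (Function.update S k [])
      Stk.t₁ (((incBits n.bits true).map .bit).reverse ++ [])) v'
    refine ⟨v'', 1 + (t1 + (t2 + t'')), ?_, .seq (.load _ _ _) (.seq ?_ (.seq hB ?_))⟩
    · have hlen : ∀ (u : List Bool) c, (incBits u c).length ≤ u.length + 1 := by
        intro u
        induction u with
        | nil => intro c; cases c <;> simp [incBits]
        | cons b u ih => intro c; simpa [incBits] using ih _
      have := hlen n.bits true
      simp only [Function.update_self, List.append_nil, List.length_reverse,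
        List.length_map] at ht''
      omega
    · convert! hA using 1
      funext j
      by_cases h3 : j = .t₁
      · subst h3; simp [ht]
      · by_cases h4 : j = k
        · subst h4; simp [h1, hk, digits]
        · simp [h3, h4]
    · convert! hC using 1
      funext j
      by_cases h4 : j = k
      · subst h4; simp [h1, incBits_bits, digits]
      · by_cases h3 : j = .t₁
        · subst h3; simp [ht, h1.symm]
        · simp [h3, h4]

/-- Put `2 ^ w - x` on the empty stack `c`, where `w` is the height of the stack `w` and `x` the
number on the stack `d`. The flag records whether a digit `1` of `x` has been seen. -/
def complement (w d c : Stk) : Pgm :=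
  .seq (.load fun v => (v.1, false)) <|
  .seq (forPop w <|
    .seq (.push .t₂ sym) <|
    .seq (popReg d) <|
    .seq (.ite (fun v => v.1.isSome) (.push .t₃ sym) skip) <|
    .seq (.push .t₁ fun v => .bit (bitVal v.1 ^^ v.2)) <|
    .load fun v => (v.1, v.2 || bitVal v.1)) <|
  .seq (.ite (fun v => v.2) skip (.push .t₁ fun _ => .bit true)) <|
  .seq (move .t₁ c) <| .seq (move .t₂ w) (move .t₃ d)

theorem exec_complement_loop {w d : Stk} (hwd : w ≠ d) (hw : w ≠ .t₁ ∧ w ≠ .t₂ ∧ w ≠ .t₃)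
    (hd : d ≠ .t₁ ∧ d ≠ .t₂ ∧ d ≠ .t₃) (l : List Γ') (S : Stacks) (u : List Bool) (c : Bool)
    (r : Option Γ') (hSw : S w = l) (hSd : S d = u.map .bit) :
    ∃ v t, t ≤ 7 * l.length + 3 ∧ Exec (.seq (forPop w <|
        .seq (.push .t₂ sym) <|
        .seq (popReg d) <|
        .seq (.ite (fun v => v.1.isSome) (.push .t₃ sym) skip) <|
        .seq (.push .t₁ fun v => .bit (bitVal v.1 ^^ v.2)) <|
        .load fun v => (v.1, v.2 || bitVal v.1))
      (.ite (fun v => v.2) skip (.push .t₁ fun _ => .bit true))) (r, c) S t v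
      (fun j => if j = w then [] else if j = d then (u.drop l.length).map .bit else
        if j = .t₁ then ((negBits l.length u c).map .bit).reverse ++ S j else
        if j = .t₂ then l.reverse ++ S j else
        if j = .t₃ then ((u.take l.length).map .bit).reverse ++ S j else S j) := by
  induction l generalizing S u c r with
  | nil =>
    refine ⟨(none, c), 1 + (1 + 1), le_rfl, .seq (v' := (none, c)) (S' := S) ?_ ?_⟩
    · have := Exec.loop_done (k := w) (f := fun (v : Reg) (a : Option Γ') => (a, v.2))
        (p := fun v => v.1.isSome) (P := .seq (.push .t₂ sym) <|
        .seq (popReg d) <|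
        .seq (.ite (fun v => v.1.isSome) (.push .t₃ sym) skip) <|
        .seq (.push .t₁ fun v => .bit (bitVal v.1 ^^ v.2)) <|
        .load fun v => (v.1, v.2 || bitVal v.1)) (v := (r, c)) (S := S) (by simp [hSw])
      convert! this using 1
      · simp [hSw]
      · rw [eq_comm, Function.update_eq_self_iff]; simp [hSw]
    · cases c
      · refine .ite_false rfl (exec_push ?_)
        funext j
        simp only [Function.update_apply]
        grind [negBits]
      · refine .ite_true rfl ?_
        convert! Exec.load (K := Stk) (Γ := Γ') id ((none, true) : Reg) _ using 1
        funext j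
        grind [negBits]
  | cons a l ih =>
    obtain ⟨v, t, ht, hP⟩ := ih (fun j => if j = w then l else if j = d then u.tail.map .bit else
        if j = .t₁ then .bit (u.headD false ^^ c) :: S j else
        if j = .t₂ then a :: S j else
        if j = .t₃ then (u.take 1).map .bit ++ S j else S j) u.tail (c || u.headD false)
        (u.head?.map .bit) (by simp) (by simp [hwd.symm])
    cases hP with
    | seq hA hB =>
      rename_i t1 v1 S1 t2
      refine ⟨v, (1 + (1 + (1 + ((1 + 1) + (1 + 1)))) + t1) + t2, ?_,
        .seq (.loop_step (v' := (u.head?.map .bit, c || u.headD false)) ?_ ?_ (by exact hA)) ?_⟩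
      · simp only [List.length_cons]; omega
      · simp [hSw]
      · refine .seq (exec_push rfl) (.seq (.pop _ _ _ _) ?_)
        have hd' : (Function.update (Function.update S w (a :: l).tail) Stk.t₂
            (a :: Function.update S w (a :: l).tail Stk.t₂)) d = u.map .bit := by
          simp [hd, hwd.symm, hSd]
        simp only [hSw, List.head?_cons, sym, Option.getD_some, hd']
        cases u with
        | nil =>
          refine .seq (.ite_false rfl (.load _ _ _)) (.seq (exec_push ?_) (exec_load ?_))
          · funext j
            simp only [Function.update_apply, bitVal]
            grind
          · simp [bitVal]
        | cons b u =>
          refine .seq (.ite_true rfl (exec_push rfl)) (.seq (exec_push ?_) (exec_load ?_))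
          · funext j
            simp only [Function.update_apply, bitVal, sym]
            grind
          · simp [bitVal]
      · convert! hB using 1
        funext j
        cases u <;> grind [negBits]

theorem length_negBits_le (w : ℕ) (l : List Bool) (c : Bool) : (negBits w l c).length ≤ w + 1 := by
  induction w generalizing l c with
  | zero => cases c <;> simp [negBits]
  | succ w ih => simpa [negBits] using ih _ _

theorem runsTo_complement {w d c : Stk} (hwd : w ≠ d) (hw : w ≠ .t₁ ∧ w ≠ .t₂ ∧ w ≠ .t₃)
    (hd : d ≠ .t₁ ∧ d ≠ .t₂ ∧ d ≠ .t₃) (hc : c ≠ .t₁ ∧ c ≠ .t₂ ∧ c ≠ .t₃ ∧ c ≠ w ∧ c ≠ d)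
    (S : Stacks) (n : ℕ) (hSd : S d = digits n) (hn : n = 0 ∨ n.bits.length < (S w).length)
    (h1 : S .t₁ = []) (h2 : S .t₂ = []) (h3 : S .t₃ = []) (hSc : S c = []) :
    RunsTo (complement w d c) S (Function.update S c (digits (2 ^ (S w).length - n)))
      (13 * (S w).length + 9) := by
  intro v
  obtain ⟨v', t, ht', hP⟩ := exec_complement_loop hwd hw hd (S w) S n.bits false v.1 rfl hSd
  generalize hS' : (fun j => _ : Stacks) = S' at hP
  cases hP with
  | seq hA hB =>
    rename_i t1 v1 S1 t2
    obtain ⟨v'', t'', ht'', hC⟩ := ((runsTo_move hc.1.symm S').seq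
      ((runsTo_move hw.2.1.symm _).seq (runsTo_move hd.2.2.symm _))) v'
    have e1 : S' .t₁ = (digits (2 ^ (S w).length - n)).reverse := by
      rw [digits, ← (negBits_bits _ n hn).1, ← hS']
      simp [hw.1.symm, hd.1.symm, h1]
    have e2 : S' .t₂ = (S w).reverse := by
      rw [← hS']
      simp [hw.2.1.symm, hd.2.1.symm, h2]
    have e3 : S' .t₃ = ((n.bits.take (S w).length).map .bit).reverse := by
      rw [← hS']
      simp [hw.2.2.symm, hd.2.2.symm, h3]
    have e4 : S' c = [] := by rw [← hS']; simp [hc, hSc]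
    have e5 : S' w = [] := by rw [← hS']; simp
    have e6 : S' d = (n.bits.drop (S w).length).map .bit := by rw [← hS']; simp [hwd.symm]
    have e7 : ∀ j, j ≠ .t₁ → j ≠ .t₂ → j ≠ .t₃ → j ≠ w → j ≠ d → S' j = S j := by
      intro j
      rw [← hS']
      simp +contextual
    refine ⟨v'', 1 + (t1 + (t2 + t'')), ?_, .seq (.load _ _ _) (.seq hA (.seq hB ?_))⟩
    · have f1 := length_negBits_le (S w).length n.bits false
      have f2 : (n.bits.take (S w).length).length ≤ (S w).length := by simp
      rw [(negBits_bits _ n hn).1] at f1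
      simp only [Function.update_of_ne hc.2.1.symm, Function.update_of_ne hw.2.2.symm,
        Function.update_of_ne hc.2.2.1.symm, Function.update_of_ne (show Stk.t₂ ≠ .t₁ by decide),
        Function.update_of_ne (show Stk.t₃ ≠ .t₁ by decide),
        Function.update_of_ne (show Stk.t₃ ≠ .t₂ by decide), e1, e2, e3, List.length_reverse,
        digits, List.length_map] at ht''
      omega
    · convert! hC using 1
      have e8 := List.take_append_drop (S w).length (digits n)
      simp only [digits, ← List.map_take, ← List.map_drop] at e8
      funext j
      simp only [Function.update_apply, digits] at *
      grind
end Machine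


/-! ### Writing the rows of the transition table -/

namespace Machine

open Computability Prog

theorem encodeNats_append (u u' : List ℕ) : encodeNats (u ++ u') = encodeNats u ++ encodeNats u' :=
  List.flatMap_append

theorem encodeNats_cons (a : ℕ) (u : List ℕ) :
    encodeNats (a :: u) = digits a ++ Γ'.comma :: encodeNats u := by
  simp [encodeNats, encodeNat_eq_bits, digits]

theorem encodeNats_nil : encodeNats [] = [] := rfl

/-- For every `i`, the program transforms `S i` to `S' i` in time polynomial in `sz i`. -/
def PolyRuns {ι : Type*} (sz : ι → ℕ) (P : Pgm) (S S' : ι → Stacks) : Prop :=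
  ∃ q : Polynomial ℕ, ∀ i, RunsTo P (S i) (S' i) (q.eval (sz i))

theorem PolyRuns.seq {ι : Type*} {sz : ι → ℕ} {P Q : Pgm} {S S' S'' : ι → Stacks}
    (h : PolyRuns sz P S S') (h' : PolyRuns sz Q S' S'') : PolyRuns sz (.seq P Q) S S'' := by
  obtain ⟨q, hq⟩ := h
  obtain ⟨q', hq'⟩ := h'
  exact ⟨q + q', fun i => by simpa using (hq i).seq (hq' i)⟩

theorem PolyRuns.comp {ι κ : Type*} {sz : ι → ℕ} {P : Pgm} {S S' : ι → Stacks}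
    (h : PolyRuns sz P S S') (f : κ → ι) :
    PolyRuns (fun j => sz (f j)) P (fun j => S (f j)) (fun j => S' (f j)) :=
  let ⟨q, hq⟩ := h
  ⟨q, fun j => hq (f j)⟩

/-- The stacks contain the numbers that occur in the rows of the table for the environment `e`. -/
structure Ready (e : RowEnv) (S : Stacks) : Prop where
  small : e.Small
  n_lt : e.n < e.m
  t₁ : S .t₁ = []
  numK : S .numK = digits e.k
  compK : S .compK = digits (2 ^ e.m - e.k)
  numD : S .numD = digits e.d
  compD : S .compD = digits (2 ^ (2 * e.m + 1) - e.d)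
  pow : S .pow = digits (2 ^ (2 * e.m + 1))
  powK : S .powK = digits (2 ^ e.m)
  copies : S .copies = digits (e.n + 1)
  before_le : (S .before).length ≤ e.m
  after_le : (S .after).length ≤ e.m

theorem Ready.update_out {e : RowEnv} {S : Stacks} (h : Ready e S) (o : List Γ') :
    Ready e (Function.update S .out o) := by
  obtain ⟨h1, h2, h3, h4, h5, h6, h7, h8, h9, h10, h11, h12⟩ := h
  constructor <;> simpa

theorem Ready.update_t₂ {e : RowEnv} {S : Stacks} (h : Ready e S) (o : List Γ') :
    Ready e (Function.update S .t₂ o) := by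
  obtain ⟨h1, h2, h3, h4, h5, h6, h7, h8, h9, h10, h11, h12⟩ := h
  constructor <;> simpa

theorem Ready.update_before {e : RowEnv} {S : Stacks} (h : Ready e S) (o : List Γ')
    (ho : o.length ≤ e.m) : Ready e (Function.update S .before o) := by
  obtain ⟨h1, h2, h3, h4, h5, h6, h7, h8, h9, h10, h11, h12⟩ := h
  constructor <;> simpa

theorem Ready.update_after {e : RowEnv} {S : Stacks} (h : Ready e S) (o : List Γ')
    (ho : o.length ≤ e.m) : Ready e (Function.update S .after o) := by
  obtain ⟨h1, h2, h3, h4, h5, h6, h7, h8, h9, h10, h11, h12⟩ := h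
  constructor <;> simpa

/-- The program appends the encoding of the numbers `w e b a` to the output, in polynomial time,
where `b` and `a` are the heights of the stacks `before` and `after`. The output stack holds the
output in reverse order. If `c` holds, the work stack `t₂` has to be empty. -/
def Emits (c : Prop) (P : Pgm) (w : RowEnv → ℕ → ℕ → List ℕ) : Prop :=
  ∃ q : Polynomial ℕ, ∀ e S, Ready e S → (c → S .t₂ = []) →
    RunsTo P S (Function.update S .out
      ((encodeNats (w e (S .before).length (S .after).length)).reverse ++ S .out)) (q.eval e.m)

theorem Emits.seq {c : Prop} {P Q : Pgm} {w w' : RowEnv → ℕ → ℕ → List ℕ} (h : Emits c P w)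
    (h' : Emits c Q w') : Emits c (.seq P Q) fun e b a => w e b a ++ w' e b a := by
  obtain ⟨q, hq⟩ := h
  obtain ⟨q', hq'⟩ := h'
  refine ⟨q + q', fun e S hS hc => ?_⟩
  rw [Polynomial.eval_add]
  refine ((hq e S hS hc).seq (hq' e _ (hS.update_out _) (by simpa using hc))).congr ?_
  simp [encodeNats_append]

/-- Run several programs one after the other. -/
def seqAll : List Pgm → Pgm
  | [] => skip
  | P :: l => .seq P (seqAll l)

theorem Emits.skip {c : Prop} : Emits c skip fun _ _ _ => [] :=
  ⟨.C 1, fun e S _ _ => by simpa [encodeNats_nil] using runsTo_skip S⟩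

theorem Emits.seqAll {c : Prop} {n : ℕ} {P : Fin n → Pgm}
    {w : Fin n → RowEnv → ℕ → ℕ → List ℕ} (h : ∀ j, Emits c (P j) (w j)) :
    Emits c (seqAll (List.ofFn P)) fun e b a => (List.ofFn fun j => w j e b a).flatten := by
  induction n with
  | zero => simpa [Machine.seqAll] using Emits.skip
  | succ n ih =>
    simp only [List.ofFn_succ, Machine.seqAll, List.flatten_cons]
    exact (h 0).seq (ih fun j => h j.succ)

theorem emits_const {c : Prop} (u : List ℕ) :
    Emits c (pushWord .out (encodeNats u).reverse) fun _ _ _ => u :=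
  ⟨.C ((encodeNats u).length + 1), fun e S _ _ => by
    simpa using runsTo_pushWord .out (encodeNats u).reverse S⟩

/-- Write the digits `u`, the number on the stack `k`, and a comma. -/
def emitStack (u : List Bool) (k : Stk) : Pgm :=
  .seq (pushWord .out (u.map .bit).reverse) <| .seq (copyOut k) (.push .out fun _ => .comma)

theorem emits_emitStack {c : Prop} (u : List Bool) {k : Stk} (h1 : k ≠ .t₁) (h2 : k ≠ .out)
    (x y : RowEnv → ℕ) (hx : ∀ e S, Ready e S → S k = digits (x e))
    (hy : ∀ e, (y e).bits = u ++ (x e).bits) (hle : ∀ e S, Ready e S → x e ≤ 2 ^ (2 * e.m + 1)) :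
    Emits c (emitStack u k) fun e _ _ => [y e] := by
  refine ⟨.C 10 * .X + .C (u.length + 14), fun e S hS _ => ?_⟩
  refine (((runsTo_pushWord .out _ S).seq ((runsTo_copyOut h1 h2 _
    (by simpa using hS.t₁)).seq (runsTo_push .out .comma _))).mono ?_).congr ?_
  · have h3 : (x e).bits.length ≤ 2 * e.m + 2 := by
      rw [Nat.size_eq_bits_len, Nat.size_le]
      exact (hle e S hS).trans_lt (Nat.pow_lt_pow_right (by norm_num) (by omega))
    simp [h2, hx e S hS, digits]
    omega
  · simp [encodeNats_cons, encodeNats_nil, hx e S hS, h2, digits, hy]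

theorem emits_stack {c : Prop} {k : Stk} (h1 : k ≠ .t₁) (h2 : k ≠ .out)
    (x : RowEnv → ℕ) (hx : ∀ e S, Ready e S → S k = digits (x e))
    (hle : ∀ e S, Ready e S → x e ≤ 2 ^ (2 * e.m + 1)) :
    Emits c (emitStack [] k) fun e _ _ => [x e] :=
  emits_emitStack [] h1 h2 x x hx (fun _ => rfl) hle

theorem Ready.copies_le {e : RowEnv} {S : Stacks} (h : Ready e S) :
    e.n + 1 ≤ 2 ^ (2 * e.m + 1) := by
  have h1 : e.m < 2 ^ e.m := Nat.lt_two_pow_self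
  have h2 : 2 ^ e.m ≤ 2 ^ (2 * e.m + 1) := Nat.pow_le_pow_right (by norm_num) (by omega)
  have := h.n_lt
  omega

theorem Ready.powK_le {e : RowEnv} {S : Stacks} (_ : Ready e S) :
    2 ^ e.m ≤ 2 ^ (2 * e.m + 1) :=
  Nat.pow_le_pow_right (by norm_num) (by omega)

/-- Write a numerator. -/
def emitNumer : Numer → Pgm
  | .lit c => pushWord .out (encodeNats [c]).reverse
  | .d => emitStack [] .numD
  | .compD => emitStack [] .compD
  | .k => emitStack [] .numK
  | .compK => emitStack [] .compK

theorem emits_emitNumer {c : Prop} (x : Numer) :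
    Emits c (emitNumer x) fun e _ _ => [x.val e] := by
  cases x with
  | lit => exact emits_const _
  | d => exact emits_stack (by decide) (by decide) _ (fun e S h => h.numD) fun e S h =>
      h.small.d_lt.le.trans h.powK_le
  | compD => exact emits_stack (by decide) (by decide) _ (fun e S h => h.compD) fun e S h =>
      Nat.sub_le _ _
  | k => exact emits_stack (by decide) (by decide) _ (fun e S h => h.numK) fun e S h =>
      h.small.k_lt.le.trans h.powK_le
  | compK => exact emits_stack (by decide) (by decide) _ (fun e S h => h.compK) fun e S h =>
      (Nat.sub_le _ _).trans h.powK_le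

/-- Write a denominator. -/
def emitDenom : Denom → Pgm
  | .lit c => pushWord .out (encodeNats [(c : ℕ)]).reverse
  | .pow => emitStack [] .pow
  | .copies => emitStack [] .copies
  | .twoCopies => emitStack [false] .copies
  | .powK => emitStack [] .powK

theorem emits_emitDenom {c : Prop} (x : Denom) :
    Emits c (emitDenom x) fun e _ _ => [(x.val e : ℕ)] := by
  cases x with
  | lit => exact emits_const _
  | pow => exact emits_stack (by decide) (by decide) _ (fun e S h => h.pow) fun e S h => le_rfl
  | copies => exact emits_stack (by decide) (by decide) _ (fun e S h => h.copies) fun e S h =>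
      h.copies_le
  | twoCopies =>
    refine emits_emitStack [false] (by decide) (by decide) (fun e => e.n + 1) _
      (fun e S h => h.copies) (fun e => ?_) fun e S h => h.copies_le
    exact Nat.bit0_bits _ (Nat.succ_ne_zero _)
  | powK => exact emits_stack (by decide) (by decide) _ (fun e S h => h.powK) fun e S h =>
      h.powK_le

/-- Write a vector of fractions. -/
def emitFracs {n : ℕ} (f : Fin n → Numer × Denom) : Pgm :=
  seqAll (List.ofFn fun j => .seq (emitNumer (f j).1) (emitDenom (f j).2))

open Reduction in
theorem emits_emitFracs {c : Prop} {n : ℕ} (f : Fin n → Numer × Denom) :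
    Emits c (emitFracs f) fun e _ _ => vecCode fracCode (entry e ∘ f) :=
  Emits.seqAll fun j => (emits_emitNumer (f j).1).seq (emits_emitDenom (f j).2)

/-- Run `P` once for each symbol on the stack `k`. -/
def forEach (k : Stk) (P : Pgm) : Pgm := .seq (forPop k (.seq (.push .t₂ sym) P)) (move .t₂ k)

theorem runsTo_forEach {k : Stk} (hk : k = .before ∨ k = .after) {P : Pgm} {w : RowEnv → List ℕ}
    {q : Polynomial ℕ} (hq : ∀ e S, Ready e S → (False → S .t₂ = []) → RunsTo P S
      (Function.update S .out ((encodeNats (w e)).reverse ++ S .out)) (q.eval e.m))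
    (e : RowEnv) (S : Stacks) (h : Ready e S) (ht : S .t₂ = []) :
    RunsTo (forEach k P) S (Function.update S .out
      ((encodeNats (List.replicate (S k).length (w e)).flatten).reverse ++ S .out))
      (e.m * (q.eval e.m + 4) + 2) := by
  have hk₁ : k ≠ .t₁ ∧ k ≠ .t₂ ∧ k ≠ .out := by rcases hk with rfl | rfl <;> decide
  have hkle : (S k).length ≤ e.m := by
    rcases hk with rfl | rfl
    exacts [h.before_le, h.after_le]
  have hready : ∀ rest : List Γ', rest.length ≤ e.m → Ready e (Function.update S k rest) := by
    intro rest hrest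
    rcases hk with rfl | rfl
    exacts [h.update_before _ hrest, h.update_after _ hrest]
  have key := runsTo_forPop k (.seq (.push .t₂ sym) P)
    (fun a rest => Function.update (Function.update (Function.update S k rest) .t₂ a) .out
      ((encodeNats (List.replicate a.length (w e)).flatten).reverse ++ S .out))
    (fun _ rest => rest.length ≤ e.m) (fun a x => x :: a) (S k) (1 + q.eval e.m)
    (fun a rest => by simp [hk₁])
    (fun a x rest c hx hI => ⟨(Nat.le_succ _).trans hI, by
      have h1 : Ready e (Function.update (Function.update (Function.update S k rest) Stk.t₂
          (x :: a)) Stk.out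
          ((encodeNats (List.replicate a.length (w e)).flatten).reverse ++ S .out)) :=
        ((hready rest ((Nat.le_succ _).trans hI)).update_t₂ _).update_out _
      obtain ⟨v', t, ht, hP⟩ := hq e _ h1 False.elim (some x, c)
      refine ⟨v', 1 + t, by omega, .seq (exec_push ?_) (by
        convert! hP using 1
        simp [List.replicate_succ', encodeNats_append])⟩
      funext j
      simp only [Function.update_apply, sym]
      grind⟩) [] hkle
  have e1 : Function.update (Function.update (Function.update S k (S k)) Stk.t₂ []) Stk.out
      ((encodeNats (List.replicate ([] : List Γ').length (w e)).flatten).reverse ++ S .out) =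
      S := by
    funext j
    simp only [Function.update_apply, List.length_nil, List.replicate_zero, List.flatten_nil,
      encodeNats_nil, List.reverse_nil, List.nil_append]
    grind
  rw [e1, foldl_cons, List.append_nil] at key
  refine ((key.seq (runsTo_move hk₁.2.1.symm _)).mono ?_).congr ?_
  · simp only [ne_eq, reduceCtorEq, not_false_eq_true, Function.update_of_ne,
      Function.update_self, List.length_reverse]
    nlinarith [Nat.mul_le_mul_right (q.eval e.m + 4) hkle]
  · funext j
    simp only [Function.update_apply, List.length_reverse]
    grind

theorem Emits.forEach_before {P : Pgm} {w : RowEnv → List ℕ} (h : Emits False P fun e _ _ => w e) :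
    Emits True (forEach .before P) fun e b _ => (List.replicate b (w e)).flatten :=
  let ⟨q, hq⟩ := h
  ⟨.X * (q + .C 4) + .C 2, fun e S hS hc => by
    simpa using runsTo_forEach (.inl rfl) hq e S hS (hc trivial)⟩

theorem Emits.forEach_after {P : Pgm} {w : RowEnv → List ℕ} (h : Emits False P fun e _ _ => w e) :
    Emits True (forEach .after P) fun e _ a => (List.replicate a (w e)).flatten :=
  let ⟨q, hq⟩ := h
  ⟨.X * (q + .C 4) + .C 2, fun e S hS hc => by
    simpa using runsTo_forEach (.inr rfl) hq e S hS (hc trivial)⟩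

/-- The code of the vector with the entries `f` on the hub, the entries `own` in one block (if `o`
holds), and the entries `other` in `b` blocks before and `a` blocks after this block. -/
def cellsCode {β : Type*} (cd : β → List ℕ) (f : Fin 13 → β) (own other : Fin 8 → β) (o : Bool)
    (b a : ℕ) : List ℕ :=
  vecCode cd f ++ ((List.replicate b (vecCode cd other)).flatten ++
    ((if o then vecCode cd own else []) ++ (List.replicate a (vecCode cd other)).flatten))

theorem vecCode_vertices {β : Type*} (cd : β → List ℕ) {n : ℕ} (F : Fin (13 + n * 8) → β) :
    vecCode cd F = vecCode cd (F ∘ Reduction.hub n) ++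
      (List.ofFn fun j : Fin n => vecCode cd (F ∘ Reduction.blk j)).flatten := by
  unfold vecCode
  rw [List.ofFn_add, List.flatten_append, List.ofFn_mul, List.flatten_flatten, List.map_ofFn]
  congr 4
  funext j
  refine congrArg List.flatten (congrArg List.ofFn (funext fun c => ?_))
  refine congrArg (fun v => cd (F v)) (Fin.ext ?_)
  simp [Reduction.blk, Reduction.vertexEquiv]
  ring

theorem flatten_ofFn_ite {n : ℕ} (j : Fin n) (u u' : List ℕ) :
    (List.ofFn fun i => if j = i then u else u').flatten = (List.replicate j u').flatten ++
      (u ++ (List.replicate (n - 1 - j) u').flatten) := by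
  have : (List.ofFn fun i => if j = i then u else u') =
      List.replicate j u' ++ u :: List.replicate (n - 1 - j) u' := by
    refine List.ext_getElem (by simp; omega) fun i h1 h2 => ?_
    simp only [List.getElem_ofFn, List.getElem_append, List.getElem_replicate,
      List.length_replicate, List.getElem_cons, Fin.ext_iff]
    split_ifs <;> first | rfl | omega
  rw [this]
  simp

theorem vecCode_cell {β : Type*} (cd : β → List ℕ) {n : ℕ} (f : Fin 13 → β)
    (own other : Fin 8 → β) (j : Fin n) :
    vecCode cd (Reduction.cell f own other (some j)) =
      cellsCode cd f own other true j (n - 1 - j) := by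
  rw [vecCode_vertices, cellsCode, if_pos rfl, ← flatten_ofFn_ite]
  congr 2
  · funext; simp
  · congr 1
    funext i
    split_ifs with h
    · congr 1; funext; simp [h]
    · congr 1; funext; simp [h]

theorem vecCode_cell_none {β : Type*} (cd : β → List ℕ) {n : ℕ} (f : Fin 13 → β)
    (own other : Fin 8 → β) {b a : ℕ} (h : b + a = n) :
    vecCode cd (Reduction.cell f own other (none : Option (Fin n))) =
      cellsCode cd f own other false b a := by
  rw [vecCode_vertices, cellsCode, if_neg Bool.false_ne_true, List.nil_append,
    ← List.flatten_append, List.replicate_append_replicate, h, ← List.ofFn_const]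
  congr 2
  · funext; simp
  · congr 1
    funext i
    congr 1; funext; simp

/-- Write the entries of a row: `f` on the hub, `own` if there is a block between the blocks before
and the blocks after, and `other` in all other blocks. -/
def emitCells {α : Type*} (emit : ∀ {n : ℕ}, (Fin n → α) → Pgm) (f : Fin 13 → α)
    (own other : Fin 8 → α) (o : Bool) : Pgm :=
  .seq (emit f) <| .seq (forEach .before (emit other)) <|
    .seq (if o then emit own else skip) (forEach .after (emit other))

theorem emits_emitCells {α β : Type*} {emit : ∀ {n : ℕ}, (Fin n → α) → Pgm} (v : RowEnv → α → β)
    (cd : β → List ℕ) (h : ∀ (c : Prop) (n : ℕ) (f : Fin n → α),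
      Emits c (emit f) fun e _ _ => vecCode cd (v e ∘ f)) (f : Fin 13 → α)
    (own other : Fin 8 → α) (o : Bool) :
    Emits True (emitCells emit f own other o) fun e b a =>
      cellsCode cd (v e ∘ f) (v e ∘ own) (v e ∘ other) o b a := by
  refine (h _ _ f).seq ((h _ _ other).forEach_before.seq (.seq ?_ (h _ _ other).forEach_after))
  cases o
  · exact Emits.skip
  · exact h _ _ own

/-- Write a vector of truth values. -/
def emitBools {n : ℕ} (f : Fin n → Bool) : Pgm :=
  pushWord .out (encodeNats (vecCode boolCode f)).reverse

theorem emits_emitBools (c : Prop) (n : ℕ) (f : Fin n → Bool) :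
    Emits c (emitBools f) fun _ _ _ => vecCode boolCode f := emits_const _

/-- The code of the vertex that a row of the table describes, in terms of the numbers of blocks
before and after its own block. -/
def rowCode (e : RowEnv) (o : Bool) (b a : ℕ) : RowSpec → List ℕ
  | .player i f own => ((i : ℕ) + 1) :: cellsCode boolCode f own (fun _ => false) o b a
  | .chance f own other => 0 :: cellsCode fracCode (Reduction.entry e ∘ f)
      (Reduction.entry e ∘ own) (Reduction.entry e ∘ other) o b a

theorem code_toRatNode (e : RowEnv) (j : Fin e.n) (r : RowSpec) (h : r.Valid e (some j)) :
    (r.toRatNode e (some j) h).code = rowCode e true j (e.n - 1 - j) r := by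
  cases r <;> simp only [RowSpec.toRatNode, RatNode.code, vecCode_cell, rowCode]

theorem code_toRatNode_none (e : RowEnv) {b a : ℕ} (hn : b + a = e.n) (r : RowSpec)
    (h : r.Valid e none) : (r.toRatNode e none h).code = rowCode e false b a r := by
  cases r <;> simp only [RowSpec.toRatNode, RatNode.code, vecCode_cell_none _ _ _ _ hn, rowCode]

/-- Write a row of the table; `o` says whether the row belongs to a block. -/
def emitRow (o : Bool) : RowSpec → Pgm
  | .player i f own => .seq (pushWord .out (encodeNats [(i : ℕ) + 1]).reverse)
      (emitCells emitBools f own (fun _ => false) o)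
  | .chance f own other => .seq (pushWord .out (encodeNats [0]).reverse)
      (emitCells emitFracs f own other o)

theorem emits_emitRow (o : Bool) (r : RowSpec) :
    Emits True (emitRow o r) fun e b a => rowCode e o b a r := by
  cases r with
  | player i f own =>
    exact (emits_const _).seq
      (emits_emitCells (fun _ => id) boolCode emits_emitBools f own (fun _ => false) o)
  | chance f own other =>
    exact (emits_const _).seq (emits_emitCells Reduction.entry fracCode
      (fun _ _ f => emits_emitFracs f) f own other o)

end Machine


/-! ### The machine that computes the reduction -/

namespace Machine

open Computability Prog

/-- The symbol for unary numbers. -/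
def mark : Γ' := .blank

theorem digits_two_pow (a : ℕ) :
    digits (2 ^ a) = List.replicate a (.bit false) ++ [.bit true] := by
  induction a with
  | zero => simp [digits]
  | succ a ih =>
    rw [pow_succ', List.replicate_succ, List.cons_append, ← ih, digits, digits,
      Nat.bit0_bits _ (by positivity)]
    rfl

theorem runsTo_pop (k : Stk) (S : Stacks) :
    RunsTo (.pop k fun v _ => v) S (Function.update S k (S k).tail) 1 := fun v =>
  ⟨v, 1, le_rfl, .pop k (fun v _ => v) v S⟩

theorem length_le_of_exec {P : Pgm} {v v' : Reg} {S S' : Stacks} {t : ℕ} (h : P.Exec v S t v' S')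
    (k : Stk) : (S' k).length ≤ (S k).length + t := by
  induction h with
  | push k' => by_cases hk : k = k' <;> simp [hk]
  | pop k' =>
    by_cases hk : k = k'
    · subst hk; simp; omega
    · simp [hk]
  | load => simp
  | seq _ _ ih1 ih2 => omega
  | ite_true _ _ ih => omega
  | ite_false _ _ ih => omega
  | @loop_done k' f p P v S _ =>
    by_cases hk : k = k'
    · subst hk; simp; omega
    · simp [hk]
  | @loop_step k' f p P v S t v' S' t' v'' S'' _ _ _ ih1 ih2 =>
    have : (Function.update S k' (S k').tail k).length ≤ (S k).length := by
      by_cases hk : k = k'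
      · subst hk; simp
      · simp [hk]
    omega

/-- The stacks after the first `j` symbols of the input, with `c` commas among them, have been moved
to `t`. -/
def scanStacks (inp t : List Γ') (c j : ℕ) : Stacks
  | .inp => inp
  | .t₂ => t
  | .pow => List.replicate (2 * j + 1) (.bit false) ++ [.bit true]
  | .powK => List.replicate j (.bit false) ++ [.bit true]
  | .copies => digits c
  | .unaryM => List.replicate j mark
  | .unaryW => List.replicate (2 * j + 1) mark
  | .after => List.replicate c mark
  | _ => []

/-- Prepare the stacks for reading the input. -/
def setup : Pgm :=
  .seq (pushWord .pow [.bit false, .bit true]) <|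
  .seq (.push .powK fun _ => .bit true) (.push .unaryW fun _ => mark)

theorem runsTo_setup (u : List Γ') :
    RunsTo setup (Function.update (fun _ => []) .inp u) (scanStacks u [] 0 0) 5 := by
  refine ((runsTo_pushWord _ _ _).seq ((runsTo_push _ _ _).seq (runsTo_push _ _ _))).congr ?_
  funext j
  cases j <;> simp [scanStacks, digits]

/-- Count a symbol of the input. -/
def countSymbol : Pgm :=
  .seq (.push .unaryM fun _ => mark) <|
  .seq (pushWord .unaryW [mark, mark]) <|
  .seq (pushWord .pow [.bit false, .bit false]) (.push .powK fun _ => .bit false)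

theorem runsTo_countSymbol (inp t : List Γ') (c j : ℕ) :
    RunsTo countSymbol (scanStacks inp t c j) (scanStacks inp t c (j + 1)) 8 := by
  refine ((runsTo_push _ _ _).seq ((runsTo_pushWord _ _ _).seq
    ((runsTo_pushWord _ _ _).seq (runsTo_push _ _ _)))).congr ?_
  funext j
  cases j <;> simp [scanStacks, List.replicate_succ, Nat.mul_add]

/-- Count a comma. -/
def countComma : Pgm := .seq (.push .after fun _ => mark) (increment .copies)

theorem length_bits_le (n : ℕ) : n.bits.length ≤ n := by
  rw [Nat.size_eq_bits_len, Nat.size_le]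
  exact Nat.lt_two_pow_self

theorem runsTo_countComma (inp t : List Γ') (c j : ℕ) :
    RunsTo countComma (scanStacks inp t c j) (scanStacks inp t (c + 1) j) (5 * c + 8) := by
  refine (((runsTo_push _ _ _).seq (runsTo_increment (by decide) _ c rfl rfl)).mono ?_).congr ?_
  · have := length_bits_le c
    omega
  · funext j
    cases j <;> simp [scanStacks, List.replicate_succ]

/-- Process the symbol of the input in the register. -/
def scanSymbol : Pgm :=
  .seq (.push .t₂ sym) <|
  .seq (.ite (fun v => v.1 = some .comma) countComma skip) countSymbol

theorem exec_scanSymbol (x : Γ') (f : Bool) (inp t : List Γ') (c j : ℕ) :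
    ∃ v' n, n ≤ 5 * c + 18 ∧ scanSymbol.Exec (some x, f) (scanStacks inp t c j) n v'
      (scanStacks inp (x :: t) (if x = .comma then c + 1 else c) (j + 1)) := by
  have h1 : Function.update (scanStacks inp t c j) .t₂ (x :: t) = scanStacks inp (x :: t) c j := by
    funext i
    cases i <;> simp [scanStacks]
  by_cases hx : x = .comma
  · subst hx
    obtain ⟨v', n, hn, hP⟩ := ((runsTo_countComma inp (.comma :: t) c j).seq
      (runsTo_countSymbol _ _ _ _)) (some .comma, f)
    cases hP with
    | seq hA hB => exact ⟨v', _, by omega, .seq (exec_push h1) (.seq (.ite_true rfl hA) hB)⟩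
  · obtain ⟨v', n, hn, hP⟩ := runsTo_countSymbol inp (x :: t) c j (some x, f)
    rw [if_neg hx]
    exact ⟨v', 1 + (1 + 1 + n), by omega, .seq (exec_push h1)
      (.seq (.ite_false (by simpa using hx) (.load _ _ _)) hP)⟩

/-- Read the input and compute its length and the number of its commas. -/
def scan : Pgm := forPop .inp scanSymbol

theorem runsTo_scan (u : List Γ') :
    RunsTo scan (scanStacks u [] 0 0) (scanStacks [] u.reverse (u.count .comma) u.length)
      (u.length * (5 * u.length + 19) + 1) := by
  have key := runsTo_forPop .inp scanSymbol
    (fun a rest => scanStacks rest a (a.count .comma) a.length)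
    (fun a rest => a.length + rest.length = u.length) (fun a x => x :: a) u (5 * u.length + 18)
    (fun a rest => rfl)
    (fun a x rest c _ hI => by
      refine ⟨by simp at hI ⊢; omega, ?_⟩
      obtain ⟨v', n, hn, hP⟩ := exec_scanSymbol x c rest a (a.count .comma) a.length
      have h4 : a.count .comma ≤ a.length := List.count_le_length
      rw [List.length_cons] at hI
      refine ⟨v', n, by omega, ?_⟩
      convert! hP using 1
      · funext j
        cases j <;> simp [scanStacks]
      · simp only [List.count_cons, List.length_cons, beq_iff_eq]
        split_ifs <;> rfl) [] (by simp)
  rw [foldl_cons, List.append_nil, List.count_reverse, List.length_reverse] at key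
  exact key

theorem count_comma_encodeNats (l : List ℕ) : (encodeNats l).count .comma = l.length := by
  induction l with
  | nil => rfl
  | cons a l ih =>
    have : (digits a).count .comma = 0 := by
      rw [List.count_eq_zero]
      simp [digits]
    rw [encodeNats_cons, List.count_append, this, List.count_cons_self, ih, List.length_cons,
      zero_add]

/-- The stacks while the output is written: the remaining input, the output, the digits on `numD`,
and the blocks before and after the current block are variable. -/
def mainStacks (e : RowEnv) (inp out d before after : List Γ') : Stacks
  | .inp => inp
  | .out => out
  | .numK => digits e.k
  | .compK => digits (2 ^ e.m - e.k)
  | .numD => d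
  | .pow => digits (2 ^ (2 * e.m + 1))
  | .powK => digits (2 ^ e.m)
  | .copies => digits (e.n + 1)
  | .unaryM => List.replicate e.m mark
  | .unaryW => List.replicate (2 * e.m + 1) mark
  | .before => before
  | .after => after
  | _ => []

/-- Prepare the stacks for the output. -/
def prepare : Pgm :=
  .seq setup <| .seq scan <| .seq (.seq (.pop .after fun v _ => v) (move .t₂ .inp)) <|
  .seq (loadNumber .numK) (complement .unaryM .numK .compK)

open Reduction in
theorem polyRuns_prepare : PolyRuns (fun I : SqrtSumInstance => (encodeNats I.code).length) prepare
    (fun I => Function.update (fun _ => []) .inp (encodeNats I.code))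
    fun I => mainStacks (rowEnv I 0) (encodeNats I.d) [] [] []
      (List.replicate I.d.length mark) := by
  refine ⟨.C 5 * .X * .X + .C 100 * .X + .C 100, fun I => ?_⟩
  have hk : I.k.bits.length < (encodeNats I.code).length :=
    Nat.length_bits_le_encodeNats (by simp [SqrtSumInstance.code])
  have hu : encodeNats I.code = digits I.k ++ .comma :: encodeNats I.d := encodeNats_cons _ _
  have hc : (encodeNats I.code).count .comma = I.d.length + 1 := count_comma_encodeNats _
  have hs : RunsTo scan (scanStacks (encodeNats I.code) [] 0 0) (scanStacks []
      (encodeNats I.code).reverse (I.d.length + 1) (encodeNats I.code).length) _ :=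
    (runsTo_scan (encodeNats I.code)).congr (by rw [hc])
  have h1 : RunsTo (.seq (.pop .after fun v _ => v) (move .t₂ .inp))
      (scanStacks [] (encodeNats I.code).reverse (I.d.length + 1) (encodeNats I.code).length)
      (Function.update (scanStacks (encodeNats I.code) [] (I.d.length + 1)
        (encodeNats I.code).length) .after (List.replicate I.d.length mark))
      (1 + (2 * (encodeNats I.code).length + 1)) := by
    refine (((runsTo_pop .after _).seq (runsTo_move (show Stk.t₂ ≠ .inp by decide) _)).congr
      ?_).mono ?_
    · funext j
      cases j <;> simp [scanStacks]
    · simp [scanStacks]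
  have h2 := runsTo_loadNumber (show Stk.numK ≠ .t₁ by decide) (by decide)
    (Function.update (scanStacks (encodeNats I.code) [] (I.d.length + 1)
        (encodeNats I.code).length) .after (List.replicate I.d.length mark)) I.k (encodeNats I.d)
    (by simpa [scanStacks] using hu) rfl rfl
  have h3 := runsTo_complement (w := .unaryM) (d := .numK) (c := .compK) (by decide) (by decide)
    (by decide) (by decide) (Function.update (Function.update
      (Function.update (scanStacks (encodeNats I.code) [] (I.d.length + 1)
        (encodeNats I.code).length) .after (List.replicate I.d.length mark)) .inp
        (encodeNats I.d)) .numK (digits I.k)) I.k (by simp) (.inr (by simpa [scanStacks] using hk))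
    rfl rfl rfl rfl
  have h := (runsTo_setup (encodeNats I.code)).seq (hs.seq (h1.seq (h2.seq h3)))
  refine (h.mono ?_).congr ?_
  · simp [scanStacks]
    ring_nf
    omega
  · funext j
    cases j <;> simp [scanStacks, mainStacks, digits_two_pow]

theorem ready_mainStacks {e : RowEnv} (he : e.Small) (hn : e.n < e.m) (inp out : List Γ')
    {b a : List Γ'} (hb : b.length ≤ e.m) (ha : a.length ≤ e.m) :
    Ready e (Function.update (mainStacks e inp out (digits e.d) b a) .compD
      (digits (2 ^ (2 * e.m + 1) - e.d))) := by
  constructor <;> first | assumption | rfl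

/-- Run `P` with `2 ^ (2 * m + 1) - d` at its place, then forget `d`. -/
def withNumber (P : Pgm) : Pgm :=
  .seq (complement .unaryW .numD .compD) <| .seq P <| .seq (drain .numD) (drain .compD)

theorem Emits.withNumber {P : Pgm} {w : RowEnv → ℕ → ℕ → List ℕ} (h : Emits True P w) :
    ∃ q : Polynomial ℕ, ∀ e : RowEnv, e.Small → e.n < e.m → ∀ inp out b a : List Γ',
      b.length ≤ e.m → a.length ≤ e.m → RunsTo (withNumber P)
        (mainStacks e inp out (digits e.d) b a)
        (mainStacks e inp ((encodeNats (w e b.length a.length)).reverse ++ out) [] b a)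
        (q.eval e.m) := by
  obtain ⟨q, hq⟩ := h
  refine ⟨q + .C 32 * .X + .C 30, fun e he hn inp out b a hb ha => ?_⟩
  have hd : e.d.bits.length ≤ e.m := by
    rw [Nat.size_eq_bits_len, Nat.size_le]
    exact he.d_lt
  have hc : (2 ^ (2 * e.m + 1) - e.d).bits.length ≤ 2 * e.m + 2 := by
    rw [Nat.size_eq_bits_len, Nat.size_le]
    exact (Nat.sub_le _ _).trans_lt (Nat.pow_lt_pow_right (by norm_num) (by omega))
  have h1 := runsTo_complement (w := .unaryW) (d := .numD) (c := .compD) (by decide) (by decide)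
    (by decide) (by decide) (mainStacks e inp out (digits e.d) b a) e.d rfl
    (.inr (by simp [mainStacks]; omega)) rfl rfl rfl rfl
  have hlen : (mainStacks e inp out (digits e.d) b a .unaryW).length = 2 * e.m + 1 := by
    simp [mainStacks]
  rw [hlen] at h1
  refine ((h1.seq ((hq e _ (ready_mainStacks he hn inp out hb ha) fun _ => rfl).seq
    ((runsTo_drain .numD _).seq (runsTo_drain .compD _)))).mono ?_).congr ?_
  · simp [mainStacks, digits]
    omega
  · funext j
    cases j <;> simp [mainStacks]

open Reduction

/-- The numbers in the code of an instance that precede the rows of the blocks. -/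
def headCode (e : RowEnv) (b a : ℕ) : List ℕ :=
  [4] ++ ([13 + e.n * 8] ++ ([0] ++ (List.ofFn fun h => rowCode e false b a (hubRow h)).flatten))

/-- Write the numbers that precede the rows of the blocks. The number of vertices is
`8 * (n + 1) + 5`, so its last three digits are those of `5`. -/
def emitHead : Pgm :=
  .seq (pushWord .out (encodeNats [4]).reverse) <|
  .seq (emitStack [true, false, true] .copies) <|
  .seq (pushWord .out (encodeNats [0]).reverse)
    (seqAll (List.ofFn fun h => emitRow false (hubRow h)))

theorem emits_emitHead : Emits True emitHead headCode := by
  refine (emits_const _).seq ((emits_emitStack _ (by decide) (by decide) (fun e => e.n + 1)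
    (fun e => 13 + e.n * 8) (fun e S h => h.copies) (fun e => ?_) fun e S h => h.copies_le).seq
    ((emits_const _).seq (Emits.seqAll fun h => emits_emitRow false (hubRow h))))
  have : 13 + e.n * 8 = Nat.bit true (Nat.bit false (Nat.bit true (e.n + 1))) := by
    simp [Nat.bit]; ring
  rw [this, Nat.bits_append_bit _ true (fun _ => rfl), Nat.bits_append_bit _ false (by simp),
    Nat.bits_append_bit _ true (fun _ => rfl)]
  rfl

/-- The rows of a block. -/
def blockCode (e : RowEnv) (b a : ℕ) : List ℕ :=
  (List.ofFn fun c => rowCode e true b a (blockRow c)).flatten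

/-- Write the rows of a block. -/
def emitBlock : Pgm := seqAll (List.ofFn fun c => emitRow true (blockRow c))

theorem emits_emitBlock : Emits True emitBlock blockCode :=
  Emits.seqAll fun c => emits_emitRow true (blockRow c)

/-- The numbers in the code of an instance that follow the rows of the vertices. -/
def tailCode (b a : ℕ) : List ℕ :=
  (List.ofFn fun i => cellsCode boolCode (winRow i) (fun _ => false) (fun _ => false) false
    b a).flatten ++ [1, 1, 0, 1, 0, 1, 0, 1, 1, 1, 1, 1, 1, 1, 1, 1]

/-- Write the numbers that follow the rows of the vertices. -/
def emitTail : Pgm :=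
  .seq (seqAll (List.ofFn fun i => emitCells emitBools (winRow i) (fun _ => false)
      (fun _ => false) false))
    (pushWord .out (encodeNats [1, 1, 0, 1, 0, 1, 0, 1, 1, 1, 1, 1, 1, 1, 1, 1]).reverse)

theorem emits_emitTail : Emits True emitTail fun _ b a => tailCode b a :=
  (Emits.seqAll fun i => emits_emitCells (fun _ => id) boolCode emits_emitBools (winRow i)
    (fun _ => false) (fun _ => false) false).seq (emits_const _)

/-- Read an entry `d` and write the rows of its block. -/
def writeBlock : Pgm :=
  .seq (loadNumber .numD) <| .seq (withNumber emitBlock) (.push .before fun _ => mark)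

/-- The rows of the first `j` blocks. -/
def blocksCode (I : SqrtSumInstance) (j : ℕ) : List ℕ :=
  (List.range j).flatMap fun i => blockCode (rowEnv I (I.d.getD i 0)) i (I.d.length - 1 - i)

theorem length_lt_length_encodeNats (I : SqrtSumInstance) :
    I.d.length < (encodeNats I.code).length := by
  have h1 := count_comma_encodeNats I.code
  have h2 : (encodeNats I.code).count .comma ≤ (encodeNats I.code).length := List.count_le_length
  rw [h1] at h2
  exact h2

theorem polyRuns_writeBlocks :
    PolyRuns (fun x : SqrtSumInstance × List Γ' => (encodeNats x.1.code).length)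
      (forPop .after writeBlock)
      (fun x => mainStacks (rowEnv x.1 0) (encodeNats x.1.d) x.2 [] []
        (List.replicate x.1.d.length mark))
      fun x => mainStacks (rowEnv x.1 0) []
        ((encodeNats (blocksCode x.1 x.1.d.length)).reverse ++ x.2) []
        (List.replicate x.1.d.length mark) [] := by
  obtain ⟨q, hq⟩ := emits_emitBlock.withNumber
  refine ⟨.X * (q + .C 4 * .X + .C 4) + .C 1, fun ⟨I, o⟩ => ?_⟩
  have hlt := length_lt_length_encodeNats I
  have key := runsTo_forPop .after writeBlock
    (fun j rest => mainStacks (rowEnv I 0) (encodeNats (I.d.drop j))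
      ((encodeNats (blocksCode I j)).reverse ++ o) [] (List.replicate j mark) rest)
    (fun j rest => j + rest.length = I.d.length) (fun j _ => j + 1)
    (List.replicate I.d.length mark) (q.eval (encodeNats I.code).length +
      4 * (encodeNats I.code).length + 3) (fun _ _ => rfl)
    (fun j x rest c _ hI => by
      rw [List.length_cons] at hI
      refine ⟨by omega, ?_⟩
      have hj : j < I.d.length := by omega
      have hmem : I.d[j] ∈ I.d := List.getElem_mem _
      have hbits : I.d[j].bits.length < (encodeNats I.code).length :=
        Nat.length_bits_le_encodeNats (by simp [SqrtSumInstance.code])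
      have h1 := (runsTo_loadNumber (show Stk.numD ≠ .t₁ by decide) (by decide)
        (mainStacks (rowEnv I 0) (encodeNats (I.d.drop j))
          ((encodeNats (blocksCode I j)).reverse ++ o) [] (List.replicate j mark) rest) I.d[j]
        (encodeNats (I.d.drop (j + 1))) (by
          rw [List.drop_eq_getElem_cons hj]; exact encodeNats_cons _ _) rfl rfl).congr
        (S'' := mainStacks (rowEnv I I.d[j]) (encodeNats (I.d.drop (j + 1)))
          ((encodeNats (blocksCode I j)).reverse ++ o) (digits I.d[j]) (List.replicate j mark)
          rest) (by funext i; cases i <;> simp [mainStacks])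
      have h2 := hq (rowEnv I I.d[j]) (rowEnv_small (.inr hmem)) hlt
        (encodeNats (I.d.drop (j + 1))) ((encodeNats (blocksCode I j)).reverse ++ o)
        (List.replicate j mark) rest (by simp; omega) (by simp; omega)
      obtain ⟨v', t, ht, hP⟩ := (h1.seq (h2.seq (runsTo_push .before mark _))) (some x, c)
      refine ⟨v', t, ht.trans (by dsimp only; omega), ?_⟩
      convert! hP using 1
      · funext i; cases i <;> simp [mainStacks]
      · have h3 : rest.length = I.d.length - 1 - j := by omega
        have h4 : blocksCode I (j + 1) = blocksCode I j ++
            blockCode (rowEnv I I.d[j]) j rest.length := by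
          rw [blocksCode, List.range_succ, List.flatMap_append, h3]
          simp [blocksCode, hj]
        rw [h4, encodeNats_append]
        funext i; cases i <;> simp [mainStacks, List.replicate_succ]) 0 (by simp)
  have hfold : ∀ (l : List Γ') (j : ℕ), l.foldl (fun j _ => j + 1) j = j + l.length := by
    intro l
    induction l with
    | nil => simp
    | cons x l ih => intro j; rw [List.foldl_cons, ih, List.length_cons]; omega
  rw [hfold] at key
  simp only [List.length_replicate, zero_add, List.drop_zero, List.drop_length] at key
  refine key.mono ?_
  simp only [Polynomial.eval_add, Polynomial.eval_mul, Polynomial.eval_X, Polynomial.eval_C]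
  gcongr

/-- Write the code of the instance that the reduction computes, in reverse order. -/
def write : Pgm :=
  .seq prepare <| .seq (withNumber emitHead) <| .seq (forPop .after writeBlock)
    (withNumber emitTail)

theorem ofFn_eq_map_range {α : Type*} (n : ℕ) (f : ℕ → α) :
    (List.ofFn fun j : Fin n => f j) = (List.range n).map f :=
  List.ext_getElem (by simp) (by simp)

theorem code_reduction (I : SqrtSumInstance) : (reduction I).code =
    headCode (rowEnv I 0) 0 I.d.length ++ blocksCode I I.d.length ++ tailCode I.d.length 0 := by
  have h1 : vecCode RatNode.code (node I) =
      (List.ofFn fun h => rowCode (rowEnv I 0) false 0 I.d.length (hubRow h)).flatten ++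
        blocksCode I I.d.length := by
    rw [vecCode_vertices]
    congr 1
    · refine congrArg List.flatten (congrArg List.ofFn (funext fun h => ?_))
      rw [Function.comp_apply, node_hub]
      exact code_toRatNode_none (rowEnv I 0) (Nat.zero_add _) _ _
    · rw [blocksCode, List.flatMap_def, ← ofFn_eq_map_range]
      refine congrArg List.flatten (congrArg List.ofFn (funext fun j => ?_))
      refine congrArg List.flatten (congrArg List.ofFn (funext fun c => ?_))
      rw [Function.comp_apply, node_blk, List.getD_eq_getElem _ _ j.2]
      exact code_toRatNode (rowEnv I I.d[j]) j _ _
  have h2 : vecCode (vecCode boolCode) (win (n := I.d.length)) =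
      (List.ofFn fun i => cellsCode boolCode (winRow i) (fun _ => false) (fun _ => false) false
        I.d.length 0).flatten :=
    congrArg List.flatten (congrArg List.ofFn (funext fun i => vecCode_cell_none _ _ _ _ rfl))
  have h3 : (reduction I).code = [4, 13 + I.d.length * 8, ((hub I.d.length 0 : Fin _) : ℕ)] ++
      (vecCode RatNode.code (node I) ++ (vecCode (vecCode boolCode) (win (n := I.d.length)) ++
        (vecCode fracCode (fun i : Fin 4 => if i = 0 then ((1 : ℕ), (1 : ℕ+)) else (0, 1)) ++
          vecCode fracCode (fun _ : Fin 4 => ((1 : ℕ), (1 : ℕ+)))))) := rfl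
  have h4 : ((hub I.d.length 0 : Fin _) : ℕ) = 0 := rfl
  rw [h3, h1, h2, h4]
  simp [headCode, tailCode, vecCode, fracCode, List.ofFn_succ]

theorem polyRuns_write :
    PolyRuns (fun I : SqrtSumInstance => (encodeNats I.code).length) write
      (fun I => Function.update (fun _ => []) .inp (encodeNats I.code))
      fun I => mainStacks (rowEnv I 0) [] (encodeNats (reduction I).code).reverse []
        (List.replicate I.d.length mark) [] := by
  refine polyRuns_prepare.seq (PolyRuns.seq (S' := fun I => mainStacks (rowEnv I 0) (encodeNats I.d)
    (encodeNats (headCode (rowEnv I 0) 0 I.d.length)).reverse [] []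
    (List.replicate I.d.length mark)) ?_ (PolyRuns.seq
    (polyRuns_writeBlocks.comp fun I => (I, (encodeNats (headCode (rowEnv I 0) 0
      I.d.length)).reverse)) ?_))
  · obtain ⟨q, hq⟩ := emits_emitHead.withNumber
    refine ⟨q, fun I => ?_⟩
    have hlt := length_lt_length_encodeNats I
    simpa [digits] using hq (rowEnv I 0) (rowEnv_small_zero I) hlt (encodeNats I.d) [] []
      (List.replicate I.d.length mark) (by simp) (by simpa using hlt.le)
  · obtain ⟨q, hq⟩ := emits_emitTail.withNumber
    refine ⟨q, fun I => ?_⟩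
    have hlt := length_lt_length_encodeNats I
    refine (hq (rowEnv I 0) (rowEnv_small_zero I) hlt [] _
      (List.replicate I.d.length mark) [] (by simpa using hlt.le) (by simp)).congr ?_
    simp [code_reduction, encodeNats_append]

/-- Leave nothing but the output, and that in the right order. -/
def finish : Pgm :=
  .seq (move .out .res) <| .seq (drain .numK) <| .seq (drain .compK) <| .seq (drain .pow) <|
  .seq (drain .powK) <| .seq (drain .copies) <| .seq (drain .unaryM) <| .seq (drain .unaryW)
    (drain .before)

theorem runsTo_finish (e : RowEnv) (out before : List Γ') :
    RunsTo finish (mainStacks e [] out [] before [])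
      (Function.update (fun _ => []) .res out.reverse)
      (2 * (out.length + (digits e.k).length + (digits (2 ^ e.m - e.k)).length +
        (digits (2 ^ (2 * e.m + 1))).length + (digits (2 ^ e.m)).length +
        (digits (e.n + 1)).length + e.m + (2 * e.m + 1) + before.length) + 9) := by
  refine (((runsTo_move (by decide) _).seq ((runsTo_drain _ _).seq ((runsTo_drain _ _).seq
    ((runsTo_drain _ _).seq ((runsTo_drain _ _).seq ((runsTo_drain _ _).seq
    ((runsTo_drain _ _).seq ((runsTo_drain _ _).seq (runsTo_drain _ _))))))))).mono ?_).congr ?_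
  · simp [mainStacks]
    omega
  · funext j
    cases j <;> simp [mainStacks]

theorem polyRuns_finish :
    PolyRuns (fun I : SqrtSumInstance => (encodeNats I.code).length) (.seq write finish)
      (fun I => Function.update (fun _ => []) .inp (encodeNats I.code))
      fun I => Function.update (fun _ => []) .res (encodeNats (reduction I).code) := by
  refine polyRuns_write.seq ?_
  obtain ⟨q, hq⟩ := polyRuns_write
  refine ⟨.C 2 * q + .C 100 * .X + .C 100, fun I => ?_⟩
  -- a machine cannot write more symbols than it makes steps
  obtain ⟨v', t, ht, hP⟩ := hq I (none, false)
  have hout := length_le_of_exec hP .out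
  have hlt := length_lt_length_encodeNats I
  have he := rowEnv_small_zero I
  have hle : ∀ a, a ≤ 2 ^ (2 * (encodeNats I.code).length + 1) →
      (digits a).length ≤ 2 * (encodeNats I.code).length + 2 := by
    intro a ha
    rw [digits, List.length_map, Nat.size_eq_bits_len, Nat.size_le]
    exact ha.trans_lt (Nat.pow_lt_pow_right (by norm_num) (by omega))
  have hpow : 2 ^ (encodeNats I.code).length ≤ 2 ^ (2 * (encodeNats I.code).length + 1) :=
    Nat.pow_le_pow_right (by norm_num) (by omega)
  have h1 := hle I.k (he.k_lt.le.trans hpow)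
  have h2 := hle (2 ^ (encodeNats I.code).length - I.k) ((Nat.sub_le _ _).trans hpow)
  have h3 := hle _ le_rfl
  have h4 := hle _ hpow
  have h5 := hle (I.d.length + 1) (by
    have := @Nat.lt_two_pow_self (encodeNats I.code).length
    omega)
  refine ((runsTo_finish _ _ _).mono ?_).congr (by rw [List.reverse_reverse])
  simp only [mainStacks, Function.update_of_ne (show Stk.out ≠ .inp by decide), List.length_nil]
    at hout
  simp only [List.length_reverse, List.length_replicate, Polynomial.eval_add, Polynomial.eval_mul,
    Polynomial.eval_C, Polynomial.eval_X] at hout ht ⊢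
  omega

end Machine

theorem Reduction.computableInPolyTime : Nonempty (Turing.TM2ComputableInPolyTime
    sqrtSumEncoding.encode statNEEncoding.encode reduction) := by
  obtain ⟨q, hq⟩ := Machine.polyRuns_finish
  refine Prog.nonempty_computableInPolyTime
    (.seq (.seq Machine.write Machine.finish) (.load fun _ => ((none, false) : Machine.Reg)))
    Machine.Stk.inp Machine.Stk.res (none, false) _ _ _ (q + 1) fun I => ?_
  obtain ⟨v, t, ht, hP⟩ := hq I (none, false)
  refine ⟨t + 1, ?_, .seq hP (.load _ _ _)⟩
  rw [Polynomial.eval_add, Polynomial.eval_one]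
  exact Nat.add_le_add_right ht 1

theorem mainTheorem6 :
    (∃ f : SqrtSumInstance → StatNEInstance,
      IsPolyTimeReduction sqrtSumEncoding statNEEncoding SqrtSum StatNE f ∧
      ∀ I, (f I).players = 4 ∧
        ∀ i, fracVal ((f I).lower i) = (if (i : ℕ) = 0 then 1 else 0) ∧
          fracVal ((f I).upper i) = 1) ∧
    (∀ p : unitInterval, 1 / 2 ≤ (p : ℝ) → (p : ℝ) < 1 →
      IsGreatest
        {x : ℝ | ∃ σ : (gadget p).Profile,
          (gadget p).IsStationaryNash GadgetVertex.s σ ∧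
            (gadget p).payoff GadgetVertex.s σ 3 = x}
        ((√(2 - 2 * (p : ℝ)) - p + 1) / (2 * p + 2))) := by
  refine ⟨⟨reduction, ⟨Reduction.computableInPolyTime, Reduction.sqrtSum_iff_statNE⟩,
    fun I => ⟨rfl, fun i => ⟨?_, ?_⟩⟩⟩,
    isGreatest_payoff_gadget⟩
  · change fracVal (if (show Fin 4 from i) = 0 then ((1 : ℕ), (1 : ℕ+)) else (0, 1)) = _
    have : (show Fin 4 from i) = 0 ↔ (i : ℕ) = 0 := Fin.ext_iff
    simp only [this]
    split_ifs <;> simp [fracVal]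
  · change fracVal ((1 : ℕ), (1 : ℕ+)) = 1
    simp [fracVal]
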